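/- Machines are deterministic Turing machines with a read-only input tape, one read-write two-way infinite work tape, and a write-only output tape. On an ordinary (\emph{offline}) machine the input $w$ is written between two endmarkers and the input head moves in both directions between them. An \emph{online} machine is one whose input head never moves to the left. An online machine \emph{with shifted input} finds on its input tape, between the endmarkers, $|w|$ empty symbols followed by $w$. A machine \emph{decides} a language $L$ if on every input $w$ it halts with the one-bit output that tells whether $w\in L$. Space is the number of work-tape cells visited. $\mathrm{1DSPACE}'(g)$ denotes the class of all languages decided by an online machine with shifted input, with an arbitrary finite work alphabet, using $O(g(n))$ work cells on inputs of length $n$. \textbf{Corollary.} Let $f:\mathbb N\to\mathbb N$ satisfy $f(n)=\Omega(\log\log n)$, and suppose that the function $1^n\mapsto f(n)$ (with $f(n)$ written in binary) is computed by an offline machine, with some finite work alphabet, using $O(f(n)\cdot 2^{f(n)})$ work cells. Let $L$ be a language over a finite alphabet that is decided by an offline machine whose work alphabet consists of two symbols (one of which is the blank) and which uses at most $f(n)$ work cells on every input of length $n$, for all sufficiently large $n$. Then $L\in \mathrm{1DSPACE}'(f\cdot 2^f)$. -/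

import Mathlib

open Filter Asymptotics

namespace SublinearSpace

/-- One-step displacement of a head. -/
inductive Move
  | left
  | stay
  | right

/-- Symbols that can occur on the read-only input tape over the input alphabet `α`:
letters, the empty symbol, and the two endmarkers. -/
inductive InputSymbol (α : Type)
  | letter (a : α)
  | blank
  | leftEnd
  | rightEnd

/-- What a machine does in one step: go to a state, write on the scanned work cell, move the two
heads, and possibly print one bit on the (write-only) output tape. -/
structure Action (Q Γ : Type) where
  state : Q
  write : Γ
  workMove : Move
  inputMove : Move
  print : Option Bool

/-- A deterministic Turing machine with a two-way read-only input tape, one read-write work tape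
over the alphabet `Γ` (the blank is `default`), and a write-only output tape.
The machine halts when `δ` gives `none`. -/
structure Machine (α Γ : Type) where
  Q : Type
  finite_Q : Finite Q
  start : Q
  δ : Q → InputSymbol α → Γ → Option (Action Q Γ)

/-- A configuration: state, position of the input head, contents of the (two-way infinite) work
tape, position of the work head, and the bits printed so far. -/
structure Config (Q Γ : Type) where
  state : Q
  inputPos : ℕ
  work : ℤ → Γ
  workPos : ℤ
  output : List Bool

/-- Displacement of the input head on a tape with `len` cells, numbered `0, …, len - 1`;
the head cannot leave the tape. -/
def Move.onInput (len : ℕ) : Move → ℕ → ℕ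
  | .left, p => p - 1
  | .stay, p => p
  | .right, p => min (p + 1) (len - 1)

/-- Displacement of the work head. -/
def Move.onWork : Move → ℤ → ℤ
  | .left, z => z - 1
  | .stay, z => z
  | .right, z => z + 1

/-- The contents `⊢ w ⊣` of the input tape of an ordinary machine on the input `w`. -/
def plainTape {α : Type} (w : List α) : List (InputSymbol α) :=
  .leftEnd :: (w.map .letter ++ [.rightEnd])

/-- The contents of the input tape of a machine with shifted input: the input `w` is preceded by
`|w|` empty symbols. -/
def shiftedTape {α : Type} (w : List α) : List (InputSymbol α) :=
  .leftEnd :: (List.replicate w.length .blank ++ w.map .letter ++ [.rightEnd])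

namespace Machine

variable {α Γ : Type} (M : Machine α Γ)

/-- One step of the machine on the input tape `tape`; `none` if the machine has halted. -/
def step (tape : List (InputSymbol α)) (c : Config M.Q Γ) : Option (Config M.Q Γ) :=
  (M.δ c.state (tape.getD c.inputPos .rightEnd) (c.work c.workPos)).map fun a =>
    { state := a.state
      inputPos := a.inputMove.onInput tape.length c.inputPos
      work := Function.update c.work c.workPos a.write
      workPos := a.workMove.onWork c.workPos
      output := c.output ++ a.print.toList }

/-- The initial configuration: the work tape is blank, the input head is on the left endmarker. -/
def init [Inhabited Γ] : Config M.Q Γ where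
  state := M.start
  inputPos := 0
  work := fun _ => default
  workPos := 0
  output := []

/-- The work cells that are visited in the computation on the input tape `tape`. -/
def usedCells [Inhabited Γ] (tape : List (InputSymbol α)) : Set ℤ :=
  {z | ∃ c, StateTransition.Reaches (M.step tape) M.init c ∧ c.workPos = z}

/-- The computation on `tape` halts with the string `v` on the output tape. -/
def Outputs [Inhabited Γ] (tape : List (InputSymbol α)) (v : List Bool) : Prop :=
  ∃ c, StateTransition.Reaches (M.step tape) M.init c ∧ M.step tape c = none ∧ c.output = v

/-- On every input `w`, presented on the input tape as `present w`, the machine halts with output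
`F w` and uses at most `s |w|` cells of the work tape. -/
def ComputesInSpace [Inhabited Γ] (present : List α → List (InputSymbol α))
    (F : List α → List Bool) (s : ℕ → ℕ) : Prop :=
  ∀ w, M.Outputs (present w) (F w) ∧ (M.usedCells (present w)).encard ≤ s w.length

/-- A machine is online if its input head never moves to the left. -/
def IsOnline : Prop :=
  ∀ q a g, ∀ t ∈ M.δ q a g, t.inputMove ≠ Move.left

end Machine

open Classical in
/-- A language as a function with one bit of output. -/
noncomputable def indicator {α : Type} (L : Language α) (w : List α) : List Bool :=
  [decide (w ∈ L)]

/-- The binary representation of a number, most significant bit first, without leading zeros. -/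
def binary (k : ℕ) : List Bool :=
  k.bits.reverse

/-- The function `1ⁿ ↦ f(n)` (with `f(n)` in binary) is computable by an offline machine with
`O(g(n))` cells of the work tape. -/
def UnaryComputableInSpace (f g : ℕ → ℕ) : Prop :=
  ∃ (Γ : Type) (_ : Finite Γ) (_ : Inhabited Γ) (M : Machine Unit Γ) (s : ℕ → ℕ),
    (fun n => (s n : ℝ)) =O[atTop] (fun n => (g n : ℝ)) ∧
    M.ComputesInSpace plainTape (fun w => binary (f w.length)) s

/-- The language `L` is decided by an offline machine with the binary work alphabet that uses at
most `f(n)` cells of the work tape on all inputs of length `n`, for all sufficiently large `n`. -/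
def BinaryOfflineDecidable {α : Type} (L : Language α) (f : ℕ → ℕ) : Prop :=
  ∃ (M : Machine α Bool) (s : ℕ → ℕ),
    (∀ᶠ n in atTop, s n ≤ f n) ∧ M.ComputesInSpace plainTape (indicator L) s

/-- The class of the languages over `α` that are decided by online machines with shifted input
that use `O(g(n))` cells of the work tape. -/
def OneDSpacePrime (α : Type) (g : ℕ → ℕ) : Set (Language α) :=
  {L | ∃ (Γ : Type) (_ : Finite Γ) (_ : Inhabited Γ) (M : Machine α Γ) (s : ℕ → ℕ),
    M.IsOnline ∧ (fun n => (s n : ℝ)) =O[atTop] (fun n => (g n : ℝ)) ∧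
    M.ComputesInSpace shiftedTape (indicator L) s}

end SublinearSpace

namespace SublinearSpace

/-! ### Computations as sequences of configurations -/

/-! Let `M` be the offline machine for `L` and put m = f(n) + C, where the constant C covers the
finitely many exceptional lengths. An online machine cannot return to earlier input cells, so it
carries a transition table from cell to cell, as in Shepherdson's conversion of two-way into one-way
automata. For every configuration in which `M` may stand on the last cell read, the table tells in
which configuration `M` first leaves to the right, or with which bit it halts. The table of the next
cell comes from simulating `M` on that cell and replacing each excursion to the left by an old
entry; a simulation with more steps than there are configurations is in a cycle (`tableStep_spec`,
`tableRun_spec`, `scanCell_spec`). Beside the table the machine keeps the configuration in which the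
actual computation first enters the next cell, and at the right endmarker this gives the answer
(`scanState_result`).

The space bound depends on the representation of configurations. The m work cells, visited within
one window, are read as a cyclic word that starts at the scanned cell (`CycRep`). A move of the work
head is then a rotation, and its position need not be recorded. This leaves O(2^m) configurations of
O(m) bits each, so that a table has O(m 2^m) = O(f 2^f) bits. Recording the position separately
would cost another factor m.

The table can be laid out only when f(n) is known. The leading empty symbols let the machine count n
in binary, and it then runs the given machine for f with the tape 1^n replaced by the number n and a
head counter. This needs O(log n) cells in addition, and log n = O(f 2^f) does not follow from f =
Ω(log log n) when the hidden constant is small. It follows from computability by pumping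
(`IsRun.outputs_add`, `le_of_computesInSpace`): with fewer than n work configurations on 1^n, every
crossing of the tape repeats one, and the computations on n and on n + k·n! have the same output.
Then f would take the value f(n) infinitely often, although f tends to infinity.

The algorithms are written as counter programs. Registers lie in binary on parallel tracks of the
work tape, so the space is the logarithm of the largest register value (`Run.reachesIn`,
`Run.outputs`). The class `Lin` of functions with polynomially bounded registers has enough closure
properties to express both simulations. In the end all registers are polynomial in a number X with
log X = O(f 2^f). -/

theorem exists_eq_of_abs_sub_le_one {g : ℕ → ℤ} {s t : ℕ} (hst : s ≤ t)
    (hg : ∀ i, s ≤ i → i < t → |g (i + 1) - g i| ≤ 1) {v : ℤ} (h₁ : g s ≤ v) (h₂ : v ≤ g t) :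
    ∃ r, s ≤ r ∧ r ≤ t ∧ g r = v := by
  induction t, hst using Nat.le_induction with
  | base => exact ⟨s, le_rfl, le_rfl, le_antisymm h₁ h₂⟩
  | succ t hst ih =>
    by_cases h : v ≤ g t
    · obtain ⟨r, h1, h2, h3⟩ := ih (fun i hi hit => hg i hi (by omega)) h
      exact ⟨r, h1, by omega, h3⟩
    · have := abs_le.1 (hg t hst (Nat.lt_succ_self t))
      exact ⟨t + 1, by omega, le_rfl, by omega⟩

theorem exists_last {P : ℕ → Prop} (h0 : P 0) {i : ℕ} (hi : 0 < i) :
    ∃ s < i, P s ∧ ∀ r, s < r → r < i → ¬ P r := by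
  classical
  refine ⟨Nat.findGreatest P (i - 1), ?_, Nat.findGreatest_spec (Nat.zero_le _) h0, ?_⟩
  · have := Nat.findGreatest_le (P := P) (i - 1); omega
  · intro r h1 h2
    exact Nat.findGreatest_is_greatest h1 (by omega)

/-- `c 0, …, c T` is a complete computation of `M`. -/
structure IsRun {α Γ : Type} [Inhabited Γ] (M : Machine α Γ) (tape : List (InputSymbol α))
    (c : ℕ → Config M.Q Γ) (T : ℕ) : Prop where
  zero : c 0 = M.init
  step : ∀ i < T, M.step tape (c i) = some (c (i + 1))
  halt : M.step tape (c T) = none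

theorem Machine.Outputs.exists_isRun {α Γ : Type} [Inhabited Γ] {M : Machine α Γ}
    {tape : List (InputSymbol α)} {v : List Bool} (h : M.Outputs tape v) :
    ∃ c T, IsRun M tape c T ∧ (c T).output = v := by
  obtain ⟨d, hd, hn, hv⟩ := h
  have key : ∀ a, StateTransition.Reaches (M.step tape) a d → ∃ (c : ℕ → Config M.Q Γ) (T : ℕ),
      c 0 = a ∧ c T = d ∧ ∀ i < T, M.step tape (c i) = some (c (i + 1)) := by
    intro a ha
    induction ha using Relation.ReflTransGen.head_induction_on with
    | refl => exact ⟨fun _ => d, 0, rfl, rfl, fun i hi => absurd hi (Nat.not_lt_zero i)⟩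
    | @head a a' hstep _ ih =>
      obtain ⟨c, T, h1, h2, h3⟩ := ih
      refine ⟨fun i => Nat.casesOn i a c, T + 1, rfl, h2, fun i hi => ?_⟩
      cases i with
      | zero => simpa [h1] using hstep
      | succ i => exact h3 i (by omega)
  obtain ⟨c, T, h1, h2, h3⟩ := key _ hd
  exact ⟨c, T, ⟨h1, h3, h2 ▸ hn⟩, h2 ▸ hv⟩

section

variable {α Γ : Type} {M : Machine α Γ} {tape : List (InputSymbol α)}

theorem step_workPos {c c' : Config M.Q Γ} (h : M.step tape c = some c') :
    |c'.workPos - c.workPos| ≤ 1 := by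
  unfold Machine.step at h
  obtain ⟨a, -, rfl⟩ := Option.map_eq_some_iff.1 h
  cases h : a.workMove <;> simp [h, Move.onWork]

theorem step_work_of_ne {c c' : Config M.Q Γ} (h : M.step tape c = some c') {z : ℤ}
    (hz : z ≠ c.workPos) : c'.work z = c.work z := by
  unfold Machine.step at h
  obtain ⟨a, -, rfl⟩ := Option.map_eq_some_iff.1 h
  exact Function.update_of_ne hz _ _

theorem step_output {c c' : Config M.Q Γ} (h : M.step tape c = some c') :
    c.output <+: c'.output := by
  unfold Machine.step at h
  obtain ⟨a, -, rfl⟩ := Option.map_eq_some_iff.1 h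
  exact List.prefix_append _ _

theorem step_inputPos_le {c c' : Config M.Q Γ} (h : M.step tape c = some c')
    (hc : c.inputPos ≤ tape.length - 1) : c'.inputPos ≤ tape.length - 1 := by
  unfold Machine.step at h
  obtain ⟨a, -, rfl⟩ := Option.map_eq_some_iff.1 h
  cases h : a.inputMove <;> simp [h, Move.onInput] <;> omega

variable [Inhabited Γ] {c : ℕ → Config M.Q Γ} {T : ℕ}

theorem IsRun.reaches (h : IsRun M tape c T) {i : ℕ} (hi : i ≤ T) :
    StateTransition.Reaches (M.step tape) M.init (c i) := by
  induction i with
  | zero => rw [h.zero]; exact Relation.ReflTransGen.refl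
  | succ i ih => exact (ih (by omega)).tail (h.step i (by omega))

theorem IsRun.inputPos_le (h : IsRun M tape c T) {i : ℕ} (hi : i ≤ T) :
    (c i).inputPos ≤ tape.length - 1 := by
  induction i with
  | zero => rw [h.zero]; exact Nat.zero_le _
  | succ i ih => exact step_inputPos_le (h.step i (by omega)) (ih (by omega))

theorem IsRun.isPrefix_output (h : IsRun M tape c T) {i : ℕ} (hi : i ≤ T) :
    (c i).output <+: (c T).output := by
  induction hi using Nat.decreasingInduction with
  | self => exact List.prefix_rfl
  | of_succ i hi ih => exact (step_output (h.step i hi)).trans ih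

theorem IsRun.work_eq_default (h : IsRun M tape c T) {i : ℕ} (hi : i ≤ T) {z : ℤ}
    (hz : ∀ j ≤ T, (c j).workPos ≠ z) : (c i).work z = default := by
  induction i with
  | zero => rw [h.zero]; rfl
  | succ i ih =>
    rw [step_work_of_ne (h.step i (by omega)) (hz i (by omega)).symm, ih (by omega)]

/-- The visited work cells lie in a window whose length is the number of visited cells. -/
theorem IsRun.exists_window (h : IsRun M tape c T) {S : ℕ}
    (hS : (M.usedCells tape).encard ≤ S) :
    ∃ lo : ℤ, ∀ i ≤ T, lo ≤ (c i).workPos ∧ (c i).workPos < lo + S := by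
  set V : Finset ℤ := (Finset.range (T + 1)).image fun i => (c i).workPos with hV
  have hne : V.Nonempty := ⟨_, Finset.mem_image_of_mem _ (Finset.mem_range.2 (Nat.succ_pos T))⟩
  have hmem : ∀ i ≤ T, (c i).workPos ∈ V := fun i hi =>
    Finset.mem_image_of_mem (fun i => (c i).workPos) (Finset.mem_range.2 (by omega))
  have hcard : V.card ≤ S := by
    have : (V : Set ℤ) ⊆ M.usedCells tape := by
      intro z hz
      obtain ⟨i, hi, rfl⟩ := Finset.mem_image.1 (Finset.mem_coe.1 hz)
      exact ⟨c i, h.reaches (by simpa [Nat.lt_succ_iff] using hi), rfl⟩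
    have := (Set.encard_le_encard this).trans hS
    rw [Set.encard_coe_eq_coe_finsetCard] at this
    exact_mod_cast this
  obtain ⟨i, hi, hi'⟩ := Finset.mem_image.1 (V.min'_mem hne)
  obtain ⟨j, hj, hj'⟩ := Finset.mem_image.1 (V.max'_mem hne)
  have hstep : ∀ r < T, |(c (r + 1)).workPos - (c r).workPos| ≤ 1 := fun r hr =>
    step_workPos (h.step r hr)
  -- The work head moves by at most one cell, so the visited positions fill the whole interval
  -- between their minimum and maximum.
  have hsub : Finset.Icc (V.min' hne) (V.max' hne) ⊆ V := by
    intro z hz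
    obtain ⟨h1, h2⟩ := Finset.mem_Icc.1 hz
    simp only [Finset.mem_range] at hi hj
    rcases le_total i j with hij | hij
    · obtain ⟨r, -, hr, rfl⟩ := exists_eq_of_abs_sub_le_one (g := fun i => (c i).workPos) hij
        (fun r _ hr => hstep r (by omega)) (hi'.le.trans h1) (h2.trans hj'.ge)
      exact hmem r (by omega)
    -- When the maximum is visited before the minimum, the intermediate value argument is applied to
    -- the negated position.
    · obtain ⟨r, -, hr, hz⟩ := exists_eq_of_abs_sub_le_one (g := fun i => -(c i).workPos)
        (v := -z) hij (fun r _ hr => by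
          have := hstep r (by omega)
          rwa [← abs_neg, neg_sub_neg, neg_sub]) (by simp only [hj']; omega)
          (by simp only [hi']; omega)
      rw [show z = (c r).workPos by simp at hz; exact hz.symm]
      exact hmem r (by omega)
  have hlen := (Finset.card_le_card hsub).trans hcard
  rw [Int.card_Icc] at hlen
  refine ⟨V.min' hne, fun r hr => ⟨V.min'_le _ (hmem r hr), ?_⟩⟩
  have := V.le_max' _ (hmem r hr)
  omega

end

/-! ### Pumping the input of a machine with a unary input alphabet -/

/-- The unary input of length `n`. -/
def unaryTape (n : ℕ) : List (InputSymbol Unit) := plainTape (List.replicate n ())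

theorem length_unaryTape (n : ℕ) : (unaryTape n).length = n + 2 := by simp [unaryTape, plainTape]

theorem getD_unaryTape (n p : ℕ) : (unaryTape n).getD p .rightEnd =
    if p = 0 then .leftEnd else if p ≤ n then .letter () else .rightEnd := by
  unfold unaryTape plainTape
  cases p with
  | zero => rfl
  | succ p =>
    simp only [List.getD_cons_succ, List.map_replicate]
    by_cases h : p < n
    · rw [List.getD_append _ _ _ _ (by simpa)]
      simp [List.getD_replicate, h, Nat.succ_le_iff]
    · rw [List.getD_append_right _ _ _ _ (by simpa using h)]
      simp only [List.length_replicate, Nat.succ_le_iff, h]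
      cases p - n <;> simp

/-- A configuration with another position of the input head. -/
def Config.setPos {Q Γ : Type} (c : Config Q Γ) (p : ℕ) : Config Q Γ := { c with inputPos := p }

/-- A configuration with the input head moved by `e` cells. -/
def Config.shift {Q Γ : Type} (c : Config Q Γ) (e : ℤ) : Config Q Γ :=
  c.setPos (c.inputPos + e).toNat

theorem Config.shift_eq_shift {Q Γ : Type} {c c' : Config Q Γ} (h : c.setPos 0 = c'.setPos 0)
    {e e' : ℤ} (he : c.inputPos + e = c'.inputPos + e') : c.shift e = c'.shift e' := by
  cases c
  cases c'
  simp only [Config.setPos, Config.mk.injEq] at h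
  simp only at he
  simp [Config.shift, Config.setPos, h, he]

/-- The head positions `p` on `unaryTape n` and `p + e` on `unaryTape n'` are of the same kind. -/
def Agree (n n' : ℕ) (e : ℤ) (p : ℕ) : Prop :=
  p ≤ n + 1 ∧ 0 ≤ p + e ∧ p + e ≤ n' + 1 ∧ (p = 0 ↔ p + e = 0) ∧ (p = n + 1 ↔ p + e = n' + 1)

theorem Agree.getD_eq {n n' p : ℕ} {e : ℤ} (h : Agree n n' e p) :
    (unaryTape n').getD (p + e).toNat .rightEnd = (unaryTape n).getD p .rightEnd := by
  obtain ⟨h1, h2, h3, h4, h5⟩ := h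
  rw [getD_unaryTape, getD_unaryTape]
  split_ifs <;> first | rfl | omega

section

variable {Γ : Type} {M : Machine Unit Γ} {n n' : ℕ} {e : ℤ}

/-- The transition depends only on the scanned symbols, and `Agree` preserves the kind of the input
cell. Since endmarkers correspond to endmarkers, the clipping of the head move is the same on both
tapes. -/
theorem step_shift {c c' : Config M.Q Γ} (h : M.step (unaryTape n) c = some c')
    (ha : Agree n n' e c.inputPos) :
    M.step (unaryTape n') (c.shift e) = some (c'.shift e) := by
  unfold Machine.step at h ⊢
  have hs : (unaryTape n').getD (c.shift e).inputPos .rightEnd =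
    (unaryTape n).getD c.inputPos .rightEnd := ha.getD_eq
  obtain ⟨a, hδ, rfl⟩ := Option.map_eq_some_iff.1 h
  rw [hs]
  show Option.map _ (M.δ c.state _ (c.work c.workPos)) = _
  rw [hδ, Option.map_some, length_unaryTape, length_unaryTape]
  congr 1
  obtain ⟨h1, h2, h3, h4, h5⟩ := ha
  have : a.inputMove.onInput (n' + 2) (c.inputPos + e).toNat =
      (a.inputMove.onInput (n + 2) c.inputPos + e).toNat := by
    cases a.inputMove <;> simp only [Move.onInput] <;> omega
  simp only [Config.shift, Config.setPos, Config.mk.injEq, true_and, and_true]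
  exact this

theorem step_shift_none {c : Config M.Q Γ} (h : M.step (unaryTape n) c = none)
    (ha : Agree n n' e c.inputPos) : M.step (unaryTape n') (c.shift e) = none := by
  unfold Machine.step at h ⊢
  have hs : (unaryTape n').getD (c.shift e).inputPos .rightEnd =
    (unaryTape n).getD c.inputPos .rightEnd := ha.getD_eq
  rw [hs]
  rw [Option.map_eq_none_iff] at h ⊢
  exact h

variable {c : ℕ → Config M.Q Γ} {T : ℕ}

theorem reaches_shift (hc : ∀ i < T, M.step (unaryTape n) (c i) = some (c (i + 1))) {a b : ℕ}
    (hab : a ≤ b) (hb : b ≤ T) (h : ∀ r, a ≤ r → r < b → Agree n n' e (c r).inputPos) :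
    StateTransition.Reaches (M.step (unaryTape n')) ((c a).shift e) ((c b).shift e) := by
  induction b, hab using Nat.le_induction with
  | base => exact Relation.ReflTransGen.refl
  | succ b hab ih =>
    exact (ih (by omega) fun r h1 h2 => h r h1 (by omega)).tail
      (step_shift (hc b (by omega)) (h b hab (Nat.lt_succ_self b)))

/-- The segment from `a` to `b` reproduces everything except the head position, which changes by
`δ`. It can therefore be replayed, each time with offset larger by `δ`, as long as the offsets stay
in `[0, d]`, where interior cells remain interior. -/
theorem reaches_shift_loop (hc : ∀ i < T, M.step (unaryTape n) (c i) = some (c (i + 1)))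
    {a b d : ℕ} (hab : a ≤ b) (hb : b ≤ T) (hcore : (c a).setPos 0 = (c b).setPos 0)
    (hin : ∀ r, a ≤ r → r < b → 1 ≤ (c r).inputPos ∧ (c r).inputPos ≤ n) {δ : ℤ}
    (hδ : δ = (c b).inputPos - (c a).inputPos) (l : ℕ)
    (he : ∀ i < l, 0 ≤ e + i * δ ∧ e + i * δ ≤ d) :
    StateTransition.Reaches (M.step (unaryTape (n + d))) ((c a).shift e)
      ((c a).shift (e + l * δ)) := by
  induction l with
  | zero => simp only [Nat.cast_zero, zero_mul, add_zero]; exact Relation.ReflTransGen.refl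
  | succ l ih =>
    refine (ih fun i hi => he i (by omega)).trans ?_
    obtain ⟨h1, h2⟩ := he l (Nat.lt_succ_self l)
    have := reaches_shift (e := e + l * δ) (n' := n + d) hc hab hb fun r hr hr' => by
      obtain ⟨h3, h4⟩ := hin r hr hr'
      generalize (l : ℤ) * δ = x at *
      refine ⟨?_, ?_, ?_, ?_, ?_⟩ <;> push_cast <;> omega
    rwa [Config.shift_eq_shift (c := c b) hcore.symm (e' := e + (l + 1 : ℕ) * δ)
      (by push_cast; rw [hδ]; ring)] at this

/-- Pigeonhole on the times at which the positions 1, …, n are first reached. Taking first visits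
makes these times increase with the position, so the repetition is a net advance. `g` is the head
position or its mirror image, which treats both directions of a crossing. -/
theorem exists_repetition {X : Type} {x : ℕ → X} {g : ℕ → ℤ} {s t : ℕ} (hst : s ≤ t)
    (hg : ∀ i, s ≤ i → i < t → |g (i + 1) - g i| ≤ 1) (hs : g s = 0) (ht : g t = n + 1)
    {F : Finset X} (hF : F.card < n) (hx : ∀ i, s ≤ i → i ≤ t → x i ∈ F) :
    ∃ a b, s ≤ a ∧ a < b ∧ b ≤ t ∧ x a = x b ∧ 1 ≤ g a ∧ g a < g b ∧ g b ≤ n := by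
  classical
  have hex : ∀ j : ℕ, j ≤ n → ∃ r, s ≤ r ∧ r ≤ t ∧ g r = j := fun j hj =>
    exists_eq_of_abs_sub_le_one hst hg (by omega) (by omega)
  let τ : ℕ → ℕ := fun j => if hj : j ≤ n then Nat.find (hex j hj) else 0
  have hτ : ∀ j, j ≤ n → s ≤ τ j ∧ τ j ≤ t ∧ g (τ j) = j := fun j hj => by
    simp only [τ, dif_pos hj]
    exact Nat.find_spec (hex j hj)
  have hlt : ∀ i j, i < j → j ≤ n → τ i < τ j := fun i j hij hj => by
    obtain ⟨h1, h2, h3⟩ := hτ j hj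
    obtain ⟨r, hr1, hr2, hr3⟩ := exists_eq_of_abs_sub_le_one h1
      (fun i hi hi' => hg i hi (by omega)) (v := i) (by omega) (by omega)
    have h4 : τ i ≤ r := by
      simp only [τ, dif_pos (hij.le.trans hj)]
      exact Nat.find_min' _ ⟨hr1, hr2.trans h2, hr3⟩
    have h5 : g (τ i) = i := (hτ i (hij.le.trans hj)).2.2
    refine lt_of_le_of_ne (h4.trans hr2) fun h => ?_
    rw [h, h3] at h5
    omega
  obtain ⟨i, hi, j, hj, hij, hx'⟩ := Finset.exists_ne_map_eq_of_card_lt_of_maps_to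
    (s := Finset.Icc 1 n) (t := F) (f := fun j => x (τ j)) (by simpa using hF) (fun j hj => by
      have := hτ j (Finset.mem_Icc.1 hj).2
      exact hx _ this.1 this.2.1)
  obtain ⟨hi1, hi2⟩ := Finset.mem_Icc.1 hi
  obtain ⟨hj1, hj2⟩ := Finset.mem_Icc.1 hj
  have hi3 := hτ i hi2
  have hj3 := hτ j hj2
  rcases lt_or_gt_of_ne hij with h | h
  · exact ⟨τ i, τ j, hi3.1, hlt i j h hj2, hj3.2.1, hx', by omega, by omega, by omega⟩
  · exact ⟨τ j, τ i, hj3.1, hlt j i h hi2, hi3.2.1, hx'.symm, by omega, by omega, by omega⟩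

end

/-- If a computation on `1ⁿ` has fewer than `n` different work configurations, then `n` can be
increased by any number that all of `1, …, n` divide. -/
theorem IsRun.outputs_add {Γ : Type} [Inhabited Γ] {M : Machine Unit Γ} {n : ℕ}
    {c : ℕ → Config M.Q Γ} {T : ℕ} (hc : IsRun M (unaryTape n) c T)
    {F : Finset (Config M.Q Γ)} (hF : F.card < n) (hcF : ∀ i ≤ T, (c i).setPos 0 ∈ F)
    {d : ℕ} (hd : ∀ k, 1 ≤ k → k ≤ n → k ∣ d) :
    M.Outputs (unaryTape (n + d)) (c T).output := by
  have hpos : ∀ i ≤ T, (c i).inputPos ≤ n + 1 := fun i hi => by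
    simpa [length_unaryTape] using hc.inputPos_le hi
  have hstep : ∀ i < T, |((c (i + 1)).inputPos : ℤ) - (c i).inputPos| ≤ 1 := fun i hi => by
    have h := hc.step i hi
    have hp := hpos i hi.le
    unfold Machine.step at h
    obtain ⟨a, -, h'⟩ := Option.map_eq_some_iff.1 h
    rw [← h', length_unaryTape, abs_le]
    cases a.inputMove <;> simp only [Move.onInput] <;> omega
  let E : ℕ → Prop := fun i => (c i).inputPos = 0 ∨ (c i).inputPos = n + 1
  have hE0 : E 0 := Or.inl (by rw [hc.zero]; rfl)
  have hin : ∀ {s t : ℕ}, t ≤ T + 1 → (∀ r, s < r → r < t → ¬ E r) → ∀ r, s < r → r < t →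
      1 ≤ (c r).inputPos ∧ (c r).inputPos ≤ n := fun ht h r hr hr' => by
    have h1 := h r hr hr'
    have h2 := hpos r (by omega)
    simp only [E] at h1
    omega
  -- Within a segment that starts at an endmarker and meets no other one.
  have hseg : ∀ {s t : ℕ} {e : ℤ}, s ≤ t → t ≤ T →
      (∀ r, s < r → r < t → 1 ≤ (c r).inputPos ∧ (c r).inputPos ≤ n) →
      ((c s).inputPos = 0 ∧ e = 0 ∨ (c s).inputPos = n + 1 ∧ e = d) →
      StateTransition.Reaches (M.step (unaryTape (n + d))) ((c s).shift e) ((c t).shift e) := by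
    intro s t e hst ht hin hs
    refine reaches_shift hc.step hst ht fun r hr hr' => ?_
    rcases hr.eq_or_lt with rfl | hr
    · rcases hs with ⟨h1, rfl⟩ | ⟨h1, rfl⟩ <;> refine ⟨?_, ?_, ?_, ?_, ?_⟩ <;> push_cast <;> omega
    · have := hin r hr hr'
      rcases hs with ⟨h1, rfl⟩ | ⟨h1, rfl⟩ <;> refine ⟨?_, ?_, ?_, ?_, ?_⟩ <;> push_cast <;> omega
  have hseg' : ∀ {s t : ℕ} {e : ℤ}, s ≤ t → t ≤ T →
      (∀ r, s ≤ r → r < t → 1 ≤ (c r).inputPos ∧ (c r).inputPos ≤ n) → (e = 0 ∨ e = d) →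
      StateTransition.Reaches (M.step (unaryTape (n + d))) ((c s).shift e) ((c t).shift e) := by
    intro s t e hst ht hin hs
    refine reaches_shift hc.step hst ht fun r hr hr' => ?_
    have := hin r hr hr'
    rcases hs with rfl | rfl <;> refine ⟨?_, ?_, ?_, ?_, ?_⟩ <;> push_cast <;> omega
  -- Only the times on an endmarker are matched: the left one with offset 0, the right one with
  -- offset `d`. The induction goes back to the last earlier visit `s` to an endmarker. A segment
  -- that returns to the same endmarker is copied; one that crosses the tape has to be pumped.
  have main : ∀ i ≤ T,
      ((c i).inputPos = 0 → StateTransition.Reaches (M.step (unaryTape (n + d))) M.init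
        ((c i).shift 0)) ∧
      ((c i).inputPos = n + 1 → StateTransition.Reaches (M.step (unaryTape (n + d))) M.init
        ((c i).shift d)) := by
    intro i
    induction i using Nat.strong_induction_on with
    | _ i ih =>
      intro hi
      rcases Nat.eq_zero_or_pos i with rfl | hi0
      · rw [hc.zero]
        exact ⟨fun _ => Relation.ReflTransGen.refl, fun h => absurd h (Nat.succ_ne_zero n).symm⟩
      · obtain ⟨s, hs, hsE, hs'⟩ := exists_last hE0 hi0
        have hin' := hin (by omega) hs'
        obtain ⟨ihl, ihr⟩ := ih s hs (by omega)
        constructor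
        · intro hp
          rcases hsE with hs0 | hs0
          · exact (ihl hs0).trans (hseg hs.le hi hin' (Or.inl ⟨hs0, rfl⟩))
          · obtain ⟨a, b, h1, h2, h3, h4, h5, h6, h7⟩ := exists_repetition (n := n)
              (x := fun i => (c i).setPos 0) (g := fun i => (n + 1 : ℤ) - (c i).inputPos) hs.le
              (fun r _ hr => by
                have := hstep r (by omega)
                rw [← abs_neg]
                convert this using 2
                ring) (by simp [hs0]) (by simp [hp]) hF
              (fun r _ hr => hcF r (by omega))
            have ha : s ≠ a := by rintro rfl; omega
            have hb : b ≠ i := by rintro rfl; omega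
            -- The loop has displacement between 1 and `n`, hence dividing `d`. Replaying it `k`
            -- more times changes the offset from `d` to 0, after which the rest of the crossing is
            -- copied.
            obtain ⟨k, hk⟩ := hd ((c a).inputPos - (c b).inputPos) (by omega) (by omega)
            refine (ihr hs0).trans ((hseg h1 (by omega) (fun r hr hr' => hin' r hr (by omega))
              (Or.inr ⟨hs0, rfl⟩)).trans (Relation.ReflTransGen.trans ?_
              (hseg' (s := a) (by omega) hi (fun r hr hr' => hin' r (by omega) hr')
              (Or.inl rfl))))
            have hk' : (d : ℤ) = ((c a).inputPos - (c b).inputPos : ℤ) * k := by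
              rw [hk]; push_cast [show (c b).inputPos ≤ (c a).inputPos by omega]; ring
            have := reaches_shift_loop (d := d) (e := d) hc.step h2.le (by omega) h4
              (fun r hr hr' => hin' r (by omega) (by omega)) rfl k (fun j hj => by
                have : (j : ℤ) ≤ k := by omega
                constructor <;> nlinarith)
            rwa [show (d : ℤ) + k * ((c b).inputPos - (c a).inputPos : ℤ) = 0 by
              rw [hk']; ring] at this
        · intro hp
          rcases hsE with hs0 | hs0
          · obtain ⟨a, b, h1, h2, h3, h4, h5, h6, h7⟩ := exists_repetition (n := n)
              (x := fun i => (c i).setPos 0) (g := fun i => (c i).inputPos) hs.le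
              (fun r _ hr => hstep r (by omega)) (by simp [hs0]) (by simp [hp]) hF
              (fun r _ hr => hcF r (by omega))
            have ha : s ≠ a := by rintro rfl; omega
            have hb : b ≠ i := by rintro rfl; omega
            -- The mirror case: `k` extra rounds change the offset from 0 to `d`.
            obtain ⟨k, hk⟩ := hd ((c b).inputPos - (c a).inputPos) (by omega) (by omega)
            refine (ihl hs0).trans ((hseg h1 (by omega) (fun r hr hr' => hin' r hr (by omega))
              (Or.inl ⟨hs0, rfl⟩)).trans (Relation.ReflTransGen.trans ?_
              (hseg' (s := a) (by omega) hi (fun r hr hr' => hin' r (by omega) hr')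
              (Or.inr rfl))))
            have hk' : (d : ℤ) = ((c b).inputPos - (c a).inputPos : ℤ) * k := by
              rw [hk]; push_cast [show (c a).inputPos ≤ (c b).inputPos by omega]; ring
            have := reaches_shift_loop (d := d) (e := 0) hc.step h2.le (by omega) h4
              (fun r hr hr' => hin' r (by omega) (by omega)) rfl k (fun j hj => by
                have : (j : ℤ) ≤ k := by omega
                constructor <;> nlinarith)
            rwa [show (0 : ℤ) + k * ((c b).inputPos - (c a).inputPos : ℤ) = d by
              rw [hk']; ring] at this
          · exact (ihr hs0).trans (hseg hs.le hi hin' (Or.inr ⟨hs0, rfl⟩))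
  obtain ⟨s, hs, hsE, hs'⟩ := exists_last hE0 (Nat.succ_pos T)
  have hin' := hin le_rfl hs'
  have hsT : s = T ∨ s < T := by omega
  have hT : ∀ e : ℤ, ((c s).inputPos = 0 ∧ e = 0 ∨ (c s).inputPos = n + 1 ∧ e = d) →
      Agree n (n + d) e (c T).inputPos := by
    intro e he
    have hp := hpos T le_rfl
    rcases hsT with rfl | h
    · rcases he with ⟨h1, rfl⟩ | ⟨h1, rfl⟩ <;> refine ⟨?_, ?_, ?_, ?_, ?_⟩ <;> push_cast <;> omega
    · have := hin' T h (Nat.lt_succ_self T)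
      rcases he with ⟨h1, rfl⟩ | ⟨h1, rfl⟩ <;> refine ⟨?_, ?_, ?_, ?_, ?_⟩ <;> push_cast <;> omega
  have hout : ∀ e : ℤ, ((c s).inputPos = 0 ∧ e = 0 ∨ (c s).inputPos = n + 1 ∧ e = d) →
      StateTransition.Reaches (M.step (unaryTape (n + d))) M.init ((c s).shift e) →
      M.Outputs (unaryTape (n + d)) (c T).output := fun e he h =>
    ⟨(c T).shift e, h.trans (hseg (by omega) le_rfl (fun r hr hr' => hin' r hr (by omega)) he),
      step_shift_none hc.halt (hT e he), rfl⟩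
  rcases hsE with h | h
  · exact hout 0 (Or.inl ⟨h, rfl⟩) ((main s (by omega)).1 h)
  · exact hout d (Or.inr ⟨h, rfl⟩) ((main s (by omega)).2 h)

/-! ### Register programs -/

/-- Structured programs over registers holding natural numbers, with one-way access to the
input tape. -/
inductive Prog (α : Type) : Type
  | skip
  | inc (r : ℕ)
  | dec (r : ℕ)
  | seq (p q : Prog α)
  | loop (r : ℕ) (p : Prog α)
  | ifz (r : ℕ) (p q : Prog α)
  | switch (f : InputSymbol α → Prog α)
  | advance
  | print (b : Bool)

/-- The data a register program works on. -/
@[ext] structure World where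
  regs : ℕ → ℕ
  ipos : ℕ
  out : List Bool

/-- Big-step semantics of register programs in which registers never grow beyond `B`. -/
inductive Run {α : Type} (tape : List (InputSymbol α)) (B : ℕ) : Prog α → World → World → Prop
  | skip (w) : Run tape B .skip w w
  | inc (r) (w : World) : w.regs r + 1 ≤ B →
      Run tape B (.inc r) w { w with regs := Function.update w.regs r (w.regs r + 1) }
  | dec (r) (w : World) : w.regs r ≠ 0 →
      Run tape B (.dec r) w { w with regs := Function.update w.regs r (w.regs r - 1) }
  | seq {p q w₁ w₂ w₃} : Run tape B p w₁ w₂ → Run tape B q w₂ w₃ → Run tape B (.seq p q) w₁ w₃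
  | loop_done {r p} {w : World} : w.regs r = 0 → Run tape B (.loop r p) w w
  | loop_step {r p} {w₁ w₂ w₃ : World} : w₁.regs r ≠ 0 → Run tape B p w₁ w₂ →
      Run tape B (.loop r p) w₂ w₃ → Run tape B (.loop r p) w₁ w₃
  | ifz_zero {r p q} {w₁ w₂ : World} : w₁.regs r = 0 → Run tape B p w₁ w₂ →
      Run tape B (.ifz r p q) w₁ w₂
  | ifz_pos {r p q} {w₁ w₂ : World} : w₁.regs r ≠ 0 → Run tape B q w₁ w₂ →
      Run tape B (.ifz r p q) w₁ w₂
  | switch {f} {w₁ w₂ : World} : Run tape B (f (tape.getD w₁.ipos .rightEnd)) w₁ w₂ →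
      Run tape B (.switch f) w₁ w₂
  | advance (w : World) :
      Run tape B .advance w { w with ipos := Move.right.onInput tape.length w.ipos }
  | print (b) (w : World) : Run tape B (.print b) w { w with out := w.out ++ [b] }

/-- All registers of the program are among the first `k + 1`. -/
def Prog.UsesUpTo {α : Type} (k : ℕ) : Prog α → Prop
  | .skip => True
  | .inc r => r ≤ k
  | .dec r => r ≤ k
  | .seq p q => p.UsesUpTo k ∧ q.UsesUpTo k
  | .loop r p => r ≤ k ∧ p.UsesUpTo k
  | .ifz r p q => r ≤ k ∧ p.UsesUpTo k ∧ q.UsesUpTo k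
  | .switch f => ∀ a, (f a).UsesUpTo k
  | .advance => True
  | .print _ => True

theorem Prog.UsesUpTo.mono {α : Type} {k l : ℕ} (h : k ≤ l) {p : Prog α} (hp : p.UsesUpTo k) :
    p.UsesUpTo l := by
  induction p with
  | skip => trivial
  | inc r => exact le_trans hp h
  | dec r => exact le_trans hp h
  | seq p q ihp ihq => exact ⟨ihp hp.1, ihq hp.2⟩
  | loop r p ih => exact ⟨hp.1.trans h, ih hp.2⟩
  | ifz r p q ihp ihq => exact ⟨hp.1.trans h, ihp hp.2.1, ihq hp.2.2⟩
  | switch f ih => exact fun a => ih a (hp a)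
  | advance => trivial
  | print b => trivial

instance {α : Type} [Finite α] : Finite (InputSymbol α) :=
  Finite.of_injective
    (fun a : InputSymbol α => (match a with
      | .letter a => .inl a
      | .blank => .inr 0
      | .leftEnd => .inr 1
      | .rightEnd => .inr 2 : α ⊕ Fin 3))
    (by intro a b h; cases a <;> cases b <;> simp_all)

/-- Finiteness of the input alphabet is needed for `switch`, which has one branch for each input
symbol. -/
theorem Prog.exists_usesUpTo {α : Type} [Finite α] (p : Prog α) : ∃ k, p.UsesUpTo k := by
  induction p with
  | skip => exact ⟨0, trivial⟩
  | inc r => exact ⟨r, le_refl r⟩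
  | dec r => exact ⟨r, le_refl r⟩
  | seq p q ihp ihq =>
    obtain ⟨k, hk⟩ := ihp
    obtain ⟨l, hl⟩ := ihq
    exact ⟨max k l, hk.mono (le_max_left _ _), hl.mono (le_max_right _ _)⟩
  | loop r p ih =>
    obtain ⟨k, hk⟩ := ih
    exact ⟨max r k, le_max_left _ _, hk.mono (le_max_right _ _)⟩
  | ifz r p q ihp ihq =>
    obtain ⟨k, hk⟩ := ihp
    obtain ⟨l, hl⟩ := ihq
    exact ⟨max r (max k l), le_max_left _ _, hk.mono (by omega), hl.mono (by omega)⟩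
  | switch f ih =>
    choose k hk using ih
    obtain ⟨l, hl⟩ := (Set.finite_range k).bddAbove
    exact ⟨l, fun a => (hk a).mono (hl ⟨a, rfl⟩)⟩
  | advance => exact ⟨0, trivial⟩
  | print b => exact ⟨0, trivial⟩

theorem Run.regs_le {α : Type} {tape : List (InputSymbol α)} {B : ℕ} {p : Prog α} {w w' : World}
    (h : Run tape B p w w') (hw : ∀ r, w.regs r ≤ B) : ∀ r, w'.regs r ≤ B := by
  induction h with
  | skip | advance | print => exact hw
  | inc r w h =>
    intro j
    by_cases hj : j = r
    · subst hj; simpa using h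
    · simpa [hj] using hw j
  | dec r w h =>
    intro j
    by_cases hj : j = r
    · subst hj; simpa using (hw j).trans (Nat.le_succ _)
    · simpa [hj] using hw j
  | seq _ _ ih₁ ih₂ => exact ih₂ (ih₁ hw)
  | loop_done => exact hw
  | loop_step _ _ _ ih₁ ih₂ => exact ih₂ (ih₁ hw)
  | ifz_zero _ _ ih => exact ih hw
  | ifz_pos _ _ ih => exact ih hw
  | switch _ ih => exact ih hw

/-! ### Registers on the tracks of a work tape -/

/-- Work cells with `k + 1` tracks. Cells that are not in use are `none`; the boolean component
marks the origin of the tape. -/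
abbrev Cell (k : ℕ) := Option (Bool × (Fin (k + 1) → Bool))

/-- The work tape whose first `ℓ` cells are in use and hold the registers in binary. -/
def regTape (k ℓ : ℕ) (σ : ℕ → ℕ) : ℤ → Cell k := fun z =>
  if 0 ≤ z ∧ z < ℓ then some (decide (z = 0), fun r => (σ r).testBit z.toNat) else none

theorem regTape_of_lt {k ℓ i : ℕ} (σ : ℕ → ℕ) (h : i < ℓ) :
    regTape k ℓ σ i =
      some (decide (i = 0), fun r : Fin (k + 1) => (σ r).testBit i) := by
  simp [regTape, h]

theorem regTape_self (k ℓ : ℕ) (σ : ℕ → ℕ) : regTape k ℓ σ ℓ = none := by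
  simp [regTape]

/-- Rewriting track `r` of one cell changes register `r` to any `v` that differs from it at most in
that bit. This turns the local action of the head into arithmetic on registers. -/
theorem update_regTape {k ℓ i r v : ℕ} {σ : ℕ → ℕ} (hi : i < ℓ) (hr : r ≤ k)
    (hv : ∀ j, j ≠ i → v.testBit j = (σ r).testBit j) :
    Function.update (regTape k ℓ σ) i (some (decide (i = 0), Function.update
      (fun r' : Fin (k + 1) => (σ r').testBit i) (Fin.ofNat (k + 1) r) (v.testBit i))) =
      regTape k ℓ (Function.update σ r v) := by
  have hr' : (Fin.ofNat (k + 1) r : ℕ) = r := Nat.mod_eq_of_lt (by omega)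
  funext z
  by_cases hz : z = i
  · subst hz
    rw [Function.update_self, regTape_of_lt _ hi]
    congr 2
    funext r'
    by_cases h : r' = Fin.ofNat (k + 1) r
    · subst h; rw [Function.update_self, hr', Function.update_self]
    · have : (r' : ℕ) ≠ r := fun e => h (Fin.ext (by rw [hr', e]))
      rw [Function.update_of_ne h, Function.update_of_ne this]
  · rw [Function.update_of_ne hz]
    unfold regTape
    split_ifs with h
    · congr 2
      funext r'
      by_cases h' : (r' : ℕ) = r
      · rw [h', Function.update_self, hv _ (by omega)]
      · rw [Function.update_of_ne h']
    · rfl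

theorem testBit_add_two_pow {y i : ℕ} (h : y.testBit i = false) (j : ℕ) :
    (y + 2 ^ i).testBit j = if j = i then true else y.testBit j := by
  rw [Nat.add_comm]
  rcases lt_trichotomy j i with hj | hj | hj
  · rw [Nat.testBit_two_pow_add_gt hj, if_neg hj.ne]
  · subst hj; rw [Nat.testBit_two_pow_add_eq, h]; simp
  · rw [if_neg hj.ne']
    obtain ⟨d, rfl⟩ : ∃ d, j = d + 1 + i := ⟨j - i - 1, by omega⟩
    have h0 : y / 2 ^ i % 2 = 0 := by
      have := h; rw [Nat.testBit_eq_decide_div_mod_eq] at this; simp at this; omega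
    have hq : (2 ^ i + y) / 2 ^ i = y / 2 ^ i + 1 := by
      rw [Nat.add_div_left _ (by positivity)]
    rw [Nat.testBit_add, Nat.testBit_add y, hq, Nat.testBit_add_one, Nat.testBit_add_one (y / 2 ^ i)]
    congr 1
    omega

theorem testBit_sub_two_pow {y i : ℕ} (h : y.testBit i = true) (j : ℕ) :
    (y - 2 ^ i).testBit j = if j = i then false else y.testBit j := by
  have hle : 2 ^ i ≤ y := Nat.ge_two_pow_of_testBit h
  have h0 : (y - 2 ^ i).testBit i = false := by
    have := Nat.testBit_two_pow_add_eq (y - 2 ^ i) i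
    rw [Nat.add_sub_cancel' hle, h] at this
    simpa using this.symm
  have := testBit_add_two_pow h0 j
  rw [Nat.sub_add_cancel hle] at this
  split_ifs with hj
  · rw [hj, h0]
  · rw [this, if_neg hj]

/-- The case of a carry past the last used cell: a new cell is opened, with a one on track `r` and
zeros elsewhere. As `ℓ ≠ 0`, it is not the origin. -/
theorem update_regTape_self {k ℓ r : ℕ} {σ : ℕ → ℕ} (hℓ : ℓ ≠ 0) (hr : r ≤ k)
    (hσ : ∀ j, j ≤ k → σ j < 2 ^ ℓ) :
    Function.update (regTape k ℓ σ) ℓ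
      (some (false, fun r' => decide (r' = Fin.ofNat (k + 1) r))) =
      regTape k (ℓ + 1) (Function.update σ r (σ r + 2 ^ ℓ)) := by
  have hr' : (Fin.ofNat (k + 1) r : ℕ) = r := Nat.mod_eq_of_lt (by omega)
  have hb : ∀ j, j ≤ k → (σ j).testBit ℓ = false := fun j hj => Nat.testBit_lt_two_pow (hσ j hj)
  have key : ∀ (r' : Fin (k + 1)) (j : ℕ), (Function.update σ r (σ r + 2 ^ ℓ) r').testBit j =
      if j = ℓ then decide (r' = Fin.ofNat (k + 1) r) else (σ r').testBit j := by
    intro r' j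
    by_cases h : r' = Fin.ofNat (k + 1) r
    · subst h
      rw [hr', Function.update_self, testBit_add_two_pow (hb r hr)]
      simp
    · have : (r' : ℕ) ≠ r := fun e => h (Fin.ext (by rw [hr', e]))
      rw [Function.update_of_ne this]
      split_ifs with hj
      · rw [hj, hb _ (by omega), decide_eq_false h]
      · rfl
  funext z
  by_cases hz : z = ℓ
  · subst hz
    rw [Function.update_self, regTape_of_lt _ (Nat.lt_succ_self ℓ)]
    simp [key, hℓ]
  · rw [Function.update_of_ne hz]
    unfold regTape
    by_cases h : 0 ≤ z ∧ z < ℓ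
    · rw [if_pos h, if_pos ⟨h.1, by push_cast; omega⟩]
      congr 2
      funext r'
      rw [key, if_neg (by omega)]
    · rw [if_neg h, if_neg (by push_cast; omega)]

/-! ### Elementary register operations on the work tape -/

/-- The elementary register operations. -/
inductive RegOp
  | inc
  | dec
  | test

/-- What an operation does to a cell it scans; a boolean tells that the operation is over. -/
def RegOp.onCell {k : ℕ} (r : Fin (k + 1)) : RegOp → Cell k → Cell k × Option Bool
  | .inc, none => (some (false, fun r' => decide (r' = r)), some true)
  | .inc, some (o, b) =>
      if b r then (some (o, Function.update b r false), none)
      else (some (o, Function.update b r true), some true)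
  | .dec, none => (none, some true)
  | .dec, some (o, b) =>
      if b r then (some (o, Function.update b r false), some true)
      else (some (o, Function.update b r true), none)
  | .test, none => (none, some false)
  | .test, some (o, b) => if b r then (some (o, b), some true) else (some (o, b), none)

/-- Control of an elementary operation: scan to the right, then go back to the origin. -/
inductive ScanState
  | scan
  | home (e : Bool)

instance : Finite ScanState :=
  Finite.of_injective
    (fun s : ScanState => (match s with
      | .scan => none
      | .home e => some e : Option Bool))
    (by intro a b h; cases a <;> cases b <;> simp_all)

/-- The transitions of an elementary operation; it is left with its boolean result. -/
def scanStep {k : ℕ} (o : RegOp) (r : Fin (k + 1)) :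
    ScanState → Cell k → Cell k × Move × (ScanState ⊕ Bool)
  | .scan, g =>
    match o.onCell r g with
    | (g', none) => (g', .right, .inl .scan)
    | (g', some e) => (g', .stay, .inl (.home e))
  | .home e, some (true, b) => (some (true, b), .stay, .inr e)
  | .home e, some (false, b) => (some (false, b), .left, .inl (.home e))
  | .home e, none => (none, .left, .inl (.home e))

/-- Reachability by computations on the work cells `0, …, S`. -/
def ReachesIn {α Γ : Type} (M : Machine α Γ) (tape : List (InputSymbol α)) (S : ℕ) :
    Config M.Q Γ → Config M.Q Γ → Prop :=
  Relation.ReflTransGen fun c c' => M.step tape c = some c' ∧ 0 ≤ c.workPos ∧ c.workPos ≤ S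

/-- The operation `o` on register `r` is a part of the machine `M`. -/
def EmbedsOp {α : Type} {k : ℕ} (M : Machine α (Cell k)) (o : RegOp) (r : Fin (k + 1))
    (ι : ScanState ⊕ Bool → M.Q) : Prop :=
  ∀ s a g, M.δ (ι (.inl s)) a g = some
    { state := ι (scanStep o r s g).2.2, write := (scanStep o r s g).1,
      workMove := (scanStep o r s g).2.1, inputMove := .stay, print := none }

section ops

variable {α : Type} {k : ℕ} {M : Machine α (Cell k)} {o : RegOp} {r : ℕ}
  {ι : ScanState ⊕ Bool → M.Q} {tape : List (InputSymbol α)} {S : ℕ}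

theorem reachesIn_head {c c' c'' : Config M.Q (Cell k)} (h : M.step tape c = some c')
    (h0 : 0 ≤ c.workPos) (hS : c.workPos ≤ S) (h' : ReachesIn M tape S c' c'') :
    ReachesIn M tape S c c'' :=
  Relation.ReflTransGen.head ⟨h, h0, hS⟩ h'

theorem reachesIn_home {r : Fin (k + 1)} (hM : EmbedsOp M o r ι) (e : Bool) {ℓ : ℕ} (hℓ : ℓ ≠ 0)
    (hS : ℓ ≤ S) (σ : ℕ → ℕ) (i : ℕ) (hi : i ≤ ℓ) (p : ℕ) (u : List Bool) :
    ReachesIn M tape S ⟨ι (.inl (.home e)), p, regTape k ℓ σ, i, u⟩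
      ⟨ι (.inr e), p, regTape k ℓ σ, 0, u⟩ := by
  induction i with
  | zero =>
    refine reachesIn_head (c' := ⟨ι (.inr e), p, regTape k ℓ σ, 0, u⟩) ?_ ?_ ?_
      Relation.ReflTransGen.refl
    · have := regTape_of_lt (k := k) σ (Nat.pos_of_ne_zero hℓ)
      simp only [Nat.cast_zero] at this
      simp [Machine.step, hM _ _ _, this, scanStep, Move.onInput, Move.onWork]
    · simp
    · simp
  | succ i ih =>
    refine reachesIn_head (c' := ⟨ι (.inl (.home e)), p, regTape k ℓ σ, i, u⟩) ?_ ?_ ?_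
      (ih (by omega))
    · have hs : scanStep o r (.home e) (regTape k ℓ σ ((i + 1 : ℕ) : ℤ)) =
          (regTape k ℓ σ ((i + 1 : ℕ) : ℤ), .left, .inl (.home e)) := by
        rcases hi.lt_or_eq with h | h
        · rw [regTape_of_lt _ h]; simp [scanStep]
        · rw [h, regTape_self]; simp [scanStep]
      simp only [Machine.step, hM _ _ _, hs, Option.map_some, Function.update_eq_self]
      simp [Move.onInput, Move.onWork]
    · exact Int.natCast_nonneg _
    · exact Int.ofNat_le.2 (by omega)

theorem reachesIn_scan_return {r : Fin (k + 1)} (hM : EmbedsOp M o r ι) {e : Bool} {ℓ ℓ' : ℕ}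
    (hℓ : ℓ' ≠ 0) (hS : ℓ' ≤ S) {σ σ' : ℕ → ℕ} {i : ℕ} (hi : i ≤ ℓ') {p : ℕ} {u : List Bool}
    {g : Cell k} (hg : o.onCell r (regTape k ℓ σ i) = (g, some e))
    (hu : Function.update (regTape k ℓ σ) i g = regTape k ℓ' σ') :
    ReachesIn M tape S ⟨ι (.inl .scan), p, regTape k ℓ σ, i, u⟩
      ⟨ι (.inr e), p, regTape k ℓ' σ', 0, u⟩ := by
  refine reachesIn_head (c' := ⟨ι (.inl (.home e)), p, regTape k ℓ' σ', i, u⟩) ?_ ?_ ?_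
    (reachesIn_home hM e hℓ hS σ' i hi p u)
  · simp [Machine.step, hM _ _ _, scanStep, hg, hu, Move.onInput, Move.onWork]
  · simp
  · simp; omega

theorem reachesIn_scan_go {r : Fin (k + 1)} (hM : EmbedsOp M o r ι) {ℓ : ℕ} (hS : ℓ ≤ S)
    {σ σ' : ℕ → ℕ} {i : ℕ} (hi : i < ℓ) {p : ℕ} {u : List Bool} {g : Cell k}
    (hg : o.onCell r (regTape k ℓ σ i) = (g, none))
    (hu : Function.update (regTape k ℓ σ) i g = regTape k ℓ σ') {c : Config M.Q (Cell k)}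
    (h : ReachesIn M tape S ⟨ι (.inl .scan), p, regTape k ℓ σ', (i + 1 : ℕ), u⟩ c) :
    ReachesIn M tape S ⟨ι (.inl .scan), p, regTape k ℓ σ, i, u⟩ c := by
  refine reachesIn_head ?_ ?_ ?_ h
  · simp [Machine.step, hM _ _ _, scanStep, hg, hu, Move.onInput, Move.onWork]
  · simp
  · simp; omega

/-- With the head on cell `i`, what remains to be added is `2 ^ i`. A one becomes zero and `2 ^ (i +
1)` remains; a zero becomes one and the head goes home. The used part grows only if the carry runs
off its end, and then the bound on the result leaves room below `S`. -/
theorem reachesIn_inc_aux (hr : r ≤ k) (hM : EmbedsOp M .inc (Fin.ofNat (k + 1) r) ι) {ℓ : ℕ}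
    (hℓ : ℓ ≠ 0) (hS : ℓ ≤ S) (p : ℕ) (u : List Bool) (d i : ℕ) (hd : i + d = ℓ) (σ : ℕ → ℕ)
    (hσ : ∀ j, j ≤ k → σ j < 2 ^ ℓ) (hlt : σ r + 2 ^ i < 2 ^ S) :
    ∃ ℓ', ℓ ≤ ℓ' ∧ ℓ' ≤ S ∧ σ r + 2 ^ i < 2 ^ ℓ' ∧
      ReachesIn M tape S ⟨ι (.inl .scan), p, regTape k ℓ σ, i, u⟩
        ⟨ι (.inr true), p, regTape k ℓ' (Function.update σ r (σ r + 2 ^ i)), 0, u⟩ := by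
  have hr' : (Fin.ofNat (k + 1) r : ℕ) = r := Nat.mod_eq_of_lt (by omega)
  induction d generalizing i σ with
  | zero =>
    obtain rfl : i = ℓ := by omega
    have hS' : i < S := (Nat.pow_lt_pow_iff_right (by norm_num : 1 < 2)).1
      (lt_of_le_of_lt (Nat.le_add_left _ _) hlt)
    refine ⟨i + 1, by omega, hS', ?_, ?_⟩
    · have := hσ r hr; rw [pow_succ]; omega
    · exact reachesIn_scan_return hM (by omega) hS' (by omega) (by rw [regTape_self]; rfl)
        (update_regTape_self hℓ hr hσ)
  | succ d ih =>
    have hi : i < ℓ := by omega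
    by_cases hb : (σ r).testBit i
    · have hle := Nat.ge_two_pow_of_testBit hb
      obtain ⟨ℓ', h1, h2, h3, h4⟩ := ih (i + 1) (by omega)
        (Function.update σ r (σ r - 2 ^ i)) (by
          intro j hj
          by_cases hjr : j = r
          · subst hjr; rw [Function.update_self]; exact lt_of_le_of_lt (Nat.sub_le _ _) (hσ j hj)
          · rw [Function.update_of_ne hjr]; exact hσ j hj) (by
          rw [Function.update_self, pow_succ]; omega)
      rw [Function.update_self, Function.update_idem] at h4
      rw [Function.update_self] at h3
      have he : σ r - 2 ^ i + 2 ^ (i + 1) = σ r + 2 ^ i := by rw [pow_succ]; omega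
      rw [he] at h3 h4
      refine ⟨ℓ', h1, h2, h3, reachesIn_scan_go hM hS hi (g := some (decide (i = 0),
        Function.update (fun r' : Fin (k + 1) => (σ r').testBit i)
          (Fin.ofNat (k + 1) r) ((σ r - 2 ^ i).testBit i))) ?_ ?_ h4⟩
      · rw [regTape_of_lt _ hi, testBit_sub_two_pow hb]
        simp only [RegOp.onCell, hr', hb]
        simp
      · exact update_regTape hi hr (fun j hj => by rw [testBit_sub_two_pow hb, if_neg hj])
    · have hb' : (σ r).testBit i = false := by simpa using hb
      have hlt' : σ r + 2 ^ i < 2 ^ ℓ := by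
        refine Nat.lt_pow_two_of_testBit _ fun j hj => ?_
        rw [testBit_add_two_pow hb', if_neg (by omega)]
        exact Nat.testBit_lt_two_pow ((hσ r hr).trans_le (Nat.pow_le_pow_right (by norm_num) hj))
      refine ⟨ℓ, le_rfl, hS, hlt', ?_⟩
      refine reachesIn_scan_return hM hℓ hS hi.le (g := some (decide (i = 0),
        Function.update (fun r' : Fin (k + 1) => (σ r').testBit i)
          (Fin.ofNat (k + 1) r) ((σ r + 2 ^ i).testBit i))) ?_ ?_
      · rw [regTape_of_lt _ hi, testBit_add_two_pow hb']
        simp only [RegOp.onCell, hr', hb']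
        simp
      · exact update_regTape hi hr (fun j hj => by rw [testBit_add_two_pow hb', if_neg hj])

/-- The borrow, dual to the carry. It cannot run off the used part because `2 ^ i ≤ σ r`. -/
theorem reachesIn_dec_aux (hr : r ≤ k) (hM : EmbedsOp M .dec (Fin.ofNat (k + 1) r) ι) {ℓ : ℕ}
    (hS : ℓ ≤ S) (p : ℕ) (u : List Bool) (d i : ℕ) (hd : i + d = ℓ) (σ : ℕ → ℕ)
    (hσ : ∀ j, j ≤ k → σ j < 2 ^ ℓ) (hle : 2 ^ i ≤ σ r) :
    ReachesIn M tape S ⟨ι (.inl .scan), p, regTape k ℓ σ, i, u⟩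
      ⟨ι (.inr true), p, regTape k ℓ (Function.update σ r (σ r - 2 ^ i)), 0, u⟩ := by
  have hr' : (Fin.ofNat (k + 1) r : ℕ) = r := Nat.mod_eq_of_lt (by omega)
  induction d generalizing i σ with
  | zero =>
    obtain rfl : i = ℓ := by omega
    exact absurd (hσ r hr) (by omega)
  | succ d ih =>
    have hi : i < ℓ := by omega
    by_cases hb : (σ r).testBit i
    · refine reachesIn_scan_return hM (by omega) hS hi.le (g := some (decide (i = 0),
        Function.update (fun r' : Fin (k + 1) => (σ r').testBit i)
          (Fin.ofNat (k + 1) r) ((σ r - 2 ^ i).testBit i))) ?_ ?_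
      · rw [regTape_of_lt _ hi, testBit_sub_two_pow hb]
        simp only [RegOp.onCell, hr', hb]
        simp
      · exact update_regTape hi hr (fun j hj => by rw [testBit_sub_two_pow hb, if_neg hj])
    · have hb' : (σ r).testBit i = false := by simpa using hb
      have hlt' : σ r + 2 ^ i < 2 ^ ℓ := by
        refine Nat.lt_pow_two_of_testBit _ fun j hj => ?_
        rw [testBit_add_two_pow hb', if_neg (by omega)]
        exact Nat.testBit_lt_two_pow ((hσ r hr).trans_le (Nat.pow_le_pow_right (by norm_num) hj))
      have h2 : 2 ^ (i + 1) ≤ σ r + 2 ^ i := by rw [pow_succ]; omega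
      have h4 := ih (i + 1) (by omega) (Function.update σ r (σ r + 2 ^ i)) (by
          intro j hj
          by_cases hjr : j = r
          · subst hjr; rw [Function.update_self]; exact hlt'
          · rw [Function.update_of_ne hjr]; exact hσ j hj) (by
          rw [Function.update_self]; exact h2)
      rw [Function.update_self, Function.update_idem] at h4
      have he : σ r + 2 ^ i - 2 ^ (i + 1) = σ r - 2 ^ i := by rw [pow_succ]; omega
      rw [he] at h4
      refine reachesIn_scan_go hM hS hi (g := some (decide (i = 0),
        Function.update (fun r' : Fin (k + 1) => (σ r').testBit i)
          (Fin.ofNat (k + 1) r) ((σ r + 2 ^ i).testBit i))) ?_ ?_ h4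
      · rw [regTape_of_lt _ hi, testBit_add_two_pow hb']
        simp only [RegOp.onCell, hr', hb']
        simp
      · exact update_regTape hi hr (fun j hj => by rw [testBit_add_two_pow hb', if_neg hj])

/-- A scan for the lowest one; reaching the first unused cell shows that the register is zero. -/
theorem reachesIn_test_aux (hr : r ≤ k) (hM : EmbedsOp M .test (Fin.ofNat (k + 1) r) ι) {ℓ : ℕ}
    (hℓ : ℓ ≠ 0) (hS : ℓ ≤ S) (p : ℕ) (u : List Bool) (σ : ℕ → ℕ)
    (hσ : ∀ j, j ≤ k → σ j < 2 ^ ℓ) (d i : ℕ) (hd : i + d = ℓ)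
    (hz : ∀ j < i, (σ r).testBit j = false) :
    ReachesIn M tape S ⟨ι (.inl .scan), p, regTape k ℓ σ, i, u⟩
      ⟨ι (.inr (decide (σ r ≠ 0))), p, regTape k ℓ σ, 0, u⟩ := by
  have hr' : (Fin.ofNat (k + 1) r : ℕ) = r := Nat.mod_eq_of_lt (by omega)
  induction d generalizing i with
  | zero =>
    obtain rfl : i = ℓ := by omega
    have h0 : σ r = 0 := Nat.eq_of_testBit_eq fun j => by
      rw [Nat.zero_testBit]
      by_cases hj : j < i
      · exact hz j hj
      · exact Nat.testBit_lt_two_pow ((hσ r hr).trans_le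
          (Nat.pow_le_pow_right (by norm_num) (by omega)))
    have : decide (σ r ≠ 0) = false := by simp [h0]
    rw [this]
    exact reachesIn_scan_return hM hℓ hS le_rfl (by rw [regTape_self]; rfl)
      (by rw [← regTape_self k i σ, Function.update_eq_self])
  | succ d ih =>
    have hi : i < ℓ := by omega
    by_cases hb : (σ r).testBit i
    · have : decide (σ r ≠ 0) = true := by
        simp only [decide_eq_true_eq]; rintro h; simp [h] at hb
      rw [this]
      refine reachesIn_scan_return hM hℓ hS hi.le (g := regTape k ℓ σ i) ?_
        (Function.update_eq_self _ _)
      rw [regTape_of_lt _ hi]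
      simp only [RegOp.onCell, hr', hb]
      simp
    · have hb' : (σ r).testBit i = false := by simpa using hb
      refine reachesIn_scan_go hM hS hi (g := regTape k ℓ σ i) ?_
        (Function.update_eq_self _ _) (ih (i + 1) (by omega) ?_)
      · rw [regTape_of_lt _ hi]
        simp only [RegOp.onCell, hr', hb']
        simp
      · intro j hj
        rcases Nat.lt_succ_iff_lt_or_eq.1 hj with h | rfl
        · exact hz j h
        · exact hb'

end ops

/-! ### Compilation of register programs -/

/-- Change of the target state of an action. -/
def Action.map {Q Q' Γ : Type} (f : Q → Q') (t : Action Q Γ) : Action Q' Γ :=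
  { state := f t.state, write := t.write, workMove := t.workMove, inputMove := t.inputMove,
    print := t.print }

@[simp] theorem Action.map_map {Q Q' Q'' Γ : Type} (f : Q → Q') (g : Q' → Q'')
    (t : Action Q Γ) : (t.map f).map g = t.map (g ∘ f) := rfl

/-- The states of the compiled program. -/
def Prog.St {α : Type} : Prog α → Type
  | .skip => Unit
  | .inc _ => ScanState
  | .dec _ => ScanState
  | .seq p q => p.St ⊕ q.St
  | .loop _ p => ScanState ⊕ p.St
  | .ifz _ p q => ScanState ⊕ (p.St ⊕ q.St)
  | .switch f => Option (Σ a, (f a).St)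
  | .advance => Unit
  | .print _ => Unit

theorem Prog.finite_st {α : Type} [Finite α] (p : Prog α) : Finite p.St := by
  induction p with
  | skip | advance | print => exact inferInstanceAs (Finite Unit)
  | inc | dec => exact inferInstanceAs (Finite ScanState)
  | seq p q ihp ihq => exact inferInstanceAs (Finite (p.St ⊕ q.St))
  | loop r p ih => exact inferInstanceAs (Finite (ScanState ⊕ p.St))
  | ifz r p q ihp ihq => exact inferInstanceAs (Finite (ScanState ⊕ (p.St ⊕ q.St)))
  | switch f ih => exact inferInstanceAs (Finite (Option (Σ a, (f a).St)))

/-- The first state of the compiled program. -/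
def Prog.entry {α : Type} : (p : Prog α) → p.St
  | .skip => ()
  | .inc _ => .scan
  | .dec _ => .scan
  | .seq p _ => .inl p.entry
  | .loop _ _ => .inl .scan
  | .ifz _ _ _ => .inl .scan
  | .switch _ => none
  | .advance => ()
  | .print _ => ()

/-- The action of an elementary operation, with continuation `f`. -/
def opAction {k : ℕ} {Q : Type} (o : RegOp) (r : ℕ) (f : ScanState ⊕ Bool → Q) (s : ScanState)
    (g : Cell k) : Action Q (Cell k) where
  state := f (scanStep o (Fin.ofNat (k + 1) r) s g).2.2
  write := (scanStep o (Fin.ofNat (k + 1) r) s g).1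
  workMove := (scanStep o (Fin.ofNat (k + 1) r) s g).2.1
  inputMove := .stay
  print := none

/-- The transitions of the compiled program; the state `none` is its exit. -/
def Prog.trans {α : Type} (k : ℕ) :
    (p : Prog α) → p.St → InputSymbol α → Cell k → Action (Option p.St) (Cell k)
  | .skip, _, _, g => ⟨none, g, .stay, .stay, none⟩
  | .inc r, s, _, g => opAction .inc r (Sum.elim some fun _ => none) s g
  | .dec r, s, _, g => opAction .dec r (Sum.elim some fun _ => none) s g
  | .seq p q, .inl s, a, g => (p.trans k s a g).map fun o => some (o.elim (.inr q.entry) .inl)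
  | .seq _ q, .inr s, a, g => (q.trans k s a g).map fun o => o.map .inr
  | .loop r p, .inl s, _, g =>
    opAction .test r (Sum.elim (fun s => some (.inl s))
      fun e => if e then some (.inr p.entry) else none) s g
  | .loop _ p, .inr s, a, g => (p.trans k s a g).map fun o => some (o.elim (.inl .scan) .inr)
  | .ifz r p q, .inl s, _, g =>
    opAction .test r (Sum.elim (fun s => some (.inl s))
      fun e => if e then some (.inr (.inr q.entry)) else some (.inr (.inl p.entry))) s g
  | .ifz _ p _, .inr (.inl s), a, g => (p.trans k s a g).map fun o => o.map (.inr ∘ .inl)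
  | .ifz _ _ q, .inr (.inr s), a, g => (q.trans k s a g).map fun o => o.map (.inr ∘ .inr)
  | .switch f, none, a, g => ⟨some (some ⟨a, (f a).entry⟩), g, .stay, .stay, none⟩
  | .switch f, some ⟨b, s⟩, a, g =>
    ((f b).trans k s a g).map fun o => o.map fun s => some ⟨b, s⟩
  | .advance, _, _, g => ⟨none, g, .stay, .right, none⟩
  | .print b, _, _, g => ⟨none, g, .stay, .stay, some b⟩

theorem Prog.trans_inputMove {α : Type} {k : ℕ} (p : Prog α) (s : p.St) (a : InputSymbol α)
    (g : Cell k) : (p.trans k s a g).inputMove ≠ .left := by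
  induction p with
  | skip | advance | print => simp [Prog.trans]
  | inc | dec => simp [Prog.trans, opAction]
  | seq p q ihp ihq => rcases s with s | s; exacts [ihp s, ihq s]
  | loop r p ih =>
    rcases s with s | s
    · simp [Prog.trans, opAction]
    · exact ih s
  | ifz r p q ihp ihq =>
    rcases s with s | s | s
    · simp [Prog.trans, opAction]
    · exact ihp s
    · exact ihq s
  | switch f ih =>
    rcases s with _ | ⟨b, s⟩
    · simp [Prog.trans]
    · exact ih b s

/-- The compiled program `p` is a part of the machine `M`, with exit `e`. -/
def Embeds {α : Type} {k : ℕ} (M : Machine α (Cell k)) (p : Prog α) (ι : p.St → M.Q) (e : M.Q) :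
    Prop :=
  ∀ s a g, M.δ (ι s) a g = some ((p.trans k s a g).map fun o => o.elim e ι)

/-- The configuration between two operations. -/
def worldConfig {k : ℕ} {Q : Type} (q : Q) (ℓ : ℕ) (w : World) : Config Q (Cell k) :=
  ⟨q, w.ipos, regTape k ℓ w.regs, 0, w.out⟩

section

variable {α : Type} {k : ℕ} {M : Machine α (Cell k)} {tape : List (InputSymbol α)} {S B : ℕ}

theorem reachesIn_single {c c' : Config M.Q (Cell k)} (h : M.step tape c = some c')
    (h0 : c.workPos = 0) : ReachesIn M tape S c c' :=
  reachesIn_head h h0.ge (by rw [h0]; exact Int.natCast_nonneg S) Relation.ReflTransGen.refl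

theorem reachesIn_test {r : ℕ} (hr : r ≤ k) {ι : ScanState ⊕ Bool → M.Q}
    (hM : EmbedsOp M .test (Fin.ofNat (k + 1) r) ι) {ℓ : ℕ} (hℓ : ℓ ≠ 0) (hS : ℓ ≤ S)
    (w : World) (hw : ∀ j, j ≤ k → w.regs j < 2 ^ ℓ) :
    ReachesIn M tape S (worldConfig (ι (.inl .scan)) ℓ w)
      (worldConfig (ι (.inr (decide (w.regs r ≠ 0)))) ℓ w) :=
  reachesIn_test_aux hr hM hℓ hS _ _ _ hw ℓ 0 (by omega) (by simp)

/-- Induction on the run; the embedding `ι` and the exit `e` vary so that subprograms can be treated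
as parts of the same machine. Between operations the work head is back at the origin. The length `ℓ`
may grow, but stays at most `S` because registers are bounded by `B < 2 ^ S`. -/
theorem Run.reachesIn (hBS : B < 2 ^ S) {p : Prog α} {w w' : World} (h : Run tape B p w w')
    (hk : p.UsesUpTo k) {ι : p.St → M.Q} {e : M.Q} (hM : Embeds M p ι e) {ℓ : ℕ} (hℓ : ℓ ≠ 0)
    (hS : ℓ ≤ S) (hw : ∀ j, j ≤ k → w.regs j < 2 ^ ℓ) :
    ∃ ℓ', ℓ' ≠ 0 ∧ ℓ' ≤ S ∧ (∀ j, j ≤ k → w'.regs j < 2 ^ ℓ') ∧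
      ReachesIn M tape S (worldConfig (ι p.entry) ℓ w) (worldConfig e ℓ' w') := by
  induction h generalizing e ℓ with
  | skip w =>
    exact ⟨ℓ, hℓ, hS, hw, reachesIn_single (by
      simp [Machine.step, worldConfig, hM _ _ _, Prog.trans, Action.map, Move.onInput,
        Move.onWork]) rfl⟩
  | inc r w h =>
    obtain ⟨ℓ', h1, h2, h3, h4⟩ := reachesIn_inc_aux (tape := tape) (S := S) (M := M)
      (ι := Sum.elim ι fun _ => e) hk
      (by intro s a g
          refine (hM s a g).trans ?_
          simp only [Prog.trans, opAction, Action.map]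
          rcases (scanStep .inc (Fin.ofNat (k + 1) r) s g).2.2 with x | x <;> rfl)
      hℓ hS w.ipos w.out ℓ 0 (by omega) w.regs hw (by simpa using lt_of_le_of_lt h hBS)
    refine ⟨ℓ', by omega, h2, ?_, by rw [pow_zero] at h4; exact h4⟩
    intro j hj
    by_cases hjr : j = r
    · subst hjr; simpa using h3
    · simpa [hjr] using (hw j hj).trans_le (Nat.pow_le_pow_right (by norm_num) h1)
  | dec r w h =>
    refine ⟨ℓ, hℓ, hS, ?_, ?_⟩
    · intro j hj
      by_cases hjr : j = r
      · subst hjr; simpa using lt_of_le_of_lt (Nat.sub_le _ _) (hw j hj)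
      · simpa [hjr] using hw j hj
    · have := reachesIn_dec_aux (tape := tape) (S := S) (M := M)
        (ι := Sum.elim ι fun _ => e) hk
        (by intro s a g
            refine (hM s a g).trans ?_
            simp only [Prog.trans, opAction, Action.map]
            rcases (scanStep .dec (Fin.ofNat (k + 1) r) s g).2.2 with x | x <;> rfl)
        hS w.ipos w.out ℓ 0 (by omega) w.regs hw (by simp; omega)
      rw [pow_zero] at this
      exact this
  | @seq p q w₁ w₂ w₃ _ _ ih₁ ih₂ =>
    obtain ⟨ℓ₁, a1, a2, a3, a4⟩ := ih₁ hk.1 (ι := fun s => ι (.inl s)) (e := ι (.inr q.entry))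
      (by intro s a g
          refine (hM (.inl s) a g).trans ?_
          simp only [Prog.trans, Action.map_map]
          congr 2
          funext o
          cases o <;> rfl) hℓ hS hw
    obtain ⟨ℓ₂, b1, b2, b3, b4⟩ := ih₂ hk.2 (ι := fun s => ι (.inr s)) (e := e)
      (by intro s a g
          refine (hM (.inr s) a g).trans ?_
          simp only [Prog.trans, Action.map_map]
          congr 2
          funext o
          cases o <;> rfl) a1 a2 a3
    exact ⟨ℓ₂, b1, b2, b3, a4.trans b4⟩
  | @loop_done r p w h =>
    refine ⟨ℓ, hℓ, hS, hw, ?_⟩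
    have := reachesIn_test (tape := tape) (S := S) hk.1
      (ι := Sum.elim (fun s => ι (.inl s)) fun e' => if e' then ι (.inr p.entry) else e)
      (by intro s a g
          refine (hM (.inl s) a g).trans ?_
          simp only [Prog.trans, opAction, Action.map]
          rcases (scanStep .test (Fin.ofNat (k + 1) r) s g).2.2 with x | x
          · rfl
          · cases x <;> rfl) hℓ hS w hw
    simp [h] at this
    exact this
  | @loop_step r p w₁ w₂ w₃ h _ _ ih₁ ih₂ =>
    have := reachesIn_test (tape := tape) (S := S) hk.1
      (ι := Sum.elim (fun s => ι (.inl s)) fun e' => if e' then ι (.inr p.entry) else e)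
      (by intro s a g
          refine (hM (.inl s) a g).trans ?_
          simp only [Prog.trans, opAction, Action.map]
          rcases (scanStep .test (Fin.ofNat (k + 1) r) s g).2.2 with x | x
          · rfl
          · cases x <;> rfl) hℓ hS w₁ hw
    obtain ⟨ℓ₁, a1, a2, a3, a4⟩ := ih₁ hk.2 (ι := fun s => ι (.inr s)) (e := ι (.inl .scan))
      (by intro s a g
          refine (hM (.inr s) a g).trans ?_
          simp only [Prog.trans, Action.map_map]
          congr 2
          funext o
          cases o <;> rfl) hℓ hS hw
    obtain ⟨ℓ₂, b1, b2, b3, b4⟩ := ih₂ hk hM a1 a2 a3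
    refine ⟨ℓ₂, b1, b2, b3, Relation.ReflTransGen.trans ?_ (a4.trans b4)⟩
    simp [h] at this
    exact this
  | @ifz_zero r p q w w' h _ ih =>
    have := reachesIn_test (tape := tape) (S := S) hk.1
      (ι := Sum.elim (fun s => ι (.inl s))
        fun e' => if e' then ι (.inr (.inr q.entry)) else ι (.inr (.inl p.entry)))
      (by intro s a g
          refine (hM (.inl s) a g).trans ?_
          simp only [Prog.trans, opAction, Action.map]
          rcases (scanStep .test (Fin.ofNat (k + 1) r) s g).2.2 with x | x
          · rfl
          · cases x <;> rfl) hℓ hS w hw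
    obtain ⟨ℓ₁, a1, a2, a3, a4⟩ := ih hk.2.1 (ι := fun s => ι (.inr (.inl s))) (e := e)
      (by intro s a g
          refine (hM (.inr (.inl s)) a g).trans ?_
          simp only [Prog.trans, Action.map_map]
          congr 2
          funext o
          cases o <;> rfl) hℓ hS hw
    refine ⟨ℓ₁, a1, a2, a3, Relation.ReflTransGen.trans ?_ a4⟩
    simp [h] at this
    exact this
  | @ifz_pos r p q w w' h _ ih =>
    have := reachesIn_test (tape := tape) (S := S) hk.1
      (ι := Sum.elim (fun s => ι (.inl s))
        fun e' => if e' then ι (.inr (.inr q.entry)) else ι (.inr (.inl p.entry)))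
      (by intro s a g
          refine (hM (.inl s) a g).trans ?_
          simp only [Prog.trans, opAction, Action.map]
          rcases (scanStep .test (Fin.ofNat (k + 1) r) s g).2.2 with x | x
          · rfl
          · cases x <;> rfl) hℓ hS w hw
    obtain ⟨ℓ₁, a1, a2, a3, a4⟩ := ih hk.2.2 (ι := fun s => ι (.inr (.inr s))) (e := e)
      (by intro s a g
          refine (hM (.inr (.inr s)) a g).trans ?_
          simp only [Prog.trans, Action.map_map]
          congr 2
          funext o
          cases o <;> rfl) hℓ hS hw
    refine ⟨ℓ₁, a1, a2, a3, Relation.ReflTransGen.trans ?_ a4⟩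
    simp [h] at this
    exact this
  | @switch f w w' _ ih =>
    obtain ⟨ℓ₁, a1, a2, a3, a4⟩ := ih (hk _)
      (ι := fun s => ι (some ⟨tape.getD w.ipos .rightEnd, s⟩)) (e := e)
      (by intro s a g
          refine (hM (some ⟨_, s⟩) a g).trans ?_
          simp only [Prog.trans, Action.map_map]
          congr 2
          funext o
          cases o <;> rfl) hℓ hS hw
    refine ⟨ℓ₁, a1, a2, a3, Relation.ReflTransGen.trans (reachesIn_single ?_ rfl) a4⟩
    have := hM none (tape.getD w.ipos .rightEnd) (regTape k ℓ w.regs 0)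
    simp only [Machine.step, worldConfig, Prog.entry, this, Prog.trans, Action.map,
      Option.map_some, Move.onInput, Move.onWork, Option.elim, Option.toList,
      Function.update_eq_self, List.append_nil]
  | advance w =>
    exact ⟨ℓ, hℓ, hS, hw, reachesIn_single (by
      simp [Machine.step, worldConfig, hM _ _ _, Prog.trans, Action.map, Move.onWork]) rfl⟩
  | print b w =>
    exact ⟨ℓ, hℓ, hS, hw, reachesIn_single (by
      simp [Machine.step, worldConfig, hM _ _ _, Prog.trans, Action.map, Move.onInput,
        Move.onWork]) rfl⟩

end

/-- The online machine that executes a program. -/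
def Prog.toMachine {α : Type} [Finite α] (p : Prog α) (k : ℕ) : Machine α (Cell k) where
  Q := Option (Option p.St)
  finite_Q := by have := p.finite_st; infer_instance
  start := none
  δ
    | none, _, _ => some ⟨some (some p.entry), some (true, fun _ => false), .stay, .stay, none⟩
    | some none, _, _ => none
    | some (some s), a, g => some ((p.trans k s a g).map some)

theorem Prog.isOnline_toMachine {α : Type} [Finite α] (p : Prog α) (k : ℕ) :
    (p.toMachine k).IsOnline := by
  intro q a g t ht
  match q, ht with
  | none, ht =>
    have : some _ = some t := ht
    rw [← Option.some_inj.1 this]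
    simp
  | some (some s), ht =>
    have : some _ = some t := ht
    rw [← Option.some_inj.1 this]
    exact p.trans_inputMove s a g

/-- By determinism every reachable configuration lies on the one path to the halting configuration,
so a bound along this path bounds all visited cells. -/
theorem ReachesIn.workPos_mem {α Γ : Type} {M : Machine α Γ} {tape : List (InputSymbol α)}
    {S : ℕ} {a b c : Config M.Q Γ} (h : ReachesIn M tape S a b) (hb : M.step tape b = none)
    (h0 : 0 ≤ b.workPos) (hS : b.workPos ≤ S)
    (hc : StateTransition.Reaches (M.step tape) a c) : 0 ≤ c.workPos ∧ c.workPos ≤ S := by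
  induction h using Relation.ReflTransGen.head_induction_on with
  | refl =>
    rcases Relation.ReflTransGen.cases_head hc with rfl | ⟨d, hd, -⟩
    · exact ⟨h0, hS⟩
    · rw [hb] at hd; simp at hd
  | head hstep _ ih =>
    rcases Relation.ReflTransGen.cases_head hc with rfl | ⟨d, hd, hdc⟩
    · exact hstep.2
    · rw [hstep.1] at hd
      obtain rfl : _ = d := Option.some_inj.1 hd
      exact ih hdc

theorem ReachesIn.reaches {α Γ : Type} {M : Machine α Γ} {tape : List (InputSymbol α)}
    {S : ℕ} {a b : Config M.Q Γ} (h : ReachesIn M tape S a b) :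
    StateTransition.Reaches (M.step tape) a b :=
  Relation.ReflTransGen.mono (fun _ _ h => h.1) _ _ h

/-- Correctness and space consumption of the compiled machine. -/
theorem Run.outputs {α : Type} [Finite α] {p : Prog α} {k : ℕ} (hk : p.UsesUpTo k)
    {tape : List (InputSymbol α)} {B S : ℕ} (hBS : B < 2 ^ S) (hS : S ≠ 0) {w : World}
    (h : Run tape B p ⟨fun _ => 0, 0, []⟩ w) :
    (p.toMachine k).Outputs tape w.out ∧
      ((p.toMachine k).usedCells tape).encard ≤ (S + 1 : ℕ) := by
  obtain ⟨ℓ, -, -, -, hr⟩ := h.reachesIn (M := p.toMachine k) (ι := fun s => some (some s))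
    (e := some none) hBS hk (by
      intro s a g
      show some ((p.trans k s a g).map some) = _
      congr 2
      funext o
      cases o <;> rfl) one_ne_zero (Nat.one_le_iff_ne_zero.2 hS) (fun _ _ => by simp)
  have h0 : ReachesIn (p.toMachine k) tape S (p.toMachine k).init
      (worldConfig (some none) ℓ w) := by
    -- The first step writes the origin marker; this is the tape with one used cell and all
    -- registers zero.
    refine Relation.ReflTransGen.trans (reachesIn_single ?_ rfl) hr
    simp only [Machine.step, Machine.init, Prog.toMachine, Option.map_some, worldConfig,
      Move.onInput, Move.onWork, Option.toList, List.append_nil]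
    congr 2
    funext z
    by_cases hz : z = 0
    · subst hz; simp [regTape]
    · rw [Function.update_of_ne hz, regTape, if_neg (by push_cast; omega)]; rfl
  have hn : (p.toMachine k).step tape (worldConfig (some none) ℓ w) = none := rfl
  refine ⟨⟨_, h0.reaches, hn, rfl⟩, ?_⟩
  have hsub : (p.toMachine k).usedCells tape ⊆ ((Finset.Icc (0 : ℤ) S : Finset ℤ) : Set ℤ) := by
    rintro z ⟨c, hc, rfl⟩
    simpa using h0.workPos_mem hn le_rfl (Int.natCast_nonneg S) hc
  refine (Set.encard_le_encard hsub).trans ?_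
  rw [Set.encard_coe_eq_coe_finsetCard]
  simp

/-! ### A pairing function that counters can compute -/

/-- Triangular numbers. -/
def tri : ℕ → ℕ
  | 0 => 0
  | n + 1 => tri n + (n + 1)

/-- Cantor's pairing function. -/
def cpair (a b : ℕ) : ℕ := tri (a + b) + b

theorem tri_le (n : ℕ) : tri n ≤ n ^ 2 := by
  induction n with
  | zero => simp [tri]
  | succ n ih => simp only [tri]; nlinarith

theorem le_tri (n : ℕ) : n ≤ tri n := by
  cases n with
  | zero => simp
  | succ n => simp [tri]

theorem left_le_cpair (a b : ℕ) : a ≤ cpair a b := by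
  have := le_tri (a + b); unfold cpair; omega

theorem right_le_cpair (a b : ℕ) : b ≤ cpair a b := by
  unfold cpair; omega

theorem cpair_le (a b : ℕ) : cpair a b ≤ (a + b + 1) ^ 2 := by
  have := tri_le (a + b)
  have h2 : (a + b + 1) ^ 2 = (a + b) ^ 2 + 2 * (a + b) + 1 := by ring
  unfold cpair; omega

/-- Types whose elements are represented by numbers. -/
class Enc (α : Type) where
  enc : α → ℕ

open Enc (enc)

instance : Enc ℕ := ⟨id⟩

instance {α β : Type} [Enc α] [Enc β] : Enc (α × β) := ⟨fun x => cpair (enc x.1) (enc x.2)⟩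

@[simp] theorem enc_nat (n : ℕ) : enc n = n := rfl

theorem enc_pair {α β : Type} [Enc α] [Enc β] (x : α × β) :
    enc x = cpair (enc x.1) (enc x.2) := rfl

/-! ### Polynomial bounds -/

theorem pow_le_pow_exp (x : ℕ) {c d : ℕ} (h : c ≤ d) : (x + 2) ^ c ≤ (x + 2) ^ d :=
  Nat.pow_le_pow_right (by omega) h

/-- `u` is bounded by a polynomial in the number that represents the argument. -/
def PolyLe {α : Type} [Enc α] (u : α → ℕ) : Prop :=
  ∃ c, ∀ a, u a ≤ (enc a + 2) ^ (c + 1)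

section

variable {α : Type} [Enc α] {u v : α → ℕ}

theorem PolyLe.mono (h : PolyLe u) (hv : ∀ a, v a ≤ u a) : PolyLe v := by
  obtain ⟨c, hc⟩ := h
  exact ⟨c, fun a => (hv a).trans (hc a)⟩

theorem PolyLe.enc : PolyLe fun a : α => enc a := ⟨0, fun a => by simp⟩

theorem PolyLe.const (k : ℕ) : PolyLe fun _ : α => k :=
  ⟨k, fun a => (Nat.lt_two_pow_self.le.trans (Nat.pow_le_pow_left (by omega) k)).trans
    (pow_le_pow_exp _ (Nat.le_succ k))⟩

theorem PolyLe.mul (hu : PolyLe u) (hv : PolyLe v) : PolyLe fun a => u a * v a := by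
  obtain ⟨c, hc⟩ := hu
  obtain ⟨d, hd⟩ := hv
  exact ⟨c + 1 + d, fun a => (Nat.mul_le_mul (hc a) (hd a)).trans (by
    rw [← pow_add]; exact pow_le_pow_exp _ (by omega))⟩

theorem PolyLe.add (hu : PolyLe u) (hv : PolyLe v) : PolyLe fun a => u a + v a := by
  obtain ⟨c, hc⟩ := hu
  obtain ⟨d, hd⟩ := hv
  refine ⟨max c d + 1, fun a => ?_⟩
  have h1 := (hc a).trans (pow_le_pow_exp (Enc.enc a) (Nat.succ_le_succ (le_max_left c d)))
  have h2 := (hd a).trans (pow_le_pow_exp (Enc.enc a) (Nat.succ_le_succ (le_max_right c d)))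
  rw [pow_succ _ (max c d + 1)]
  simp only [Nat.succ_eq_add_one] at h1 h2
  nlinarith

theorem PolyLe.pow (hu : PolyLe u) (k : ℕ) : PolyLe fun a => u a ^ k := by
  induction k with
  | zero => simpa using PolyLe.const 1
  | succ k ih => simpa only [pow_succ] using ih.mul hu

theorem PolyLe.cpair (hu : PolyLe u) (hv : PolyLe v) : PolyLe fun a => cpair (u a) (v a) :=
  (((hu.add hv).add (.const 1)).pow 2).mono fun _ => cpair_le _ _

theorem PolyLe.comp {β : Type} [Enc β] {w : β → ℕ} (hw : PolyLe w) {f : α → β}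
    (hf : PolyLe fun a => Enc.enc (f a)) : PolyLe fun a => w (f a) := by
  obtain ⟨c, hc⟩ := hw
  exact ((hf.add (.const 2)).pow (c + 1)).mono fun a => hc (f a)

end

/-! ### Frames of registers -/

/-- The registers below `b` are those of `σ`, the others hold the entries of `l`. -/
def frame (σ : ℕ → ℕ) (b : ℕ) (l : List ℕ) : ℕ → ℕ := fun j =>
  if j < b then σ j else l.getD (j - b) 0

theorem frame_add (σ : ℕ → ℕ) (b i : ℕ) (l : List ℕ) : frame σ b l (b + i) = l.getD i 0 := by
  simp [frame]

theorem frame_self (σ : ℕ → ℕ) (b : ℕ) (l : List ℕ) : frame σ b l b = l.getD 0 0 :=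
  frame_add σ b 0 l

theorem update_frame (σ : ℕ → ℕ) (b i v : ℕ) {l : List ℕ} (hi : i < l.length) :
    Function.update (frame σ b l) (b + i) v = frame σ b (l.set i v) := by
  funext j
  by_cases hj : j = b + i
  · subst hj; simp [frame, hi]
  · rw [Function.update_of_ne hj]
    unfold frame
    split_ifs with h
    · rfl
    · rw [List.getD_eq_getElem?_getD, List.getD_eq_getElem?_getD, List.getElem?_set_ne]
      omega

theorem update_frame_self (σ : ℕ → ℕ) (b v : ℕ) {l : List ℕ} (hi : 0 < l.length) :
    Function.update (frame σ b l) b v = frame σ b (l.set 0 v) :=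
  update_frame σ b 0 v hi

theorem frame_frame (σ : ℕ → ℕ) (b : ℕ) (l l' : List ℕ) {b' : ℕ} (hb : b' = b + l.length) :
    frame (frame σ b l) b' l' = frame σ b (l ++ l') := by
  subst hb
  funext j
  unfold frame
  by_cases h : j < b
  · simp [h, show j < b + l.length by omega]
  · by_cases h' : j < b + l.length
    · rw [if_pos h', if_neg h, if_neg h, List.getD_append]; omega
    · rw [if_neg h', if_neg h, List.getD_append_right _ _ _ _ (by omega)]
      congr 1; omega

theorem frame_append_zero (σ : ℕ → ℕ) (b : ℕ) (l : List ℕ) (n : ℕ) :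
    frame σ b (l ++ List.replicate n 0) = frame σ b l := by
  funext j
  unfold frame
  split_ifs
  · rfl
  · by_cases h : j - b < l.length
    · rw [List.getD_append _ _ _ _ h]
    · rw [List.getD_append_right _ _ _ _ (by omega),
        List.getD_eq_default (l := l) _ (by omega)]
      simp [List.getD_replicate]

/-! ### Programs that only use the registers -/

/-- Runs of a program that depend on the registers only. -/
def RegRun {α : Type} (tape : List (InputSymbol α)) (B : ℕ) (p : Prog α) (σ σ' : ℕ → ℕ) : Prop :=
  ∀ i o, Run tape B p ⟨σ, i, o⟩ ⟨σ', i, o⟩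

section programs

variable {α : Type} {tape : List (InputSymbol α)} {B : ℕ} {p q : Prog α} {σ σ₁ σ₂ : ℕ → ℕ}

theorem RegRun.seq (h : RegRun tape B p σ σ₁) (h' : RegRun tape B q σ₁ σ₂) :
    RegRun tape B (.seq p q) σ σ₂ :=
  fun i o => .seq (h i o) (h' i o)

theorem RegRun.loop_step {r : ℕ} (hr : σ r ≠ 0) (h : RegRun tape B p σ σ₁)
    (h' : RegRun tape B (.loop r p) σ₁ σ₂) : RegRun tape B (.loop r p) σ σ₂ :=
  fun i o => .loop_step hr (h i o) (h' i o)

theorem RegRun.loop_done {r : ℕ} (hr : σ r = 0) : RegRun tape B (.loop r p) σ σ :=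
  fun _ _ => .loop_done hr

theorem RegRun.ifz_zero {r : ℕ} (hr : σ r = 0) (h : RegRun tape B p σ σ₁) :
    RegRun tape B (.ifz r p q) σ σ₁ :=
  fun i o => .ifz_zero hr (h i o)

theorem RegRun.ifz_pos {r : ℕ} (hr : σ r ≠ 0) (h : RegRun tape B q σ σ₁) :
    RegRun tape B (.ifz r p q) σ σ₁ :=
  fun i o => .ifz_pos hr (h i o)

theorem RegRun.inc {r : ℕ} (h : σ r + 1 ≤ B) :
    RegRun tape B (.inc r) σ (Function.update σ r (σ r + 1)) :=
  fun i o => Run.inc r ⟨σ, i, o⟩ h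

theorem RegRun.dec {r : ℕ} (h : σ r ≠ 0) :
    RegRun tape B (.dec r) σ (Function.update σ r (σ r - 1)) :=
  fun i o => Run.dec r ⟨σ, i, o⟩ h

end programs

namespace Prog

variable {α : Type}

/-- Adds register `i` to register `j` and clears it. -/
def move (i j : ℕ) : Prog α := .loop i (.seq (.dec i) (.inc j))

/-- Adds register `i` to the registers `j` and `k` and clears it. -/
def moveBoth (i j k : ℕ) : Prog α := .loop i (.seq (.dec i) (.seq (.inc j) (.inc k)))

/-- Clears a register. -/
def clear (i : ℕ) : Prog α := .loop i (.dec i)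

end Prog

section programs

variable {α : Type} {tape : List (InputSymbol α)} {B : ℕ}

theorem RegRun.clear {i : ℕ} (n : ℕ) (σ : ℕ → ℕ) (hn : σ i = n) :
    RegRun tape B (.clear i) σ (Function.update σ i 0) := by
  induction n generalizing σ with
  | zero => rw [← hn, Function.update_eq_self]; exact .loop_done hn
  | succ n ih =>
    refine .loop_step (by omega) (.dec (by omega)) ?_
    have := ih (Function.update σ i (σ i - 1)) (by simp [hn])
    rwa [Function.update_idem] at this

theorem RegRun.move {i j : ℕ} (hij : i ≠ j) (n : ℕ) (σ : ℕ → ℕ) (hn : σ i = n)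
    (hB : σ j + n ≤ B) :
    RegRun tape B (.move i j) σ (Function.update (Function.update σ i 0) j (σ j + n)) := by
  induction n generalizing σ with
  | zero => rw [← hn, Function.update_eq_self, hn, add_zero, Function.update_eq_self]
            exact .loop_done hn
  | succ n ih =>
    refine .loop_step (by omega) (.seq (.dec (by omega)) (.inc ?_)) ?_
    · simp [hij.symm]; omega
    refine cast ?_ (ih (Function.update (Function.update σ i (σ i - 1)) j
      (Function.update σ i (σ i - 1) j + 1)) (by simp [hij, hn]) (by simp [hij.symm]; omega))
    congr 1
    funext r
    by_cases h1 : r = j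
    · subst h1; simp [hij.symm]; omega
    · by_cases h2 : r = i
      · subst h2; simp [hij]
      · simp [h1, h2]

theorem RegRun.moveBoth {i j k : ℕ} (hij : i ≠ j) (hik : i ≠ k) (hjk : j ≠ k) (n : ℕ)
    (σ : ℕ → ℕ) (hn : σ i = n) (hB : σ j + n ≤ B) (hB' : σ k + n ≤ B) :
    RegRun tape B (.moveBoth i j k) σ (Function.update (Function.update (Function.update σ i 0)
      j (σ j + n)) k (σ k + n)) := by
  induction n generalizing σ with
  | zero => rw [← hn, Function.update_eq_self, hn, add_zero, add_zero, Function.update_eq_self,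
              Function.update_eq_self]
            exact .loop_done hn
  | succ n ih =>
    refine .loop_step (by omega) (.seq (.dec (by omega)) (.seq (.inc ?_) (.inc ?_))) ?_
    · simp [hij.symm]; omega
    · simp [hik.symm, hjk.symm]; omega
    refine cast ?_ (ih (Function.update (Function.update (Function.update σ i (σ i - 1)) j
      (Function.update σ i (σ i - 1) j + 1)) k (Function.update (Function.update σ i (σ i - 1)) j
      (Function.update σ i (σ i - 1) j + 1) k + 1)) (by simp [hij, hik, hn])
      (by simp [hij.symm, hjk]; omega) (by simp [hik.symm, hjk.symm]; omega))
    congr 1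
    funext r
    by_cases h1 : r = k
    · subst h1; simp [hik.symm, hjk.symm]; omega
    · by_cases h2 : r = j
      · subst h2; simp [hij.symm, h1]; omega
      · by_cases h3 : r = i
        · subst h3; simp [hij, hik]
        · simp [h1, h2, h3]

/-! ### Programs for the pairing function -/

/-- Replaces `0, x, y` by `cpair x y, 0, 0`. -/
def Prog.pair (b : ℕ) : Prog α :=
  .seq (.moveBoth (b + 2) (b + 1) b) (.loop (b + 1) (.seq (.moveBoth (b + 1) (b + 2) b)
    (.seq (.dec (b + 2)) (.move (b + 2) (b + 1)))))

/-- Replaces `cpair x y, 0, 0` by `0, x, y`. -/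
def Prog.unpair (b : ℕ) : Prog α :=
  .loop b (.seq (.dec b) (.ifz (b + 1)
    (.seq (.inc (b + 1)) (.move (b + 2) (b + 1)))
    (.seq (.dec (b + 1)) (.inc (b + 2)))))

/-- After the sum `s = x + y` is formed, the loop adds `s + (s - 1) + … + 1 = tri s` to the result.
No register exceeds the final value. -/
theorem RegRun.pair (σ : ℕ → ℕ) (b x y : ℕ) (hB : cpair x y ≤ B) :
    RegRun tape B (.pair b) (frame σ b [0, x, y]) (frame σ b [cpair x y, 0, 0]) := by
  have hxy := le_tri (x + y)
  have hc : cpair x y = tri (x + y) + y := rfl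
  refine .seq (σ₁ := frame σ b [y, x + y, 0]) ?_ ?_
  · have := RegRun.moveBoth (tape := tape) (B := B) (i := b + 2) (j := b + 1) (k := b)
      (by omega) (by omega) (by omega) y (frame σ b [0, x, y])
      (by simp [frame_add]) (by simp [frame_add]; omega) (by simp [frame_self]; omega)
    simpa [frame_add, frame_self, update_frame, update_frame_self] using this
  · rw [hc] at hB ⊢
    generalize x + y = s at *
    generalize y = r at *
    clear hc
    induction s generalizing r with
    | zero => simpa [tri] using RegRun.loop_done (by simp [frame_add])
    | succ s ih =>
      simp only [tri] at hB ⊢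
      refine .loop_step (σ₁ := frame σ b [r + (s + 1), s, 0]) (by simp [frame_add]) ?_ ?_
      · refine .seq (σ₁ := frame σ b [r + (s + 1), 0, s + 1]) ?_ (.seq
          (σ₁ := frame σ b [r + (s + 1), 0, s]) ?_ ?_)
        · have := RegRun.moveBoth (tape := tape) (B := B) (i := b + 1) (j := b + 2) (k := b)
            (by omega) (by omega) (by omega) (s + 1) (frame σ b [r, s + 1, 0])
            (by simp [frame_add]) (by simp [frame_add]; omega) (by simp [frame_self]; omega)
          simpa [frame_add, frame_self, update_frame, update_frame_self] using this
        · have := RegRun.dec (tape := tape) (B := B) (r := b + 2)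
            (σ := frame σ b [r + (s + 1), 0, s + 1]) (by simp [frame_add])
          simpa [frame_add, update_frame] using this
        · have := RegRun.move (tape := tape) (B := B) (i := b + 2) (j := b + 1)
            (by omega) s (frame σ b [r + (s + 1), 0, s])
            (by simp [frame_add]) (by simp [frame_add]; omega)
          simpa [frame_add, update_frame] using this
      · have := ih (le_tri s) (r + (s + 1)) (by omega)
        rwa [show tri s + (s + 1) + r = tri s + (r + (s + 1)) by omega]

theorem tri_mono : Monotone tri :=
  monotone_nat_of_le_succ fun n => by simp [tri]

/-- The values with sum `s` lie in the interval from `tri s` to `tri s + s`, and these intervals are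
disjoint. Thus the sum is determined, and then the second entry. -/
theorem cpair_inj {x y x' y' : ℕ} (h : cpair x' y' = cpair x y) : x' = x ∧ y' = y := by
  have key : ∀ {a b c d : ℕ}, cpair a b = cpair c d → ¬ a + b < c + d := by
    intro a b c d h hlt
    have h1 := tri_mono (Nat.succ_le_of_lt hlt)
    simp only [cpair, tri, Nat.succ_eq_add_one] at *
    omega
  have h1 := key h
  have h2 := key h.symm
  have h3 : x' + y' = x + y := by omega
  simp only [cpair, h3] at h
  omega

/-- The loop walks along Cantor's enumeration: each decrement of the code moves `(x, y)` to its
successor, `(x - 1, y + 1)` or, at the end of a diagonal, `(y + 1, 0)`. The invariant is that `m`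
steps remain. -/
theorem RegRun.unpair_aux (σ : ℕ → ℕ) (b m : ℕ) (x y x' y' : ℕ) (h : cpair x' y' = cpair x y + m)
    (hB : cpair x' y' + 1 ≤ B) :
    RegRun tape B (.unpair b) (frame σ b [m, x, y]) (frame σ b [0, x', y']) := by
  induction m generalizing x y with
  | zero =>
    obtain ⟨rfl, rfl⟩ := cpair_inj h
    exact .loop_done (by simp [frame_self])
  | succ m ih =>
    refine .loop_step
      (σ₁ := frame σ b (if x = 0 then [m, y + 1, 0] else [m, x - 1, y + 1]))
      (by simp [frame_self]) (.seq (σ₁ := frame σ b [m, x, y]) ?_ ?_) ?_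
    · have := RegRun.dec (tape := tape) (B := B) (r := b)
        (σ := frame σ b [m + 1, x, y]) (by simp [frame_self])
      simpa [frame_self, update_frame_self] using this
    · have hx := left_le_cpair x y
      have hy := right_le_cpair x y
      by_cases hx0 : x = 0
      · subst hx0
        refine .ifz_zero (by simp [frame_add]) (.seq (σ₁ := frame σ b [m, 1, y]) ?_ ?_)
        · have := RegRun.inc (tape := tape) (B := B) (r := b + 1)
            (σ := frame σ b [m, 0, y]) (by simp [frame_add]; omega)
          simpa [frame_add, update_frame] using this
        · have := RegRun.move (tape := tape) (B := B) (i := b + 2) (j := b + 1)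
            (by omega) y (frame σ b [m, 1, y])
            (by simp [frame_add]) (by simp [frame_add]; omega)
          simpa [frame_add, update_frame, add_comm] using this
      · refine .ifz_pos (by simpa [frame_add]) (.seq (σ₁ := frame σ b [m, x - 1, y]) ?_ ?_)
        · have := RegRun.dec (tape := tape) (B := B) (r := b + 1)
            (σ := frame σ b [m, x, y]) (by simpa [frame_add])
          simpa [frame_add, update_frame] using this
        · have := RegRun.inc (tape := tape) (B := B) (r := b + 2)
            (σ := frame σ b [m, x - 1, y]) (by simp [frame_add]; omega)
          simpa [frame_add, update_frame, hx0] using this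
    · have e : ∀ u v, cpair u v = cpair x y + 1 → RegRun tape B (.unpair b)
          (frame σ b [m, u, v]) (frame σ b [0, x', y']) := fun u v huv => ih u v (by omega)
      split_ifs with hx0
      · subst hx0; exact e _ _ (by simp [cpair, tri]; omega)
      · obtain ⟨a, rfl⟩ := Nat.exists_eq_succ_of_ne_zero hx0
        exact e _ _ (by
          simp only [cpair, Nat.succ_eq_add_one, Nat.add_sub_cancel]
          rw [show a + (y + 1) = a + 1 + y by omega]; omega)

end programs

/-! ### Functions computed in linear space -/

/-- `f` is computed by a program whose registers remain polynomially bounded. The program is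
given for every base register; it leaves the registers below the base alone and needs the
registers above the base to be zero. -/
def Lin {α β : Type} [Enc α] [Enc β] (f : α → β) : Prop :=
  ∃ (p : (γ : Type) → ℕ → Prog γ) (u : α → ℕ), PolyLe u ∧
    ∀ (γ : Type) (tape : List (InputSymbol γ)) (B b : ℕ) (σ : ℕ → ℕ) (a : α), u a ≤ B →
      RegRun tape B (p γ b) (frame σ b [enc a]) (frame σ b [enc (f a)])

section

variable {α β δ : Type} [Enc α] [Enc β] [Enc δ]

/-- The result is left in a register, and registers never exceed the space bound. It suffices to
look at one run, on an arbitrary tape. -/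
theorem Lin.polyLe {f : α → β} (hf : Lin f) : PolyLe fun a => enc (f a) := by
  obtain ⟨p, u, hu, h⟩ := hf
  refine (hu.add .enc).mono fun a => ?_
  have := (h Unit [] (u a + enc a) 0 0 a (Nat.le_add_right _ _) 0 []).regs_le (by
    intro r
    rcases r with _ | r <;> simp [frame]) 0
  simpa [frame] using this

theorem Lin.of_eq {f g : α → β} (hf : Lin f) (h : ∀ a, f a = g a) : Lin g :=
  (funext h : f = g) ▸ hf

/-- Functions on the same numbers. -/
theorem Lin.recode {α' β' : Type} [Enc α'] [Enc β'] {f : α → β} (hf : Lin f) (i : α' → α)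
    (hi : ∀ a, enc (i a) = enc a) (f' : α' → β') (hf' : ∀ a, enc (f' a) = enc (f (i a))) :
    Lin f' := by
  obtain ⟨p, u, ⟨c, hu⟩, h⟩ := hf
  refine ⟨p, fun a => u (i a), ⟨c, fun a => ?_⟩, fun γ tape B b σ a hB => ?_⟩
  · rw [← hi]; exact hu _
  · rw [← hi, hf']; exact h γ tape B b σ (i a) hB

/-! ### Closure of `Lin` under composition, pairing, branching and iteration -/

theorem Lin.id : Lin fun a : α => a :=
  ⟨fun _ _ => .skip, fun _ => 0, .const 0, fun _ _ _ _ _ _ _ _ _ => .skip _⟩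

theorem Lin.comp {g : β → δ} {f : α → β} (hg : Lin g) (hf : Lin f) : Lin fun a => g (f a) := by
  have hp := hf.polyLe
  obtain ⟨p, u, hu, h⟩ := hf
  obtain ⟨q, v, hv, h'⟩ := hg
  refine ⟨fun γ b => .seq (p γ b) (q γ b), fun a => u a + v (f a), hu.add (hv.comp hp),
    fun γ tape B b σ a hB => ?_⟩
  beta_reduce at hB
  exact .seq (h γ tape B b σ a (by omega)) (h' γ tape B b σ _ (by omega))

theorem frame_pad₁ (σ : ℕ → ℕ) (b x : ℕ) : frame σ b [x, 0] = frame σ b [x] :=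
  frame_append_zero σ b [x] 1

theorem frame_pad₂ (σ : ℕ → ℕ) (b x : ℕ) : frame σ b [x, 0, 0] = frame σ b [x] :=
  frame_append_zero σ b [x] 2

/-- A program with a higher base register acts as a subroutine that preserves the registers in `l`;
this is why `Lin` asks for programs at every base and for every `σ`. -/
theorem RegRun.sub {γ : Type} {tape : List (InputSymbol γ)} {B b b' v v' : ℕ} {p : Prog γ}
    (l : List ℕ) (hb : b' = b + l.length)
    (h : ∀ σ, RegRun tape B p (frame σ b' [v]) (frame σ b' [v'])) (σ : ℕ → ℕ) :
    RegRun tape B p (frame σ b (l ++ [v])) (frame σ b (l ++ [v'])) := by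
  have := h (frame σ b l)
  rwa [frame_frame _ _ _ _ hb, frame_frame _ _ _ _ hb] at this

theorem Lin.succ : Lin fun n : ℕ => n + 1 := by
  refine ⟨fun _ b => .inc b, fun n => n + 1, (PolyLe.enc (α := ℕ)).add (.const 1),
    fun γ tape B b σ n hB => ?_⟩
  have := RegRun.inc (tape := tape) (B := B) (r := b) (σ := frame σ b [n])
    (by simpa [frame_self] using hB)
  simpa [frame_self, update_frame_self] using this

theorem Lin.zero : Lin fun _ : α => (0 : ℕ) := by
  refine ⟨fun _ b => .clear b, fun _ => 0, .const 0, fun γ tape B b σ a hB => ?_⟩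
  have := RegRun.clear (tape := tape) (B := B) (i := b) _ (frame σ b [enc a]) rfl
  simpa [update_frame_self] using this

theorem Lin.const (k : ℕ) : Lin fun _ : α => k := by
  induction k with
  | zero => exact .zero
  | succ k ih => exact Lin.succ.comp ih

theorem RegRun.unpair {γ : Type} {tape : List (InputSymbol γ)} {B : ℕ} (σ : ℕ → ℕ) (b x y : ℕ)
    (hB : cpair x y + 1 ≤ B) :
    RegRun tape B (.unpair b) (frame σ b [cpair x y]) (frame σ b [0, x, y]) := by
  rw [← frame_pad₂]
  exact RegRun.unpair_aux σ b _ 0 0 x y (by simp [cpair, tri]) hB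

theorem Lin.fst : Lin fun x : α × β => x.1 := by
  refine ⟨fun _ b => .seq (.unpair b) (.seq (.move (b + 1) b) (.clear (b + 2))),
    fun x => enc x + 1, PolyLe.enc.add (.const 1), fun γ tape B b σ x hB => ?_⟩
  beta_reduce at hB ⊢
  have h1 := left_le_cpair (enc x.1) (enc x.2)
  rw [enc_pair] at hB ⊢
  refine (RegRun.unpair σ b _ _ hB).seq (.seq (σ₁ := frame σ b [enc x.1, 0, enc x.2]) ?_ ?_)
  · have := RegRun.move (tape := tape) (B := B) (i := b + 1) (j := b) (by omega) _
      (frame σ b [0, enc x.1, enc x.2]) rfl (by simp [frame_add, frame_self]; omega)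
    simpa [frame_add, frame_self, update_frame, update_frame_self] using this
  · have := RegRun.clear (tape := tape) (B := B) (i := b + 2) _
      (frame σ b [enc x.1, 0, enc x.2]) rfl
    simpa [update_frame, frame_pad₂] using this

theorem Lin.snd : Lin fun x : α × β => x.2 := by
  refine ⟨fun _ b => .seq (.unpair b) (.seq (.move (b + 2) b) (.clear (b + 1))),
    fun x => enc x + 1, PolyLe.enc.add (.const 1), fun γ tape B b σ x hB => ?_⟩
  beta_reduce at hB ⊢
  have h1 := right_le_cpair (enc x.1) (enc x.2)
  rw [enc_pair] at hB ⊢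
  refine (RegRun.unpair σ b _ _ hB).seq (.seq (σ₁ := frame σ b [enc x.2, enc x.1, 0]) ?_ ?_)
  · have := RegRun.move (tape := tape) (B := B) (i := b + 2) (j := b) (by omega) _
      (frame σ b [0, enc x.1, enc x.2]) rfl (by simp [frame_add, frame_self]; omega)
    simpa [frame_add, frame_self, update_frame, update_frame_self] using this
  · have := RegRun.clear (tape := tape) (B := B) (i := b + 1) _
      (frame σ b [enc x.2, enc x.1, 0]) rfl
    simpa [update_frame, frame_pad₂] using this

theorem Lin.pair {f : α → β} {g : α → δ} (hf : Lin f) (hg : Lin g) :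
    Lin fun a => (f a, g a) := by
  have hpf := hf.polyLe
  have hpg := hg.polyLe
  obtain ⟨p, u, hu, h⟩ := hf
  obtain ⟨q, v, hv, h'⟩ := hg
  refine ⟨fun γ b => .seq (.moveBoth b (b + 1) (b + 2)) (.seq (p γ (b + 2))
      (.seq (.move (b + 1) (b + 3)) (.seq (q γ (b + 3)) (.seq (.pair (b + 1))
        (.move (b + 1) b))))),
    fun a => u a + (v a + (enc a + cpair (enc (f a)) (enc (g a)))),
    hu.add (hv.add (PolyLe.enc.add (hpf.cpair hpg))), fun γ tape B b σ a hB => ?_⟩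
  beta_reduce at hB ⊢
  refine .seq (σ₁ := frame σ b [0, enc a, enc a]) ?_ (.seq (σ₁ := frame σ b [0, enc a, enc (f a)])
    (RegRun.sub [0, enc a] rfl (fun σ => h γ tape B _ σ a (by omega)) σ)
    (.seq (σ₁ := frame σ b [0, 0, enc (f a), enc a]) ?_ (.seq
      (RegRun.sub [0, 0, enc (f a)] rfl (fun σ => h' γ tape B _ σ a (by omega)) σ)
    (.seq (σ₁ := frame σ b [0, cpair (enc (f a)) (enc (g a)), 0, 0]) ?_ ?_))))
  · have := RegRun.moveBoth (tape := tape) (B := B) (i := b) (j := b + 1) (k := b + 2)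
      (by omega) (by omega) (by omega) _ (frame σ b [enc a, 0, 0]) rfl
      (by simp [frame_add, frame_self]; omega) (by simp [frame_add, frame_self]; omega)
    rw [frame_pad₂] at this
    simpa [← frame_pad₂ σ b (enc a), frame_add, frame_self, update_frame, update_frame_self]
      using this
  · have := RegRun.move (tape := tape) (B := B) (i := b + 1) (j := b + 3)
      (by omega) _ (frame σ b ([0, enc a, enc (f a)] ++ List.replicate 1 0)) rfl
      (by simp [frame_add]; omega)
    rw [frame_append_zero] at this
    simpa [← frame_append_zero σ b [0, enc a, enc (f a)] 1, frame_add, update_frame] using this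
  · have := RegRun.pair (tape := tape) (B := B) (frame σ b [0]) (b + 1) (enc (f a)) (enc (g a))
      (by omega)
    rwa [frame_frame σ b [0] _ (b' := b + 1) rfl, frame_frame σ b [0] _ (b' := b + 1) rfl] at this
  · have := RegRun.move (tape := tape) (B := B) (i := b + 1) (j := b)
      (by omega) _ (frame σ b [0, cpair (enc (f a)) (enc (g a)), 0, 0]) rfl
      (by simp [frame_add, frame_self]; omega)
    have h3 : frame σ b [cpair (enc (f a)) (enc (g a)), 0, 0, 0] = frame σ b [enc (f a, g a)] :=
      frame_append_zero σ b [_] 3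
    rw [← h3]
    simpa [frame_add, frame_self, update_frame, update_frame_self] using this

theorem Lin.ite_zero {c : α → ℕ} {f g : α → β} (hc : Lin c) (hf : Lin f) (hg : Lin g) :
    Lin fun a => if c a = 0 then f a else g a := by
  obtain ⟨r, w, hw, hr⟩ := hc
  obtain ⟨p, u, hu, h⟩ := hf
  obtain ⟨q, v, hv, h'⟩ := hg
  refine ⟨fun γ b => .seq (.moveBoth b (b + 1) (b + 2)) (.seq (r γ (b + 2))
      (.seq (.move (b + 1) b) (.ifz (b + 2) (p γ b) (.seq (.clear (b + 2)) (q γ b))))),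
    fun a => u a + (v a + (enc a + w a)),
    hu.add (hv.add (PolyLe.enc.add hw)), fun γ tape B b σ a hB => ?_⟩
  beta_reduce at hB ⊢
  refine .seq (σ₁ := frame σ b [0, enc a, enc a]) ?_ (.seq (σ₁ := frame σ b [0, enc a, enc (c a)])
    (RegRun.sub [0, enc a] rfl (fun σ => hr γ tape B _ σ a (by omega)) σ)
    (.seq (σ₁ := frame σ b [enc a, 0, enc (c a)]) ?_ ?_))
  · have := RegRun.moveBoth (tape := tape) (B := B) (i := b) (j := b + 1) (k := b + 2)
      (by omega) (by omega) (by omega) _ (frame σ b [enc a, 0, 0]) rfl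
      (by simp [frame_add, frame_self]; omega) (by simp [frame_add, frame_self]; omega)
    rw [frame_pad₂] at this
    simpa [← frame_pad₂ σ b (enc a), frame_add, frame_self, update_frame, update_frame_self]
      using this
  · have := RegRun.move (tape := tape) (B := B) (i := b + 1) (j := b)
      (by omega) _ (frame σ b [0, enc a, enc (c a)]) rfl
      (by simp [frame_add, frame_self]; omega)
    simpa [frame_add, frame_self, update_frame, update_frame_self] using this
  · by_cases hz : c a = 0
    · rw [if_pos hz]
      refine .ifz_zero (by simp [frame_add, hz]) ?_
      rw [hz, enc_nat, frame_pad₂]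
      exact h γ tape B b σ a (by omega)
    · rw [if_neg hz]
      refine .ifz_pos (by simp [frame_add, hz]) (.seq (σ₁ := frame σ b [enc a]) ?_
        (h' γ tape B b σ a (by omega)))
      have := RegRun.clear (tape := tape) (B := B) (i := b + 2) _
        (frame σ b [enc a, 0, enc (c a)]) rfl
      simpa [update_frame, frame_pad₂] using this

/-- Polynomial bounds do not survive unrestricted iteration, so a bound for all intermediate
iterates is required. It has to hold for all arguments of the type, which motivates the type
`RecState` below. -/
theorem Lin.iterate {f : α → α} (hf : Lin f)
    (hb : ∃ c, ∀ n a i, i ≤ n → enc (f^[i] a) ≤ (enc (n, a) + 2) ^ (c + 1)) :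
    Lin fun x : ℕ × α => f^[x.1] x.2 := by
  obtain ⟨p, u, ⟨d, hd⟩, h⟩ := hf
  obtain ⟨c, hc⟩ := hb
  refine ⟨fun γ b => .seq (.unpair b) (.seq (.loop (b + 1) (.seq (.dec (b + 1)) (p γ (b + 2))))
      (.move (b + 2) b)),
    fun x => (enc x + 1) + (((enc x + 2) ^ (c + 1) + 2) ^ (d + 1) + (enc x + 2) ^ (c + 1)),
    (PolyLe.enc.add (.const 1)).add (((((PolyLe.enc.add (.const 2)).pow _).add (.const 2)).pow
      _).add ((PolyLe.enc.add (.const 2)).pow _)), ?_⟩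
  rintro γ tape B b σ ⟨n, a⟩ hB
  beta_reduce at hB ⊢
  have hu : ∀ i ≤ n, u (f^[i] a) ≤ B := fun i hi => by
    have := (hd (f^[i] a)).trans (Nat.pow_le_pow_left (Nat.add_le_add_right (hc n a i hi) 2) _)
    omega
  have hn := hc n a n le_rfl
  refine .seq (RegRun.unpair σ b n (enc a) (by rw [enc_pair] at hB; simp at hB; omega)) (.seq
    (σ₁ := frame σ b [0, 0, enc (f^[n] a)]) ?_ ?_)
  · clear hB hn hc
    induction n generalizing a with
    | zero => exact .loop_done (by simp [frame_add])
    | succ n ih =>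
      refine .loop_step (σ₁ := frame σ b [0, n, enc (f a)]) (by simp [frame_add])
        (.seq (σ₁ := frame σ b [0, n, enc a]) ?_ ?_) ?_
      · have := RegRun.dec (tape := tape) (B := B) (r := b + 1)
          (σ := frame σ b [0, n + 1, enc a]) (by simp [frame_add])
        simpa [frame_add, update_frame] using this
      · exact RegRun.sub [0, n] rfl (fun σ => h γ tape B _ σ a (hu 0 (Nat.zero_le _))) σ
      · exact ih (f a) fun i hi => hu (i + 1) (by omega)
  · have := RegRun.move (tape := tape) (B := B) (i := b + 2) (j := b) (by omega) _
      (frame σ b [0, 0, enc (f^[n] a)]) rfl (by simp [frame_add, frame_self]; omega)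
    rw [← frame_pad₂]
    simpa [frame_add, frame_self, update_frame, update_frame_self] using this

end

/-! ### Arithmetic in linear space -/

theorem cpair_mono {a b c d : ℕ} (h : a ≤ c) (h' : b ≤ d) : cpair a b ≤ cpair c d :=
  Nat.add_le_add (tri_mono (Nat.add_le_add h h')) h'

section

variable {α β δ : Type} [Enc α] [Enc β] [Enc δ]

theorem Lin.comp₂ {f : α → β} {g : α → δ} {ε : Type} [Enc ε] {h : β × δ → ε} (hh : Lin h)
    (hf : Lin f) (hg : Lin g) : Lin fun a => h (f a, g a) :=
  hh.comp (hf.pair hg)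

theorem Lin.add {f g : α → ℕ} (hf : Lin f) (hg : Lin g) : Lin fun a => f a + g a := by
  have h := Lin.succ.iterate ⟨2, fun n x i hi => by
    rw [Nat.succ_iterate, enc_pair]
    have h1 := left_le_cpair (enc n) (enc x)
    have h2 := right_le_cpair (enc n) (enc x)
    simp only [enc_nat] at *
    nlinarith [pow_succ (cpair n x + 2) 2, sq_nonneg (cpair n x)]⟩
  exact (h.comp₂ hg hf).of_eq fun a => Nat.succ_iterate _ _

/-- Iterating `(x, y) ↦ (y, y + 1)` from `(0, 0)` leaves the predecessor of the number of rounds in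
the first component, and 0 after no rounds. -/
theorem Lin.pred {f : α → ℕ} (hf : Lin f) : Lin fun a => f a - 1 := by
  have key : ∀ i (x : ℕ × ℕ), (fun x : ℕ × ℕ => (x.2, x.2 + 1))^[i + 1] x =
      (x.2 + i, x.2 + i + 1) := by
    intro i x
    induction i with
    | zero => rfl
    | succ i ih => rw [Function.iterate_succ_apply', ih]; rfl
  have hP : PolyLe fun x : ℕ × ℕ × ℕ => cpair (enc x + enc x) (enc x + enc x + 1) :=
    (PolyLe.enc.add .enc).cpair ((PolyLe.enc.add .enc).add (.const 1))
  have h := (Lin.snd.pair (Lin.succ.comp Lin.snd) : Lin fun x : ℕ × ℕ => (x.2, x.2 + 1)).iterate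
    (by
      obtain ⟨c, hc⟩ := hP
      refine ⟨c, fun n x i hi => le_trans ?_ (hc (n, x))⟩
      have h1 := left_le_cpair (enc n) (enc x)
      have h2 := right_le_cpair (enc n) (enc x)
      have h3 := left_le_cpair x.1 x.2
      have h4 := right_le_cpair x.1 x.2
      simp only [enc_pair, enc_nat] at *
      cases i with
      | zero => exact cpair_mono (by simp; omega) (by simp; omega)
      | succ i => rw [key]; exact cpair_mono (by simp; omega) (by simp; omega))
  refine (Lin.fst.comp (h.comp₂ hf ((Lin.const 0).pair (Lin.const 0)))).of_eq fun a => ?_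
  cases hn : f a with
  | zero => simp [hn]
  | succ n => simp [hn, key]

theorem Lin.sub {f g : α → ℕ} (hf : Lin f) (hg : Lin g) : Lin fun a => f a - g a := by
  have key : ∀ i x, (fun n : ℕ => n - 1)^[i] x = x - i := by
    intro i
    induction i with
    | zero => intro x; rfl
    | succ i ih => intro x; rw [Function.iterate_succ_apply, ih]; omega
  have h := (Lin.id.pred : Lin fun n : ℕ => n - 1).iterate ⟨0, fun n x i hi => by
    rw [key, enc_pair]
    have h2 := right_le_cpair (enc n) (enc x)
    simp only [enc_nat, zero_add, pow_one] at *
    omega⟩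
  exact (h.comp₂ hg hf).of_eq fun a => key _ _

theorem Lin.ite_le {u v : α → ℕ} {f g : α → β} (hu : Lin u) (hv : Lin v) (hf : Lin f)
    (hg : Lin g) : Lin fun a => if u a ≤ v a then f a else g a :=
  (Lin.ite_zero (hu.sub hv) hf hg).of_eq fun a => by simp only [Nat.sub_eq_zero_iff_le]

theorem Lin.ite_lt {u v : α → ℕ} {f g : α → β} (hu : Lin u) (hv : Lin v) (hf : Lin f)
    (hg : Lin g) : Lin fun a => if u a < v a then f a else g a :=
  (Lin.ite_le (Lin.succ.comp hu) hv hf hg).of_eq fun a => by simp only [Nat.succ_le_iff]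

theorem Lin.ite_eq {u v : α → ℕ} {f g : α → β} (hu : Lin u) (hv : Lin v) (hf : Lin f)
    (hg : Lin g) : Lin fun a => if u a = v a then f a else g a :=
  (Lin.ite_zero ((hu.sub hv).add (hv.sub hu)) hf hg).of_eq fun a =>
    if_congr (by omega) rfl rfl

theorem Lin.inf {f g : α → ℕ} (hf : Lin f) (hg : Lin g) : Lin fun a => min (f a) (g a) :=
  (Lin.ite_le hf hg hf hg).of_eq fun a => by rw [Nat.min_def]

/-- A function on a finite set of indices. -/
theorem Lin.switch {n : ℕ} {u : α → ℕ} (hu : Lin u) (h : ∀ a, u a < n) {F : ℕ → α → β}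
    (hF : ∀ i, Lin (F i)) : Lin fun a => F (u a) a := by
  -- A cascade of comparisons: for each fixed `m`, only finitely many of the functions `F i` occur,
  -- so one program contains them all.
  have key : ∀ m, Lin fun a => if u a < m then F (u a) a else F m a := by
    intro m
    induction m with
    | zero => simpa using hF 0
    | succ m ih =>
      refine (Lin.ite_lt hu (.const (m + 1)) ih (hF (m + 1))).of_eq fun a => ?_
      by_cases h1 : u a < m
      · simp [h1, h1.trans (Nat.lt_succ_self m)]
      · by_cases h2 : u a = m
        · simp [h2]
        · simp [show ¬ u a < m + 1 by omega]
  exact (key n).of_eq fun a => if_pos (h a)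

/-- States of a recursion with values `r`. -/
@[ext] structure RecState (α : Type) (r : α → ℕ → ℕ) where
  arg : α
  idx : ℕ

/-- The argument, the index and the current value. -/
def RecState.triple {r : α → ℕ → ℕ} (s : RecState α r) : α × ℕ × ℕ :=
  (s.arg, s.idx, r s.arg s.idx)

instance (r : α → ℕ → ℕ) : Enc (RecState α r) := ⟨fun s => enc s.triple⟩

theorem enc_recState {r : α → ℕ → ℕ} (s : RecState α r) : enc s = enc s.triple := rfl

/-- Primitive recursion with polynomially bounded values. -/
theorem Lin.natRec {x n w : α → ℕ} {f : α × ℕ × ℕ → ℕ} (hx : Lin x) (hn : Lin n) (hf : Lin f)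
    (hw : PolyLe w)
    (hb : ∀ a i, i ≤ n a → Nat.rec (motive := fun _ => ℕ) (x a) (fun j y => f (a, j, y)) i ≤ w a) :
    Lin fun a => Nat.rec (motive := fun _ => ℕ) (x a) (fun j y => f (a, j, y)) (n a) := by
  -- The recursion is frozen after `n a` steps, so that all values of `r` satisfy the bound `w`. A
  -- `RecState` carries its value only through its code, which excludes triples with an arbitrarily
  -- large third entry.
  let r : α → ℕ → ℕ := fun a i =>
    Nat.rec (motive := fun _ => ℕ) (x a) (fun j y => f (a, j, y)) (min i (n a))
  have hr : ∀ a i, r a i ≤ w a := fun a i => hb a _ (min_le_right _ _)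
  let next : RecState α r → RecState α r := fun s => ⟨s.arg, s.idx + 1⟩
  have hnext : Lin next := by
    have h : Lin fun t : α × ℕ × ℕ =>
        (t.1, t.2.1 + 1, if t.2.1 < n t.1 then f t else t.2.2) :=
      Lin.fst.pair ((Lin.succ.comp (Lin.fst.comp .snd)).pair
        (.ite_lt (Lin.fst.comp .snd) (hn.comp .fst) hf (Lin.snd.comp .snd)))
    refine h.recode RecState.triple (fun _ => rfl) _ fun s => ?_
    rw [enc_recState]
    by_cases h : s.triple.2.1 < n s.triple.1
    · rw [if_pos h]
      have h' : s.idx < n s.arg := h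
      simp only [RecState.triple, next, r]
      rw [min_eq_left (Nat.succ_le_of_lt h'), min_eq_left h'.le]
    · rw [if_neg h]
      have h' : ¬ s.idx < n s.arg := h
      simp only [RecState.triple, next, r]
      rw [min_eq_right (by omega), min_eq_right (by omega)]
  have hit : ∀ k (s : RecState α r), next^[k] s = ⟨s.arg, s.idx + k⟩ := by
    intro k
    induction k with
    | zero => intro s; rfl
    | succ k ih =>
      intro s
      rw [Function.iterate_succ_apply, ih]
      simp only [next, RecState.mk.injEq, true_and]
      omega
  have hP : PolyLe fun t : ℕ × RecState α r =>
      cpair (enc t) (cpair (enc t + enc t) (w t.2.arg)) :=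
    PolyLe.enc.cpair ((PolyLe.enc.add .enc).cpair (hw.comp (PolyLe.enc.mono fun t =>
      (left_le_cpair (enc t.2.arg) _).trans (right_le_cpair (enc t.1) (enc t.2)))))
  have h := hnext.iterate (by
    obtain ⟨c, hc⟩ := hP
    refine ⟨c, fun k s i hi => le_trans ?_ (hc (k, s))⟩
    rw [hit]
    have h1 : k ≤ enc (k, s) := left_le_cpair (enc k) (enc s)
    have h2 : enc s ≤ enc (k, s) := right_le_cpair (enc k) (enc s)
    have h3 : enc s.arg ≤ enc s := left_le_cpair _ _
    have h4 : s.idx ≤ enc s :=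
      (left_le_cpair s.idx (r s.arg s.idx)).trans (right_le_cpair (enc s.arg) _)
    refine cpair_mono (h3.trans h2) (cpair_mono ?_ (hr _ _))
    show s.idx + i ≤ _
    omega)
  have h0 : Lin fun a => (⟨a, 0⟩ : RecState α r) :=
    (Lin.id.pair ((Lin.const 0).pair hx)).recode _ (fun _ => rfl) _ fun a => by
      rw [enc_recState]
      simp [RecState.triple, r]
  have h1 : Lin fun s : RecState α r => r s.arg s.idx :=
    (Lin.snd.comp (Lin.snd) : Lin fun t : α × ℕ × ℕ => t.2.2).recode
      RecState.triple (fun _ => rfl) _ fun _ => rfl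
  refine (h1.comp (h.comp₂ hn h0)).of_eq fun a => ?_
  simp only [hit]
  simp [r]

/-- Primitive recursion with a cap on the values. -/
theorem Lin.capRec {x n w : α → ℕ} {f : α × ℕ × ℕ → ℕ} (hx : Lin x) (hn : Lin n) (hf : Lin f)
    (hw : Lin w) : Lin fun a => Nat.rec (motive := fun _ => ℕ) (x a)
      (fun j y => min (f (a, j, y)) (w a)) (n a) :=
  Lin.natRec (f := fun t => min (f t) (w t.1)) hx hn (hf.inf (hw.comp .fst))
    (hx.polyLe.add hw.polyLe) fun a i _ => by
      cases i with
      | zero => exact Nat.le_add_right _ _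
      | succ i => exact (min_le_right _ _).trans (Nat.le_add_left _ _)

/-! ### Multiplication and division -/

theorem Lin.mul {f g : α → ℕ} (hf : Lin f) (hg : Lin g) : Lin fun a => f a * g a := by
  have key : ∀ a i, Nat.rec (motive := fun _ => ℕ) 0 (fun _ y => y + f a) i = f a * i := by
    intro a i
    induction i with
    | zero => rfl
    | succ i ih => simp only [ih]; ring
  have h := Lin.natRec (f := fun t : α × ℕ × ℕ => t.2.2 + f t.1) (.const 0) hg
    ((Lin.snd.comp .snd).add (hf.comp .fst)) (hf.polyLe.mul hg.polyLe)
    fun a i hi => by simp only [key]; exact Nat.mul_le_mul_left _ hi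
  exact h.of_eq fun a => key a _

/-- The quotient is raised by one as long as its successor times the divisor fits. `f a` rounds are
enough, and the cap `f a` has no effect. -/
theorem Lin.div {f g : α → ℕ} (hf : Lin f) (hg : Lin g) : Lin fun a => f a / g a := by
  have key : ∀ a, g a ≠ 0 → ∀ i, Nat.rec (motive := fun _ => ℕ) 0
      (fun _ y => min (if (y + 1) * g a ≤ f a then y + 1 else y) (f a)) i = min i (f a / g a) := by
    intro a ha i
    induction i with
    | zero => simp
    | succ i ih =>
      have h0 := Nat.pos_of_ne_zero ha
      have hle := Nat.div_le_self (f a) (g a)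
      simp only [ih]
      simp only [← Nat.le_div_iff_mul_le h0]
      split_ifs <;> omega
  have h := Lin.capRec (f := fun t : α × ℕ × ℕ => if (t.2.2 + 1) * g t.1 ≤ f t.1 then t.2.2 + 1
    else t.2.2) (.const 0) hf (.ite_le ((Lin.succ.comp (Lin.snd.comp .snd)).mul (hg.comp .fst))
      (hf.comp .fst) (Lin.succ.comp (Lin.snd.comp .snd)) (Lin.snd.comp .snd)) hf
  refine (Lin.ite_zero hg (.const 0) h).of_eq fun a => ?_
  split_ifs with ha
  · rw [ha, Nat.div_zero]
  · exact (key a ha _).trans (min_eq_right (Nat.div_le_self _ _))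

theorem Lin.mod {f g : α → ℕ} (hf : Lin f) (hg : Lin g) : Lin fun a => f a % g a :=
  (hf.sub (hg.mul (hf.div hg))).of_eq fun a => by
    have := Nat.div_add_mod (f a) (g a); omega

end

/-! ### Binary representations -/

/-- The number with a given binary representation. -/
def bitVal (l : List Bool) : ℕ := l.foldl (fun a b => 2 * a + b.toNat) 0

theorem bitVal_append (l l' : List Bool) :
    bitVal (l ++ l') = l'.foldl (fun a b => 2 * a + b.toNat) (bitVal l) :=
  List.foldl_append ..

theorem bitVal_mono {l l' : List Bool} (h : l <+: l') : bitVal l ≤ bitVal l' := by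
  obtain ⟨t, rfl⟩ := h
  rw [bitVal_append]
  generalize bitVal l = a
  induction t generalizing a with
  | nil => exact le_rfl
  | cons b t ih => exact le_trans (by omega) (ih (2 * a + b.toNat))

theorem bitVal_binary (k : ℕ) : bitVal (binary k) = k := by
  unfold bitVal binary
  rw [List.foldl_reverse]
  induction k using Nat.binaryRec' with
  | zero => simp
  | bit b n h ih =>
    rw [Nat.bits_append_bit n b h, List.foldr_cons, ih, Nat.bit_val]

theorem length_binary_le (k : ℕ) : (binary k).length ≤ k := by
  rw [binary, List.length_reverse, Nat.size_eq_bits_len]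
  exact Nat.size_le.2 Nat.lt_two_pow_self

/-! ### Computable functions of the input length grow logarithmically -/

theorem Machine.Outputs.unique {α Γ : Type} [Inhabited Γ] {M : Machine α Γ}
    {tape : List (InputSymbol α)} {u v : List Bool} (hu : M.Outputs tape u)
    (hv : M.Outputs tape v) : u = v := by
  obtain ⟨c, hc, hcn, rfl⟩ := hu
  obtain ⟨d, hd, hdn, rfl⟩ := hv
  rw [Part.mem_unique (StateTransition.mem_eval.2 ⟨hc, hcn⟩)
    (StateTransition.mem_eval.2 ⟨hd, hdn⟩)]

/-- The number of work configurations in a computation. -/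
theorem IsRun.exists_finset {α Γ : Type} [Inhabited Γ] [Finite Γ] {M : Machine α Γ}
    {tape : List (InputSymbol α)} {c : ℕ → Config M.Q Γ} {T : ℕ} (hc : IsRun M tape c T) {S : ℕ}
    (hS : (M.usedCells tape).encard ≤ S) :
    ∃ F : Finset (Config M.Q Γ), (∀ i ≤ T, (c i).setPos 0 ∈ F) ∧
      F.card ≤ Nat.card M.Q * (Nat.card Γ ^ S * (S * ((c T).output.length + 1))) := by
  classical
  have := M.finite_Q
  have := Fintype.ofFinite M.Q
  have := Fintype.ofFinite Γ
  obtain ⟨lo, hlo⟩ := hc.exists_window hS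
  have hS0 : 0 < S := by have := hlo 0 (Nat.zero_le _); omega
  refine ⟨(Finset.range (T + 1)).image fun i => (c i).setPos 0, fun i hi =>
    Finset.mem_image_of_mem (fun i => (c i).setPos 0) (Finset.mem_range.2 (by omega)), ?_⟩
  -- The residues only serve to land in `Fin`; along the run the entries are in range. Printed
  -- strings are prefixes of the final output, so the length determines them, and outside the window
  -- the tape is blank.
  let φ : Config M.Q Γ → M.Q × (Fin S → Γ) × Fin S × Fin ((c T).output.length + 1) := fun d =>
    (d.state, fun k => d.work (lo + k), ⟨(d.workPos - lo).toNat % S, Nat.mod_lt _ hS0⟩,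
      ⟨d.output.length % ((c T).output.length + 1), Nat.mod_lt _ (Nat.succ_pos _)⟩)
  have h := Finset.card_le_card_of_injOn (t := Finset.univ) φ
    (s := (Finset.range (T + 1)).image fun i => (c i).setPos 0)
    (fun _ _ => Finset.mem_coe.2 (Finset.mem_univ _)) (by
      intro d hd d' hd' h
      obtain ⟨i, hi, rfl⟩ := Finset.mem_image.1 (Finset.mem_coe.1 hd)
      obtain ⟨j, hj, rfl⟩ := Finset.mem_image.1 (Finset.mem_coe.1 hd')
      have hi : i ≤ T := by simpa [Nat.lt_succ_iff] using hi
      have hj : j ≤ T := by simpa [Nat.lt_succ_iff] using hj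
      simp only [φ, Config.setPos, Prod.mk.injEq, Fin.mk.injEq] at h
      obtain ⟨h1, h2, h3, h4⟩ := h
      obtain ⟨hi1, hi2⟩ := hlo i hi
      obtain ⟨hj1, hj2⟩ := hlo j hj
      have ho := hc.isPrefix_output hi
      have ho' := hc.isPrefix_output hj
      rw [Nat.mod_eq_of_lt (by omega), Nat.mod_eq_of_lt (by omega)] at h3
      rw [Nat.mod_eq_of_lt (Nat.lt_succ_of_le ho.length_le),
        Nat.mod_eq_of_lt (Nat.lt_succ_of_le ho'.length_le)] at h4
      simp only [Config.setPos, Config.mk.injEq, true_and, h1]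
      refine ⟨?_, by omega, (List.prefix_of_prefix_length_le ho ho' h4.le).eq_of_length h4⟩
      funext z
      by_cases hz : lo ≤ z ∧ z < lo + S
      · have := congrFun h2 ⟨(z - lo).toNat, by omega⟩
        simpa [hz.1] using this
      · have hz' : ∀ j ≤ T, (c j).workPos ≠ z := fun j hj hjz => hz (hjz ▸ hlo j hj)
        rw [hc.work_eq_default hi hz', hc.work_eq_default hj hz'])
  simpa [Finset.card_univ, Nat.card_eq_fintype_card] using h

/-- Otherwise the computation on 1^n has fewer than `n` work configurations, and pumping by
multiples of `n !`, which all of 1, …, n divide, gives the value `f n` at arbitrarily large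
arguments. This contradicts divergence. The output length enters the count of configurations and is
at most `f n`. -/
theorem le_of_computesInSpace {Γ : Type} [Inhabited Γ] [Finite Γ] {M : Machine Unit Γ}
    {f s : ℕ → ℕ} (hM : M.ComputesInSpace plainTape (fun w => binary (f w.length)) s)
    (hf : Tendsto f atTop atTop) (n : ℕ) :
    n ≤ Nat.card M.Q * (Nat.card Γ ^ s n * (s n * (f n + 1))) := by
  by_contra! hlt
  have hM' : ∀ n, M.Outputs (unaryTape n) (binary (f n)) ∧
      (M.usedCells (unaryTape n)).encard ≤ s n := fun n => by
    have := hM (List.replicate n ())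
    simp only [List.length_replicate] at this
    exact this
  obtain ⟨c, T, hc, ho⟩ := (hM' n).1.exists_isRun
  obtain ⟨F, hF, hcard⟩ := hc.exists_finset (hM' n).2
  have hlt' : F.card < n := by
    refine lt_of_le_of_lt (hcard.trans ?_) hlt
    rw [ho]
    have := length_binary_le (f n)
    gcongr
  have hfix : ∀ k, f (n + k * n.factorial) = f n := fun k => by
    have h := hc.outputs_add hlt' hF (d := k * n.factorial) fun i hi hi' =>
      Dvd.dvd.mul_left (Nat.dvd_factorial hi hi') k
    rw [ho] at h
    have := congrArg bitVal (h.unique (hM' _).1)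
    rw [bitVal_binary, bitVal_binary] at this
    exact this.symm
  obtain ⟨N, hN⟩ := (hf.eventually_ge_atTop (f n + 1)).exists_forall_of_atTop
  have := hN (n + N * n.factorial) (le_add_left (Nat.le_mul_of_pos_right _ n.factorial_pos))
  rw [hfix] at this
  omega

/-! ### Loops of functions computed in linear space -/

/-- The registers when only register `0` is in use. -/
def single (v : ℕ) : ℕ → ℕ := frame (fun _ => 0) 0 [v]

/-- Each round turns register 0 into the code of `(f x, t (f x))` and unpairs it, so that register 2
holds the test value that controls the loop. The bound is needed only along the given trajectory,
and the number of rounds is unrestricted. -/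
theorem exists_while {α : Type} [Enc α] {f : α → α} {t : α → ℕ} (hf : Lin f) (ht : Lin t) :
    ∃ (p : (γ : Type) → Prog γ) (u : α → ℕ), PolyLe u ∧
      ∀ (γ : Type) (tape : List (InputSymbol γ)) (B : ℕ) (x : ℕ → α) (n : ℕ),
        (∀ i < n, x (i + 1) = f (x i)) → (∀ i < n, t (x i) ≠ 0) → t (x n) = 0 →
        (∀ i ≤ n, u (x i) ≤ B) →
        RegRun tape B (p γ) (single (enc (x 0))) (single (enc (x n))) := by
  have h1 := Lin.id.pair ht
  have h2 := hf.pair (ht.comp hf)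
  have h1p := h1.polyLe
  have h2p := h2.polyLe
  obtain ⟨p, u, hu, hp⟩ := h1
  obtain ⟨q, v, hv, hq⟩ := h2
  refine ⟨fun γ => .seq (p γ 0) (.seq (.unpair 0) (.seq (.loop 2 (.seq (.clear 2) (.seq
      (.move 1 0) (.seq (q γ 0) (.unpair 0))))) (.move 1 0))),
    fun x => (u x + v x) + ((enc (x, t x) + 1) + (enc (f x, t (f x)) + 1)),
    (hu.add hv).add ((h1p.add (.const 1)).add (h2p.add (.const 1))), ?_⟩
  intro γ tape B x n hx htn ht0 hB
  beta_reduce at hB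
  have hle : ∀ i ≤ n, enc (x i) ≤ B := fun i hi => by
    have := hB i hi
    have h3 : enc (x i) ≤ enc (x i, t (x i)) := left_le_cpair _ _
    omega
  have hB0 := hB 0 (Nat.zero_le _)
  refine (hp γ tape B 0 _ (x 0) (by omega)).seq ((RegRun.unpair _ 0 (enc (x 0)) (t (x 0)) (by
    rw [enc_pair] at hB0; simp only [enc_nat] at hB0; omega)).seq ?_)
  refine .seq (σ₁ := frame (fun _ => 0) 0 [0, enc (x n), 0]) ?_ ?_
  · clear hB0
    induction n generalizing x with
    | zero => rw [ht0]; exact .loop_done rfl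
    | succ n ih =>
      have hB0 := hB 0 (Nat.zero_le _)
      refine .loop_step (σ₁ := frame (fun _ => 0) 0 [0, enc (x 1), t (x 1)])
        (htn 0 (Nat.succ_pos n)) ?_ ?_
      · refine .seq (σ₁ := frame (fun _ => 0) 0 [0, enc (x 0), 0]) ?_ (.seq
          (σ₁ := frame (fun _ => 0) 0 [enc (x 0)]) ?_ (.seq (hq γ tape B 0 _ (x 0) (by omega)) ?_))
        · have := RegRun.clear (tape := tape) (B := B) (i := 2) _
            (frame (fun _ => 0) 0 [0, enc (x 0), t (x 0)]) rfl
          have h3 := update_frame (fun _ => 0) 0 2 0 (l := [0, enc (x 0), t (x 0)]) (by simp)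
          rw [Nat.zero_add] at h3
          rwa [h3] at this
        · have := RegRun.move (tape := tape) (B := B) (i := 1) (j := 0) (by omega) _
            (frame (fun _ => 0) 0 [0, enc (x 0), 0]) rfl (by
              have := hle 0 (Nat.zero_le _)
              simpa [frame] using this)
          have h3 := fun v => update_frame (fun _ => 0) 0 1 v (l := [0, enc (x 0), 0]) (by simp)
          rw [Nat.zero_add] at h3
          rw [h3, update_frame_self _ _ _ (by simp), ← frame_pad₂] at *
          simpa [frame] using this
        · beta_reduce
          have h4 := hx 0 (Nat.succ_pos n)
          rw [Nat.zero_add] at h4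
          rw [← h4] at hB0 ⊢
          exact RegRun.unpair _ 0 (enc (x 1)) (t (x 1)) (by
            rw [enc_pair, enc_pair] at hB0; simp only [enc_nat] at hB0; omega)
      · exact ih (fun i => x (i + 1)) (fun i hi => hx (i + 1) (by omega))
          (fun i hi => htn (i + 1) (by omega)) ht0 (fun i hi => hB (i + 1) (by omega))
          (fun i hi => hle (i + 1) (by omega))
  · have := RegRun.move (tape := tape) (B := B) (i := 1) (j := 0) (by omega) _
      (frame (fun _ => 0) 0 [0, enc (x n), 0]) rfl (by
        have := hle n le_rfl
        simpa [frame] using this)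
    have h3 := fun v => update_frame (fun _ => 0) 0 1 v (l := [0, enc (x n), 0]) (by simp)
    rw [Nat.zero_add] at h3
    unfold single
    rw [h3, update_frame_self _ _ _ (by simp), ← frame_pad₂] at *
    simpa [frame] using this

/-! ### Numbers for the elements of finite types -/

/-- Numbers for the elements of a finite type. -/
structure Coding (X : Type) where
  card : ℕ
  code : X → ℕ
  decode : ℕ → X
  code_lt : ∀ x, code x < card
  decode_code : ∀ x, decode (code x) = x

/-- The normalization `code x₀ = 0` will make the blank the digit 0, so that an infinite blank
half-tape has code 0. -/
theorem exists_coding {X : Type} [Finite X] (x₀ : X) : ∃ C : Coding X, C.code x₀ = 0 := by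
  classical
  obtain ⟨n, ⟨e⟩⟩ := Finite.exists_equiv_fin X
  have hn : 0 < n := (Nat.zero_le _).trans_lt (e x₀).2
  let e₁ := e.trans (Equiv.swap (e x₀) ⟨0, hn⟩)
  refine ⟨⟨n, fun x => e₁ x, fun i => if h : i < n then e₁.symm ⟨i, h⟩ else x₀,
    fun x => (e₁ x).2, fun x => by simp⟩, by simp [e₁]⟩

/-! ### Digits -/

theorem digit_push_zero {G w : ℕ} (a : ℕ) (hw : w < G) : (a * G + w) / G ^ 0 % G = w := by
  rw [pow_zero, Nat.div_one, Nat.mul_comm, Nat.mul_add_mod, Nat.mod_eq_of_lt hw]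

theorem push_div {G w : ℕ} (a : ℕ) (hw : w < G) : (a * G + w) / G = a := by
  rw [Nat.mul_comm, Nat.mul_add_div (by omega), Nat.div_eq_of_lt hw, Nat.add_zero]

theorem digit_push_succ {G w : ℕ} (a k : ℕ) (hw : w < G) :
    (a * G + w) / G ^ (k + 1) % G = a / G ^ k % G := by
  rw [pow_succ', ← Nat.div_div_eq_div_mul, push_div a hw]

theorem digit_pop (G a k : ℕ) : a / G / G ^ k % G = a / G ^ (k + 1) % G := by
  rw [pow_succ', ← Nat.div_div_eq_div_mul]

/-- Bounds the code of a half-tape by the window in which nonblank cells can occur. -/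
theorem lt_pow_of_digits_eq_zero {G : ℕ} (hG : 1 < G) {a S : ℕ}
    (h : ∀ k, S ≤ k → a / G ^ k % G = 0) : a < G ^ S := by
  have key : ∀ y, (∀ k, y / G ^ k % G = 0) → y = 0 := by
    intro y
    induction y using Nat.strong_induction_on with
    | _ y ih =>
      intro hy
      by_contra h0
      have h1 := hy 0
      rw [pow_zero, Nat.div_one] at h1
      have h2 := ih (y / G) (Nat.div_lt_self (Nat.pos_of_ne_zero h0) hG) fun k => by
        rw [digit_pop]; exact hy _
      have := Nat.div_add_mod y G
      rw [h1, h2] at this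
      omega
  by_contra! hle
  have := key (a / G ^ S) fun k => by
    rw [Nat.div_div_eq_div_mul, ← pow_add]; exact h _ (Nat.le_add_right _ _)
  rw [Nat.div_eq_zero_iff] at this
  rcases this with h | h
  · exact absurd h (by positivity)
  · omega

/-! ### Direct simulation of a machine with a unary input alphabet -/

/-- Input length, state, position of the input head, work tape to the left of the work head,
rest of the work tape, and the number that has been printed. -/
abbrev SimState := ℕ × ℕ × ℕ × ℕ × ℕ × ℕ

section

variable {Γ : Type} (M : Machine Unit Γ) (kQ : Coding M.Q) (kΓ : Coding Γ)

/-- The input symbols `⊢`, `1` and `⊣`. -/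
def unarySymbol : ℕ → InputSymbol Unit
  | 0 => .leftEnd
  | 1 => .letter ()
  | _ => .rightEnd

/-- The number of the symbol in position `i` of the input tape. -/
def unaryCode (n i : ℕ) : ℕ := if i = 0 then 0 else if i ≤ n then 1 else 2

theorem unarySymbol_unaryCode (n i : ℕ) :
    unarySymbol (unaryCode n i) = (unaryTape n).getD i .rightEnd := by
  rw [getD_unaryTape, unaryCode]
  split_ifs <;> rfl

variable {M}

/-- The effect of an action. -/
def simAction (t : Action M.Q Γ) (x : SimState) : SimState :=
  (x.1, kQ.code t.state,
    (match t.inputMove with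
      | .left => x.2.2.1 - 1
      | .stay => x.2.2.1
      | .right => min (x.2.2.1 + 1) (x.1 + 1)),
    (match t.workMove with
      | .left => x.2.2.2.1 / (kΓ.card + 1)
      | .stay => x.2.2.2.1
      | .right => x.2.2.2.1 * (kΓ.card + 1) + kΓ.code t.write),
    (match t.workMove with
      | .left => (x.2.2.2.2.1 / (kΓ.card + 1) * (kΓ.card + 1) + kΓ.code t.write) * (kΓ.card + 1) +
          x.2.2.2.1 % (kΓ.card + 1)
      | .stay => x.2.2.2.2.1 / (kΓ.card + 1) * (kΓ.card + 1) + kΓ.code t.write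
      | .right => x.2.2.2.2.1 / (kΓ.card + 1)),
    (match t.print with
      | none => x.2.2.2.2.2
      | some b => 2 * x.2.2.2.2.2 + b.toNat))

theorem lin_simAction (t : Action M.Q Γ) : Lin (simAction kQ kΓ t) := by
  have h1 : Lin fun x : SimState => x.1 := Lin.fst
  have h3 : Lin fun x : SimState => x.2.2.1 := Lin.fst.comp (Lin.snd.comp .snd)
  have h4 : Lin fun x : SimState => x.2.2.2.1 := Lin.fst.comp (Lin.snd.comp (Lin.snd.comp .snd))
  have h5 : Lin fun x : SimState => x.2.2.2.2.1 :=
    Lin.fst.comp (Lin.snd.comp (Lin.snd.comp (Lin.snd.comp .snd)))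
  have h6 : Lin fun x : SimState => x.2.2.2.2.2 :=
    Lin.snd.comp (Lin.snd.comp (Lin.snd.comp (Lin.snd.comp .snd)))
  have hG : Lin fun _ : SimState => kΓ.card + 1 := .const _
  have hw := (((h5.div hG).mul hG).add (.const (kΓ.code t.write)))
  refine h1.pair ((Lin.const _).pair (Lin.pair ?_ (Lin.pair ?_ (Lin.pair ?_ ?_))))
  · cases t.inputMove
    · exact h3.pred
    · exact h3
    · exact (h3.add (.const 1)).inf (h1.add (.const 1))
  · cases t.workMove
    · exact h4.div hG
    · exact h4
    · exact (h4.mul hG).add (.const _)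
  · cases t.workMove
    · exact (hw.mul hG).add (h4.mod hG)
    · exact hw
    · exact h5.div hG
  · cases t.print
    · exact h6
    · exact ((Lin.const 2).mul h6).add (.const _)

/-- One step of the simulation, for a given state, input symbol and work symbol. -/
def simStepAt (q a g : ℕ) (x : SimState) : SimState :=
  (M.δ (kQ.decode q) (unarySymbol a) (kΓ.decode g)).elim x fun t => simAction kQ kΓ t x

/-- Whether the machine has not halted, for a given state, input symbol and work symbol. -/
def simRunningAt (q a g : ℕ) (_ : SimState) : ℕ :=
  (M.δ (kQ.decode q) (unarySymbol a) (kΓ.decode g)).elim 0 fun _ => 1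

/-- One step of the simulation. -/
def simStep (x : SimState) : SimState :=
  simStepAt kQ kΓ (x.2.1 % (kQ.card + 1)) (unaryCode x.1 x.2.2.1)
    (x.2.2.2.2.1 % (kΓ.card + 1)) x

/-- Whether the machine has not halted. -/
def simRunning (x : SimState) : ℕ :=
  simRunningAt kQ kΓ (x.2.1 % (kQ.card + 1)) (unaryCode x.1 x.2.2.1)
    (x.2.2.2.2.1 % (kΓ.card + 1)) x

/-- State, input symbol and work symbol take finitely many values, so the transition function is
built into the program by case distinction. The remainders make the indices bounded for all numbers;
on codes of configurations they recover the state and the scanned digit. -/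
theorem lin_sim_switch {β : Type} [Enc β] {F : ℕ → ℕ → ℕ → SimState → β}
    (hF : ∀ q a g, Lin (F q a g)) : Lin fun x : SimState =>
      F (x.2.1 % (kQ.card + 1)) (unaryCode x.1 x.2.2.1) (x.2.2.2.2.1 % (kΓ.card + 1)) x := by
  have h1 : Lin fun x : SimState => x.1 := Lin.fst
  have h2 : Lin fun x : SimState => x.2.1 := Lin.fst.comp .snd
  have h3 : Lin fun x : SimState => x.2.2.1 := Lin.fst.comp (Lin.snd.comp .snd)
  have h5 : Lin fun x : SimState => x.2.2.2.2.1 :=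
    Lin.fst.comp (Lin.snd.comp (Lin.snd.comp (Lin.snd.comp .snd)))
  refine Lin.switch (F := fun q x => F q (unaryCode x.1 x.2.2.1) (x.2.2.2.2.1 % (kΓ.card + 1)) x)
    (h2.mod (.const (kQ.card + 1))) (fun _ => Nat.mod_lt _ (Nat.succ_pos _)) fun q => ?_
  refine Lin.switch (n := 3) (u := fun x : SimState => unaryCode x.1 x.2.2.1)
    (F := fun a x => F q a (x.2.2.2.2.1 % (kΓ.card + 1)) x)
    (.ite_eq h3 (.const 0) (.const 0) (.ite_le h3 h1 (.const 1) (.const 2))) (fun x => by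
      unfold unaryCode; split_ifs <;> omega) fun a => ?_
  exact Lin.switch (F := fun g x => F q a g x)
    (h5.mod (.const (kΓ.card + 1))) (fun _ => Nat.mod_lt _ (Nat.succ_pos _)) fun g => hF q a g

theorem lin_simStep : Lin (simStep kQ kΓ) :=
  lin_sim_switch kQ kΓ fun q a g => by
    cases h : M.δ (kQ.decode q) (unarySymbol a) (kΓ.decode g) with
    | none => exact (Lin.id).of_eq fun x => by simp [simStepAt, h]
    | some t => exact (lin_simAction kQ kΓ t).of_eq fun x => by simp [simStepAt, h]

theorem lin_simRunning : Lin (simRunning kQ kΓ) :=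
  lin_sim_switch kQ kΓ fun _ _ _ => Lin.const _

/-- The numbers `x` represent the configuration `c`. -/
structure SimRep (n : ℕ) (c : Config M.Q Γ) (x : SimState) : Prop where
  len : x.1 = n
  state : x.2.1 = kQ.code c.state
  pos : x.2.2.1 = c.inputPos
  left : ∀ k : ℕ, x.2.2.2.1 / (kΓ.card + 1) ^ k % (kΓ.card + 1) =
    kΓ.code (c.work (c.workPos - 1 - k))
  right : ∀ k : ℕ, x.2.2.2.2.1 / (kΓ.card + 1) ^ k % (kΓ.card + 1) =
    kΓ.code (c.work (c.workPos + k))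
  out : x.2.2.2.2.2 = bitVal c.output

variable {kQ kΓ} {n : ℕ} {c c' : Config M.Q Γ} {x : SimState}

theorem SimRep.action_eq (h : SimRep kQ kΓ n c x) :
    M.δ (kQ.decode (x.2.1 % (kQ.card + 1))) (unarySymbol (unaryCode x.1 x.2.2.1))
      (kΓ.decode (x.2.2.2.2.1 % (kΓ.card + 1))) =
    M.δ c.state ((unaryTape n).getD c.inputPos .rightEnd) (c.work c.workPos) := by
  have h0 := h.right 0
  simp only [pow_zero, Nat.div_one, Nat.cast_zero, add_zero] at h0
  have := kQ.code_lt c.state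
  rw [unarySymbol_unaryCode, h0, kΓ.decode_code, h.state, Nat.mod_eq_of_lt (by omega),
    kQ.decode_code, h.len, h.pos]

theorem SimRep.running_of_some (h : SimRep kQ kΓ n c x)
    (hs : M.step (unaryTape n) c = some c') : simRunning kQ kΓ x ≠ 0 := by
  unfold Machine.step at hs
  obtain ⟨t, ht, -⟩ := Option.map_eq_some_iff.1 hs
  rw [simRunning, simRunningAt, h.action_eq, ht]
  exact one_ne_zero

theorem SimRep.running_of_none (h : SimRep kQ kΓ n c x)
    (hs : M.step (unaryTape n) c = none) : simRunning kQ kΓ x = 0 := by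
  unfold Machine.step at hs
  rw [Option.map_eq_none_iff] at hs
  rw [simRunning, simRunningAt, h.action_eq, hs]
  rfl

/-- The half-tapes are stacks of digits whose tops are next to the work head. A move pops a digit
from one and pushes a digit on the other. -/
theorem SimRep.step (h : SimRep kQ kΓ n c x) (hs : M.step (unaryTape n) c = some c') :
    SimRep kQ kΓ n c' (simStep kQ kΓ x) := by
  unfold Machine.step at hs
  obtain ⟨t, ht, rfl⟩ := Option.map_eq_some_iff.1 hs
  have hx : simStep kQ kΓ x = simAction kQ kΓ t x := by
    rw [simStep, simStepAt, h.action_eq, ht]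
    rfl
  rw [hx]
  have hw : kΓ.code t.write < kΓ.card + 1 := (kΓ.code_lt _).trans (Nat.lt_succ_self _)
  have hl := h.left
  have hr := h.right
  have hupd : ∀ z : ℤ, z ≠ 0 → Function.update c.work c.workPos t.write (c.workPos + z) =
      c.work (c.workPos + z) := fun z hz => Function.update_of_ne (by omega) _ _
  have hl' : ∀ k : ℕ, x.2.2.2.1 / (kΓ.card + 1) ^ k % (kΓ.card + 1) =
      kΓ.code (Function.update c.work c.workPos t.write (c.workPos - 1 - k)) := fun k => by
    rw [hl, show c.workPos - 1 - k = c.workPos + (-1 - k) by ring, hupd _ (by omega)]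
  have hr' : ∀ k : ℕ, (x.2.2.2.2.1 / (kΓ.card + 1) * (kΓ.card + 1) + kΓ.code t.write) /
      (kΓ.card + 1) ^ k % (kΓ.card + 1) =
      kΓ.code (Function.update c.work c.workPos t.write (c.workPos + k)) := fun k => by
    cases k with
    | zero => rw [digit_push_zero _ hw]; simp
    | succ k => rw [digit_push_succ _ _ hw, digit_pop, hr, hupd _ (by omega)]
  refine ⟨h.len, rfl, ?_, ?_, ?_, ?_⟩
  · simp only [simAction, length_unaryTape, h.pos, h.len]
    cases t.inputMove <;> simp [Move.onInput]
  · intro k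
    simp only [simAction]
    cases t.workMove <;> simp only [Move.onWork]
    · rw [digit_pop, hl']
      congr 2
      push_cast
      ring
    · exact hl' k
    · cases k with
      | zero => rw [digit_push_zero _ hw]; simp
      | succ k =>
        rw [digit_push_succ _ _ hw, hl']
        congr 2
        push_cast
        ring
  · intro k
    simp only [simAction]
    cases t.workMove <;> simp only [Move.onWork]
    · cases k with
      | zero =>
        rw [digit_push_zero _ (Nat.mod_lt _ (Nat.succ_pos _))]
        have := hl' 0
        simpa using this
      | succ k =>
        rw [digit_push_succ _ _ (Nat.mod_lt _ (Nat.succ_pos _)), hr']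
        congr 2
        push_cast
        ring
    · exact hr' k
    · have := hr' (k + 1)
      rw [digit_push_succ _ _ hw] at this
      rw [this]
      congr 2
      push_cast
      ring
  · simp only [simAction, h.out]
    cases t.print <;> simp [bitVal, List.foldl_append]

theorem SimRep.init [Inhabited Γ] (h : kΓ.code default = 0) (n : ℕ) :
    SimRep kQ kΓ n M.init (n, kQ.code M.start, 0, 0, 0, 0) :=
  ⟨rfl, rfl, rfl, fun k => by simp [Machine.init, h], fun k => by simp [Machine.init, h], rfl⟩

end

/-- The numbers in the simulation of a complete computation. -/
theorem IsRun.simRep {Γ : Type} [Inhabited Γ] {M : Machine Unit Γ} {kQ : Coding M.Q}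
    {kΓ : Coding Γ} (hk : kΓ.code default = 0) {n : ℕ} {c : ℕ → Config M.Q Γ} {T : ℕ}
    (hc : IsRun M (unaryTape n) c T) {i : ℕ} (hi : i ≤ T) :
    SimRep kQ kΓ n (c i) ((simStep kQ kΓ)^[i] (n, kQ.code M.start, 0, 0, 0, 0)) := by
  induction i with
  | zero => rw [hc.zero]; exact .init hk n
  | succ i ih =>
    rw [Function.iterate_succ_apply']
    exact (ih (by omega)).step (hc.step i (by omega))

theorem IsRun.simRep_le {Γ : Type} [Inhabited Γ] {M : Machine Unit Γ} {kQ : Coding M.Q}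
    {kΓ : Coding Γ} (hk : kΓ.code default = 0) {n : ℕ} {c : ℕ → Config M.Q Γ} {T S : ℕ}
    (hc : IsRun M (unaryTape n) c T) (hS : (M.usedCells (unaryTape n)).encard ≤ S) {i : ℕ}
    (hi : i ≤ T) {x : SimState} (hx : SimRep kQ kΓ n (c i) x) :
    x.1 = n ∧ x.2.1 < kQ.card ∧ x.2.2.1 ≤ n + 1 ∧ x.2.2.2.1 < (kΓ.card + 1) ^ S ∧
      x.2.2.2.2.1 < (kΓ.card + 1) ^ S ∧ x.2.2.2.2.2 ≤ bitVal (c T).output := by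
  obtain ⟨lo, hlo⟩ := hc.exists_window hS
  have hG : 1 < kΓ.card + 1 := by have := kΓ.code_lt default; omega
  have hwin : ∀ z : ℤ, z < lo ∨ lo + S ≤ z → kΓ.code ((c i).work z) = 0 := fun z hz => by
    rw [hc.work_eq_default hi fun j hj hjz => ?_, hk]
    have := hlo j hj
    omega
  have hp := hlo i hi
  refine ⟨hx.len, hx.state ▸ kQ.code_lt _, ?_, ?_, ?_, ?_⟩
  · rw [hx.pos]; simpa [length_unaryTape] using hc.inputPos_le hi
  · exact lt_pow_of_digits_eq_zero hG fun k hk => by rw [hx.left]; exact hwin _ (by omega)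
  · exact lt_pow_of_digits_eq_zero hG fun k hk => by rw [hx.right]; exact hwin _ (by omega)
  · rw [hx.out]; exact bitVal_mono (hc.isPrefix_output hi)

/-! ### Transition tables of a machine with a cyclic binary work tape -/

/-- The actual move of the input head, which cannot leave the tape. -/
def effMove {α : Type} : InputSymbol α → Move → Move
  | .leftEnd, .left => .stay
  | .rightEnd, .right => .stay
  | _, m => m

section

variable {α : Type} {M : Machine α Bool} (kQ : Coding M.Q)

theorem Coding.card_pos {X : Type} (k : Coding X) (x : X) : 0 < k.card :=
  (Nat.zero_le _).trans_lt (k.code_lt x)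

/-- The number of pairs of a state and the last printed bit, if any. -/
def nControl : ℕ := 3 * kQ.card

/-- The number of configurations on a cyclic work tape with `P` possible contents. -/
def nConf (P : ℕ) : ℕ := nControl kQ * P

/-- The number of possible entries of a table: `0` stands for no information, `1` and `2` for
halting, and `3 + c` for leaving to the right in the configuration `c`. -/
def nEntry (P : ℕ) : ℕ := nConf kQ P + 3

/-- The rotation of a cyclic tape by a move of the head. -/
def rotate (P : ℕ) : Move → ℕ → ℕ
  | .left, v => 2 * v % P + 2 * v / P
  | .stay, v => v
  | .right, v => v / 2 + v % 2 * (P / 2)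

/-- The action in the configuration `c` on the input symbol `a`. -/
def confAction (a : InputSymbol α) (c : ℕ) : Option (Action M.Q Bool) :=
  M.δ (kQ.decode (c % nControl kQ / 3)) a (decide (c / nControl kQ % 2 = 1))

/-- The effect of an action, where the control part of the configuration is `j`. -/
def confNextAt (P : ℕ) (t : Action M.Q Bool) (j v : ℕ) : ℕ :=
  rotate P t.workMove (v / 2 * 2 + t.write.toNat) * nControl kQ +
    (3 * kQ.code t.state + t.print.elim (j % 3) fun b => 1 + b.toNat)

/-- The effect of an action on a configuration. -/
def confNext (P : ℕ) (t : Action M.Q Bool) (c : ℕ) : ℕ :=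
  confNextAt kQ P t (c % nControl kQ) (c / nControl kQ)

/-- Entry `c` of the table `T`. -/
def tableEntry (P T c : ℕ) : ℕ := T / nEntry kQ P ^ c % nEntry kQ P

/-- How a computation goes on in configuration `c'` after a move of the input head. -/
def afterMove (P T : ℕ) : Move → ℕ → ℕ
  | .left, d =>
    if tableEntry kQ P T d < 3 then tableEntry kQ P T d
    else nEntry kQ P + (tableEntry kQ P T d - 3)
  | .stay, d => nEntry kQ P + d
  | .right, d => 3 + d

/-- One step of a computation on a cell with symbol `a`, for a given control part `j` and a
given scanned bit `g` of the configuration. -/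
def tableStepAt (a : InputSymbol α) (j g : ℕ) (x : ℕ × ℕ × ℕ) : ℕ :=
  (M.δ (kQ.decode (j / 3)) a (decide (g = 1))).elim (j % 3) fun t =>
    afterMove kQ x.1 x.2.1 (effMove a t.inputMove)
      (confNextAt kQ x.1 t j ((x.2.2 - nEntry kQ x.1) / nControl kQ))

/-- One step of a computation on a cell with symbol `a`, where `T` is the table of the cell to
the left. Numbers below `nEntry kQ P` are final results. -/
def tableStep (a : InputSymbol α) (x : ℕ × ℕ × ℕ) : ℕ :=
  if x.2.2 < nEntry kQ x.1 then x.2.2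
  else tableStepAt kQ a ((x.2.2 - nEntry kQ x.1) % nControl kQ)
    ((x.2.2 - nEntry kQ x.1) / nControl kQ % 2) x

/-- The computation that starts in configuration `c`. -/
def tableRun (a : InputSymbol α) (P T c n : ℕ) : ℕ :=
  Nat.rec (motive := fun _ => ℕ) (nEntry kQ P + c)
    (fun _ y => min (tableStep kQ a (P, T, y)) (nEntry kQ P + nConf kQ P)) n

/-- The entry of the new table. -/
def newEntry (a : InputSymbol α) (x : ℕ × ℕ × ℕ) : ℕ :=
  if tableRun kQ a x.1 x.2.1 x.2.2 (nConf kQ x.1) < nEntry kQ x.1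
  then tableRun kQ a x.1 x.2.1 x.2.2 (nConf kQ x.1) else 0

/-- Numbers `P`, `N`, `T`, `D`: the number of contents of the work tape, a bound for all tables,
the current table, and the result so far. -/
abbrev TableState := ℕ × ℕ × ℕ × ℕ

/-- The first `n` steps of the construction of the new table. -/
def tableBuild (a : InputSymbol α) (P N T n : ℕ) : ℕ :=
  Nat.rec (motive := fun _ => ℕ) 0
    (fun j y => min (y * nEntry kQ P + newEntry kQ a (P, T, nConf kQ P - 1 - j)) N) n

/-- The table of a cell with symbol `a`, from the table of the cell to the left. -/
def newTable (a : InputSymbol α) (x : TableState) : ℕ :=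
  tableBuild kQ a x.1 x.2.1 x.2.2.1 (nConf kQ x.1)

/-- Processing a cell of the input tape. -/
def scanCell (a : InputSymbol α) (x : TableState) : TableState :=
  (x.1, x.2.1, newTable kQ a x,
    if x.2.2.2 < 3 then x.2.2.2 else tableEntry kQ x.1 (newTable kQ a x) (x.2.2.2 - 3))

/-! #### Linear space -/

section lin

variable {β : Type} [Enc β] {p u v : β → ℕ}

theorem lin_nConf (hp : Lin p) : Lin fun x => nConf kQ (p x) := (Lin.const _).mul hp

theorem lin_nEntry (hp : Lin p) : Lin fun x => nEntry kQ (p x) :=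
  (lin_nConf kQ hp).add (.const 3)

theorem lin_tableEntry (hp : Lin p) (hu : Lin u) (hv : Lin v) :
    Lin fun x => tableEntry kQ (p x) (u x) (v x) := by
  have key : ∀ x i, Nat.rec (motive := fun _ => ℕ) (u x)
      (fun _ y => min (y / nEntry kQ (p x)) (u x)) i = u x / nEntry kQ (p x) ^ i := by
    intro x i
    induction i with
    | zero => simp
    | succ i ih =>
      simp only [ih]
      rw [Nat.div_div_eq_div_mul, ← pow_succ, min_eq_left (Nat.div_le_self _ _)]
  have h := Lin.capRec (f := fun t : β × ℕ × ℕ => t.2.2 / nEntry kQ (p t.1)) hu hv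
    ((Lin.snd.comp .snd).div (lin_nEntry kQ (hp.comp .fst))) hu
  exact (h.mod (lin_nEntry kQ hp)).of_eq fun x => by rw [key]; rfl

theorem lin_rotate (m : Move) (hp : Lin p) (hv : Lin v) : Lin fun x => rotate (p x) m (v x) := by
  have h2 : Lin fun _ : β => 2 := .const 2
  cases m
  · exact ((h2.mul hv).mod hp).add ((h2.mul hv).div hp)
  · exact hv
  · exact (hv.div h2).add ((hv.mod h2).mul (hp.div h2))

theorem lin_confNextAt (t : Action M.Q Bool) (j : ℕ) (hp : Lin p) (hv : Lin v) :
    Lin fun x => confNextAt kQ (p x) t j (v x) :=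
  ((lin_rotate t.workMove hp (((hv.div (.const 2)).mul (.const 2)).add (.const _))).mul
    (.const _)).add (.const _)

theorem lin_afterMove (m : Move) (hp : Lin p) (hu : Lin u) (hv : Lin v) :
    Lin fun x => afterMove kQ (p x) (u x) m (v x) := by
  have he := lin_tableEntry kQ hp hu hv
  cases m
  · exact .ite_lt he (.const 3) he ((lin_nEntry kQ hp).add (he.sub (.const 3)))
  · exact (lin_nEntry kQ hp).add hv
  · exact (Lin.const 3).add hv

theorem lin_tableStep (a : InputSymbol α) : Lin (tableStep kQ a) := by
  have hp : Lin fun x : ℕ × ℕ × ℕ => x.1 := .fst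
  have hT : Lin fun x : ℕ × ℕ × ℕ => x.2.1 := Lin.fst.comp .snd
  have hy : Lin fun x : ℕ × ℕ × ℕ => x.2.2 := Lin.snd.comp .snd
  have hn : Lin fun _ : ℕ × ℕ × ℕ => nControl kQ := .const _
  have hc := hy.sub (lin_nEntry kQ hp)
  have hpos : 0 < nControl kQ := Nat.mul_pos (by norm_num) (kQ.card_pos M.start)
  refine .ite_lt hy (lin_nEntry kQ hp) hy ?_
  refine Lin.switch (F := fun j x => tableStepAt kQ a j
    ((x.2.2 - nEntry kQ x.1) / nControl kQ % 2) x) (hc.mod hn) (fun _ => Nat.mod_lt _ hpos)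
    fun j => ?_
  refine Lin.switch (F := fun g x => tableStepAt kQ a j g x) ((hc.div hn).mod (.const 2))
    (fun _ => Nat.mod_lt _ (by norm_num)) fun g => ?_
  cases h : M.δ (kQ.decode (j / 3)) a (decide (g = 1)) with
  | none => exact (Lin.const (j % 3)).of_eq fun x => by simp [tableStepAt, h]
  | some t =>
    exact (lin_afterMove kQ (effMove a t.inputMove) hp hT
      (lin_confNextAt kQ t j hp (hc.div hn))).of_eq fun x => by simp [tableStepAt, h]

theorem lin_newEntry (a : InputSymbol α) (hp : Lin p) (hu : Lin u) (hv : Lin v) :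
    Lin fun x => newEntry kQ a (p x, u x, v x) := by
  have hf : Lin fun t : β × ℕ × ℕ => tableStep kQ a (p t.1, u t.1, t.2.2) :=
    (lin_tableStep kQ a).comp ((hp.comp .fst).pair ((hu.comp .fst).pair (Lin.snd.comp .snd)))
  have h : Lin fun x => tableRun kQ a (p x) (u x) (v x) (nConf kQ (p x)) :=
    Lin.capRec ((lin_nEntry kQ hp).add hv) (lin_nConf kQ hp) hf
      ((lin_nEntry kQ hp).add (lin_nConf kQ hp))
  exact .ite_lt h (lin_nEntry kQ hp) h (.const 0)

theorem lin_newTable (a : InputSymbol α) : Lin (newTable kQ a) := by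
  have hp : Lin fun x : TableState => x.1 := .fst
  have hN : Lin fun x : TableState => x.2.1 := Lin.fst.comp .snd
  have hT : Lin fun x : TableState => x.2.2.1 := Lin.fst.comp (Lin.snd.comp .snd)
  have hp' := hp.comp (Lin.fst : Lin fun t : TableState × ℕ × ℕ => t.1)
  exact Lin.capRec (f := fun t : TableState × ℕ × ℕ => t.2.2 * nEntry kQ t.1.1 +
    newEntry kQ a (t.1.1, t.1.2.2.1, nConf kQ t.1.1 - 1 - t.2.1)) (.const 0) (lin_nConf kQ hp)
    (((Lin.snd.comp .snd).mul (lin_nEntry kQ hp')).add (lin_newEntry kQ a hp'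
      (hT.comp .fst) (((lin_nConf kQ hp').sub (.const 1)).sub (Lin.fst.comp .snd)))) hN

theorem lin_scanCell (a : InputSymbol α) : Lin (scanCell kQ a) := by
  have hp : Lin fun x : TableState => x.1 := .fst
  have hN : Lin fun x : TableState => x.2.1 := Lin.fst.comp .snd
  have hD : Lin fun x : TableState => x.2.2.2 := Lin.snd.comp (Lin.snd.comp .snd)
  exact hp.pair (hN.pair ((lin_newTable kQ a).pair (.ite_lt hD (.const 3) hD
    (lin_tableEntry kQ hp (lin_newTable kQ a) (hD.sub (.const 3))))))

end lin

/-! #### Correctness -/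

/-- The position of the input head after a move. -/
def headPos : Move → ℕ → ℕ
  | .left, i => i - 1
  | .stay, i => i
  | .right, i => i + 1

/-- The computation that starts in configuration `c` on cell `i` halts after `t` steps with
result `b`. -/
def HaltsIn (sym : ℕ → InputSymbol α) (P b : ℕ) : ℕ → ℕ → ℕ → Prop
  | 0, c, i => confAction kQ (sym i) c = none ∧ c % nControl kQ % 3 = b
  | t + 1, c, i => ∃ A, confAction kQ (sym i) c = some A ∧
      HaltsIn sym P b t (confNext kQ P A c) (headPos (effMove (sym i) A.inputMove) i)

variable {kQ} {sym : ℕ → InputSymbol α} {P b : ℕ}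

/-- The remaining time is a function of configuration and cell. Hence a halting computation never
repeats a configuration on the same cell, which justifies stopping after `nConf` steps. -/
theorem HaltsIn.unique {t t' c i : ℕ} (h : HaltsIn kQ sym P b t c i)
    (h' : HaltsIn kQ sym P b t' c i) : t = t' := by
  induction t generalizing t' c i with
  | zero =>
    cases t' with
    | zero => rfl
    | succ t' =>
      obtain ⟨A, hA, -⟩ := h'
      rw [h.1] at hA
      cases hA
  | succ t ih =>
    obtain ⟨A, hA, h⟩ := h
    cases t' with
    | zero => rw [h'.1] at hA; cases hA
    | succ t' =>
      obtain ⟨A', hA', h'⟩ := h'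
      rw [hA] at hA'
      cases hA'
      rw [ih h h']

theorem rotate_lt {m : ℕ} (hm : m ≠ 0) (mv : Move) {v : ℕ} (hv : v < 2 ^ m) :
    rotate (2 ^ m) mv v < 2 ^ m := by
  obtain ⟨n, rfl⟩ := Nat.exists_eq_succ_of_ne_zero hm
  cases mv
  · have h1 : 2 * v % 2 ^ (n + 1) = 2 * (v % 2 ^ n) := by
      rw [pow_succ', Nat.mul_mod_mul_left]
    have h2 : 2 * v / 2 ^ (n + 1) = v / 2 ^ n := by
      rw [pow_succ', Nat.mul_div_mul_left _ _ (by norm_num)]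
    have h3 : v % 2 ^ n < 2 ^ n := Nat.mod_lt _ (by positivity)
    have h4 : v / 2 ^ n < 2 := by
      rw [Nat.div_lt_iff_lt_mul (by positivity), ← pow_succ']; exact hv
    simp only [rotate, Nat.succ_eq_add_one]
    rw [h1, h2, pow_succ']
    omega
  · exact hv
  · have h1 : 2 ^ (n + 1) / 2 = 2 ^ n := by rw [pow_succ]; simp
    have h2 : v % 2 < 2 := Nat.mod_lt _ (by norm_num)
    simp only [rotate, Nat.succ_eq_add_one, h1]
    rw [Nat.succ_eq_add_one, pow_succ'] at hv
    rw [pow_succ']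
    have : v % 2 * 2 ^ n ≤ 1 * 2 ^ n := Nat.mul_le_mul_right _ (by omega)
    omega

theorem nControl_pos (kQ : Coding M.Q) : 0 < nControl kQ :=
  Nat.mul_pos (by norm_num) (kQ.card_pos M.start)

theorem confNext_lt {m : ℕ} (hm : m ≠ 0) (t : Action M.Q Bool) {c : ℕ}
    (hc : c < nConf kQ (2 ^ m)) : confNext kQ (2 ^ m) t c < nConf kQ (2 ^ m) := by
  have h1 : c / nControl kQ < 2 ^ m := Nat.div_lt_of_lt_mul hc
  have h2 : c / nControl kQ / 2 * 2 + t.write.toNat < 2 ^ m := by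
    obtain ⟨n, rfl⟩ := Nat.exists_eq_succ_of_ne_zero hm
    rw [Nat.succ_eq_add_one, pow_succ'] at *
    have := Bool.toNat_lt t.write
    omega
  have h3 := rotate_lt hm t.workMove h2
  have h4 := kQ.code_lt t.state
  have h5 : (t.print.elim (c % nControl kQ % 3) fun b => 1 + b.toNat) < 3 := by
    cases t.print with
    | none => exact Nat.mod_lt _ (by norm_num)
    | some b => have := Bool.toNat_lt b; simp only [Option.elim]; omega
  unfold confNext confNextAt nConf
  calc _ < rotate (2 ^ m) t.workMove (c / nControl kQ / 2 * 2 + t.write.toNat) * nControl kQ +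
      nControl kQ := by
        apply Nat.add_lt_add_left
        unfold nControl at *
        omega
    _ = (rotate (2 ^ m) t.workMove (c / nControl kQ / 2 * 2 + t.write.toNat) + 1) *
      nControl kQ := by ring
    _ ≤ 2 ^ m * nControl kQ := Nat.mul_le_mul_right _ h3
    _ = _ := Nat.mul_comm _ _

/-- The table `T` describes the computations that start on cell `i` until they move on to
cell `i + 1`. -/
def GoodTable (kQ : Coding M.Q) (sym : ℕ → InputSymbol α) (P b T i : ℕ) : Prop :=
  ∀ c < nConf kQ P, ∀ t, HaltsIn kQ sym P b t c i → tableEntry kQ P T c = b ∨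
    ∃ c' < nConf kQ P, ∃ t' < t, tableEntry kQ P T c = 3 + c' ∧ sym i ≠ .rightEnd ∧
      HaltsIn kQ sym P b t' c' (i + 1)

/-- A move to the left is followed by a lookup in the old table, which covers the whole excursion up
to the return to cell `i`. In each case other than halting the remaining time decreases. On the left
endmarker no such lookup occurs, so there `T` is arbitrary. -/
theorem tableStep_spec {m T t c i : ℕ} (hm : m ≠ 0) (hP : P = 2 ^ m) (hb : b < 3)
    (hT : sym i = .leftEnd ∨ 0 < i ∧ GoodTable kQ sym P b T (i - 1)) (hc : c < nConf kQ P)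
    (h : HaltsIn kQ sym P b t c i) :
    tableStep kQ (sym i) (P, T, nEntry kQ P + c) = b ∨
    (∃ c' < nConf kQ P, ∃ t' < t, tableStep kQ (sym i) (P, T, nEntry kQ P + c) = 3 + c' ∧
      sym i ≠ .rightEnd ∧ HaltsIn kQ sym P b t' c' (i + 1)) ∨
    (∃ c' < nConf kQ P, ∃ t' < t, tableStep kQ (sym i) (P, T, nEntry kQ P + c) =
      nEntry kQ P + c' ∧ HaltsIn kQ sym P b t' c' i) := by
  have hstep : tableStep kQ (sym i) (P, T, nEntry kQ P + c) =
      (confAction kQ (sym i) c).elim (c % nControl kQ % 3) fun A =>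
        afterMove kQ P T (effMove (sym i) A.inputMove) (confNext kQ P A c) := by
    rw [tableStep, if_neg (by simp)]
    simp only [tableStepAt, Nat.add_sub_cancel_left]
    rfl
  rw [hstep]
  cases t with
  | zero =>
    left
    rw [h.1]
    exact h.2
  | succ t =>
    obtain ⟨A, hA, h⟩ := h
    rw [hA]
    have hlt : confNext kQ P A c < nConf kQ P := by subst hP; exact confNext_lt hm A hc
    simp only [Option.elim]
    cases hmv : effMove (sym i) A.inputMove with
    | stay =>
      rw [hmv] at h
      exact Or.inr (Or.inr ⟨_, hlt, t, Nat.lt_succ_self t, rfl, h⟩)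
    | right =>
      rw [hmv] at h
      refine Or.inr (Or.inl ⟨_, hlt, t, Nat.lt_succ_self t, rfl, ?_, h⟩)
      intro hr
      rw [hr] at hmv
      cases hA : A.inputMove <;> simp [hA, effMove] at hmv
    | left =>
      rw [hmv] at h
      obtain hT | ⟨hi, hT⟩ := hT
      · rw [hT] at hmv
        cases hA : A.inputMove <;> simp [hA, effMove] at hmv
      · simp only [headPos] at h
        rcases hT _ hlt t h with h' | ⟨c', hc', t', ht', h', -, hh⟩
        · left
          simp [afterMove, h', hb]
        · refine Or.inr (Or.inr ⟨c', hc', t', by omega, ?_, ?_⟩)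
          · simp [afterMove, h']
          · rwa [Nat.sub_add_cancel hi] at hh

/-- While the run has not ended, the set `V` collects the configurations already met on this cell.
Their remaining times are larger than the current one, so they are distinct from the current
configuration and `V` gains one element per step. -/
theorem tableRun_spec {m T t c i : ℕ} (hm : m ≠ 0) (hP : P = 2 ^ m) (hb : b < 3)
    (hT : sym i = .leftEnd ∨ 0 < i ∧ GoodTable kQ sym P b T (i - 1)) (hc : c < nConf kQ P)
    (h : HaltsIn kQ sym P b t c i) (n : ℕ) :
    tableRun kQ (sym i) P T c n = b ∨
    (∃ c' < nConf kQ P, ∃ t' < t, tableRun kQ (sym i) P T c n = 3 + c' ∧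
      sym i ≠ .rightEnd ∧ HaltsIn kQ sym P b t' c' (i + 1)) ∨
    (∃ c' < nConf kQ P, ∃ t' ≤ t, tableRun kQ (sym i) P T c n = nEntry kQ P + c' ∧
      HaltsIn kQ sym P b t' c' i ∧ ∃ V ⊆ Finset.range (nConf kQ P), V.card = n ∧
        ∀ v ∈ V, ∃ t'' > t', HaltsIn kQ sym P b t'' v i) := by
  have hn : nEntry kQ P = nConf kQ P + 3 := rfl
  induction n with
  | zero => exact Or.inr (Or.inr ⟨c, hc, t, le_rfl, rfl, h, ∅, by simp, rfl, by simp⟩)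
  | succ n ih =>
    have hs : tableRun kQ (sym i) P T c (n + 1) =
      min (tableStep kQ (sym i) (P, T, tableRun kQ (sym i) P T c n))
        (nEntry kQ P + nConf kQ P) := rfl
    have hfin : ∀ y, y < nEntry kQ P → tableStep kQ (sym i) (P, T, y) = y := fun y hy => by
      rw [tableStep, if_pos hy]
    rcases ih with h0 | ⟨c', hc', t', ht', h0, h1, h2⟩ | ⟨c', hc', t', ht', h0, h1, V, hV, hVn, hVt⟩
    · left
      rw [hs, h0, hfin _ (by omega), min_eq_left (by omega)]
    · refine Or.inr (Or.inl ⟨c', hc', t', ht', ?_, h1, h2⟩)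
      rw [hs, h0, hfin _ (by omega), min_eq_left (by omega)]
    · rw [hs, h0]
      rcases tableStep_spec hm hP hb hT hc' h1 with h3 | ⟨d, hd, u, hu, h3, h4, h5⟩ |
        ⟨d, hd, u, hu, h3, h4⟩
      · left
        rw [h3, min_eq_left (by omega)]
      · refine Or.inr (Or.inl ⟨d, hd, u, by omega, ?_, h4, h5⟩)
        rw [h3, min_eq_left (by omega)]
      · refine Or.inr (Or.inr ⟨d, hd, u, by omega, ?_, h4, insert c' V, ?_, ?_, ?_⟩)
        · rw [h3, min_eq_left (by omega)]
        · exact Finset.insert_subset (Finset.mem_range.2 hc') hV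
        · rw [Finset.card_insert_of_notMem, hVn]
          intro hmem
          obtain ⟨t'', ht'', h6⟩ := hVt c' hmem
          exact absurd (h1.unique h6) (by omega)
        · intro v hv
          rcases Finset.mem_insert.1 hv with rfl | hv
          · exact ⟨t', hu, h1⟩
          · obtain ⟨t'', ht'', h6⟩ := hVt v hv
            exact ⟨t'', by omega, h6⟩

theorem newEntry_spec {m T t c i : ℕ} (hm : m ≠ 0) (hP : P = 2 ^ m) (hb : b < 3)
    (hT : sym i = .leftEnd ∨ 0 < i ∧ GoodTable kQ sym P b T (i - 1)) (hc : c < nConf kQ P)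
    (h : HaltsIn kQ sym P b t c i) :
    newEntry kQ (sym i) (P, T, c) = b ∨
    ∃ c' < nConf kQ P, ∃ t' < t, newEntry kQ (sym i) (P, T, c) = 3 + c' ∧
      sym i ≠ .rightEnd ∧ HaltsIn kQ sym P b t' c' (i + 1) := by
  have hn : nEntry kQ P = nConf kQ P + 3 := rfl
  simp only [newEntry]
  rcases tableRun_spec hm hP hb hT hc h (nConf kQ P) with h0 | ⟨c', hc', t', ht', h0, h1⟩ |
    ⟨c', hc', t', ht', h0, h1, V, hV, hVn, hVt⟩
  · left
    rw [h0, if_pos (by omega)]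
  · refine Or.inr ⟨c', hc', t', ht', ?_, h1⟩
    rw [h0, if_pos (by omega)]
  -- After `nConf` steps `V` contains all configurations, including the current one, which would
  -- then have two different remaining times.
  · have hVe := Finset.eq_of_subset_of_card_le hV (by rw [hVn, Finset.card_range])
    obtain ⟨t'', ht'', h6⟩ := hVt c' (hVe ▸ Finset.mem_range.2 hc')
    exact absurd (h1.unique h6) (by omega)

theorem newEntry_lt (a : InputSymbol α) (x : ℕ × ℕ × ℕ) : newEntry kQ a x < nEntry kQ x.1 := by
  unfold newEntry
  split_ifs with h
  · exact h
  · simp [nEntry]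

/-- Entries are pushed as lowest digits, so they are computed from the last one to the first, and
finally digit `c` is entry `c`. Partial tables are below `N`, so the cap is never effective. -/
theorem tableBuild_spec (a : InputSymbol α) {P N : ℕ} (T : ℕ)
    (hN : N = nEntry kQ P ^ nConf kQ P) (n : ℕ) (hn : n ≤ nConf kQ P) :
    tableBuild kQ a P N T n < nEntry kQ P ^ n ∧ ∀ i < n,
      tableBuild kQ a P N T n / nEntry kQ P ^ i % nEntry kQ P =
        newEntry kQ a (P, T, nConf kQ P - n + i) := by
  induction n with
  | zero => exact ⟨by simp [tableBuild], fun i hi => absurd hi (Nat.not_lt_zero i)⟩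
  | succ n ih =>
    obtain ⟨ih1, ih2⟩ := ih (by omega)
    have he := newEntry_lt (kQ := kQ) a (P, T, nConf kQ P - 1 - n)
    simp only at he
    have hlt : tableBuild kQ a P N T n * nEntry kQ P +
        newEntry kQ a (P, T, nConf kQ P - 1 - n) < nEntry kQ P ^ (n + 1) := by
      rw [pow_succ]
      calc _ < tableBuild kQ a P N T n * nEntry kQ P + nEntry kQ P := by omega
        _ = (tableBuild kQ a P N T n + 1) * nEntry kQ P := by ring
        _ ≤ _ := Nat.mul_le_mul_right _ ih1
    have hle : nEntry kQ P ^ (n + 1) ≤ N :=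
      hN ▸ Nat.pow_le_pow_right (by simp [nEntry]) hn
    have hs : tableBuild kQ a P N T (n + 1) = tableBuild kQ a P N T n * nEntry kQ P +
        newEntry kQ a (P, T, nConf kQ P - 1 - n) :=
      min_eq_left (hlt.le.trans hle)
    rw [hs]
    refine ⟨hlt, fun i hi => ?_⟩
    cases i with
    | zero => rw [digit_push_zero _ he]; congr 3; omega
    | succ i => rw [digit_push_succ _ _ he, ih2 i (by omega)]; congr 3; omega

/-- The invariant of the scan. Only configurations that lead to halting with `b` are controlled; the
other entries of a table are irrelevant, as the actual computation never uses them. -/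
theorem scanCell_spec {m i : ℕ} {x : TableState} (hm : m ≠ 0) (hP : x.1 = 2 ^ m)
    (hN : x.2.1 = nEntry kQ x.1 ^ nConf kQ x.1) (hb : b < 3)
    (hT : sym i = .leftEnd ∨ 0 < i ∧ GoodTable kQ sym x.1 b x.2.2.1 (i - 1))
    (hD : x.2.2.2 = b ∨ ∃ c < nConf kQ x.1, ∃ t, x.2.2.2 = 3 + c ∧
      HaltsIn kQ sym x.1 b t c i) :
    GoodTable kQ sym x.1 b (scanCell kQ (sym i) x).2.2.1 i ∧
    ((scanCell kQ (sym i) x).2.2.2 = b ∨ sym i ≠ .rightEnd ∧ ∃ c < nConf kQ x.1, ∃ t,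
      (scanCell kQ (sym i) x).2.2.2 = 3 + c ∧ HaltsIn kQ sym x.1 b t c (i + 1)) := by
  have hg : GoodTable kQ sym x.1 b (newTable kQ (sym i) x) i := by
    intro c hc t h
    have := (tableBuild_spec (sym i) x.2.2.1 hN _ le_rfl).2 c hc
    rw [Nat.sub_self, Nat.zero_add] at this
    have h' : tableEntry kQ x.1 (newTable kQ (sym i) x) c =
      newEntry kQ (sym i) (x.1, x.2.2.1, c) := this
    rw [h']
    exact newEntry_spec hm hP hb hT hc h
  refine ⟨hg, ?_⟩
  simp only [scanCell]
  rcases hD with hD | ⟨c, hc, t, hD, h⟩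
  · left
    rw [hD, if_pos hb]
  · rw [hD, if_neg (by omega), Nat.add_sub_cancel_left]
    rcases hg c hc t h with h' | ⟨c', hc', t', ht', h', h1, h2⟩
    · exact Or.inl h'
    · exact Or.inr ⟨h1, c', hc', t', h', h2⟩

/-- The size bound comes from the cap and from the remainder in `tableEntry`, whatever the contents
of the table are. -/
theorem scanCell_le {a : InputSymbol α} {x : TableState} (hN : nEntry kQ x.1 ≤ x.2.1) :
    (scanCell kQ a x).2.2.1 ≤ x.2.1 ∧
      (scanCell kQ a x).2.2.2 ≤ x.2.1 := by
  constructor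
  · show tableBuild kQ a x.1 x.2.1 x.2.2.1 (nConf kQ x.1) ≤ x.2.1
    cases nConf kQ x.1 with
    | zero => exact Nat.zero_le _
    | succ n => exact min_le_right _ _
  · simp only [scanCell]
    split_ifs with h
    · have : nEntry kQ x.1 = nConf kQ x.1 + 3 := rfl
      omega
    · exact (Nat.mod_lt _ (by simp [nEntry])).le.trans hN

end

/-! ### Computations on a cyclic work tape -/

theorem testBit_write (v k : ℕ) (b : Bool) :
    (v / 2 * 2 + b.toNat).testBit k = if k = 0 then b else v.testBit k := by
  rw [Nat.mul_comm, ← pow_one 2,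
    Nat.testBit_two_pow_mul_add _ (by rw [pow_one]; exact Bool.toNat_lt b)]
  cases k with
  | zero => cases b <;> rfl
  | succ k => simp [Nat.testBit_succ]

theorem testBit_rotate_right {n v : ℕ} (hv : v < 2 ^ (n + 1)) (k : ℕ) :
    (rotate (2 ^ (n + 1)) .right v).testBit k =
      if k < n then v.testBit (k + 1) else (v % 2).testBit (k - n) := by
  have h1 : 2 ^ (n + 1) / 2 = 2 ^ n := by rw [pow_succ]; simp
  have h2 : v / 2 < 2 ^ n := by rw [pow_succ] at hv; omega
  simp only [rotate]
  rw [h1, Nat.add_comm, Nat.mul_comm, Nat.testBit_two_pow_mul_add _ h2, Nat.testBit_succ]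

theorem testBit_rotate_left {n v : ℕ} (hv : v < 2 ^ (n + 1)) (k : ℕ) (hk : k < n + 1) :
    (rotate (2 ^ (n + 1)) .left v).testBit k =
      if k = 0 then v.testBit n else v.testBit (k - 1) := by
  have h1 : 2 * v % 2 ^ (n + 1) = 2 ^ 1 * (v % 2 ^ n) := by
    rw [pow_succ', Nat.mul_mod_mul_left, pow_one]
  have h2 : 2 * v / 2 ^ (n + 1) = v / 2 ^ n := by
    rw [pow_succ', Nat.mul_div_mul_left _ _ (by norm_num)]
  have h4 : v / 2 ^ n < 2 ^ 1 := by
    rw [Nat.div_lt_iff_lt_mul (by positivity), ← pow_add, Nat.add_comm]; exact hv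
  simp only [rotate]
  rw [h1, h2, Nat.testBit_two_pow_mul_add _ h4]
  cases k with
  | zero => rw [Nat.testBit_div_two_pow]; simp
  | succ k =>
    have : k < n := by omega
    simp [Nat.testBit_mod_two_pow, this]

/-! ### Symbols and head moves on the ordinary input tape -/

theorem getD_plainTape {α : Type} (w : List α) (p : ℕ) :
    (plainTape w).getD p .rightEnd =
      if p = 0 then .leftEnd else (w[p - 1]?).elim .rightEnd .letter := by
  unfold plainTape
  cases p with
  | zero => rfl
  | succ p =>
    simp only [List.getD_cons_succ, Nat.add_sub_cancel, Nat.succ_ne_zero, if_false]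
    by_cases h : p < w.length
    · rw [List.getD_append _ _ _ _ (by simpa)]
      simp [h]
    · rw [List.getD_append_right _ _ _ _ (by simpa using h)]
      rw [List.getElem?_eq_none (by omega)]
      cases h : p - (List.map InputSymbol.letter w).length <;> simp

theorem length_plainTape {α : Type} (w : List α) : (plainTape w).length = w.length + 2 := by
  simp [plainTape]

/-- Whether a move is blocked can be seen from the scanned symbol. The table construction therefore
needs neither the head position nor the input length. -/
theorem onInput_plainTape {α : Type} (w : List α) {p : ℕ} (hp : p ≤ w.length + 1) (m : Move) :
    m.onInput (plainTape w).length p =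
      headPos (effMove ((plainTape w).getD p .rightEnd) m) p := by
  rw [getD_plainTape, length_plainTape]
  split_ifs with h
  · subst h
    cases m <;> simp [Move.onInput, headPos, effMove]
  · rcases Nat.lt_or_ge (p - 1) w.length with h' | h'
    · rw [List.getElem?_eq_getElem h']
      cases m <;> simp [Move.onInput, headPos, effMove]
      omega
    · rw [List.getElem?_eq_none h']
      cases m <;> simp [Move.onInput, headPos, effMove]
      omega

/-- The last printed bit: `0` if nothing has been printed, `1` for `false`, `2` for `true`. -/
def lastBit (l : List Bool) : ℕ := l.getLast?.elim 0 fun b => 1 + b.toNat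

theorem lastBit_lt (l : List Bool) : lastBit l < 3 := by
  unfold lastBit
  cases l.getLast? with
  | none => simp
  | some b => have := Bool.toNat_lt b; simp only [Option.elim]; omega

theorem lastBit_append (l : List Bool) (p : Option Bool) :
    lastBit (l ++ p.toList) = p.elim (lastBit l) fun b => 1 + b.toNat := by
  cases p <;> simp [lastBit]

section

variable {α : Type} {M : Machine α Bool} {kQ : Coding M.Q} {m : ℕ} {lo : ℤ}

/-- The number `d` represents the configuration `c` whose work tape is the window of length `m`
that starts at `lo`; the bits are listed cyclically, starting with the scanned one. -/
structure CycRep (kQ : Coding M.Q) (m : ℕ) (lo : ℤ) (c : Config M.Q Bool) (d : ℕ) : Prop where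
  lt : d / nControl kQ < 2 ^ m
  bits : ∀ k < m, (d / nControl kQ).testBit k =
    c.work (c.workPos + k - if c.workPos + k < lo + m then (0 : ℤ) else m)
  control : d % nControl kQ = 3 * kQ.code c.state + lastBit c.output

theorem CycRep.init : CycRep kQ m lo M.init (3 * kQ.code M.start) := by
  have h : 3 * kQ.code M.start < nControl kQ := by
    have := kQ.code_lt M.start
    unfold nControl
    omega
  refine ⟨?_, fun k _ => ?_, ?_⟩
  · rw [Nat.div_eq_of_lt h]; positivity
  · rw [Nat.div_eq_of_lt h, Nat.zero_testBit]; rfl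
  · rw [Nat.mod_eq_of_lt h]; rfl

theorem CycRep.action_eq {c : Config M.Q Bool} {d : ℕ} (h : CycRep kQ m lo c d)
    (hlo : lo ≤ c.workPos ∧ c.workPos < lo + m) (a : InputSymbol α) :
    confAction kQ a d = M.δ c.state a (c.work c.workPos) := by
  have h0 := h.bits 0 (by omega)
  rw [Nat.cast_zero, add_zero, if_pos hlo.2, sub_zero, Nat.testBit_zero] at h0
  have := lastBit_lt c.output
  rw [confAction, h0, h.control, Nat.mul_add_div (by norm_num), Nat.div_eq_of_lt this,
    Nat.add_zero, kQ.decode_code]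

/-- Writing changes the lowest bit, and a move rotates the word. The bit that passes from one end to
the other is the cell at the border of the window, and by `hlo'` the head never uses this
wrap-around to leave the window. -/
theorem CycRep.next {c : Config M.Q Bool} {d : ℕ} (h : CycRep kQ m lo c d)
    (hlo : lo ≤ c.workPos ∧ c.workPos < lo + m) (t : Action M.Q Bool) (p : ℕ)
    (hlo' : lo ≤ t.workMove.onWork c.workPos ∧ t.workMove.onWork c.workPos < lo + m) :
    CycRep kQ m lo ⟨t.state, p, Function.update c.work c.workPos t.write,
      t.workMove.onWork c.workPos, c.output ++ t.print.toList⟩ (confNext kQ (2 ^ m) t d) := by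
  have hm : m ≠ 0 := by omega
  obtain ⟨hv, hb, hc⟩ := h
  have hl := lastBit_lt (c.output ++ t.print.toList)
  have hj : d % nControl kQ % 3 = lastBit c.output := by
    rw [hc, Nat.mul_add_mod, Nat.mod_eq_of_lt (lastBit_lt _)]
  have hcode := kQ.code_lt t.state
  have hlt : 3 * kQ.code t.state + lastBit (c.output ++ t.print.toList) < nControl kQ := by
    unfold nControl
    omega
  set v := d / nControl kQ with hvdef
  have hnext : confNext kQ (2 ^ m) t d =
      rotate (2 ^ m) t.workMove (v / 2 * 2 + t.write.toNat) * nControl kQ +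
        (3 * kQ.code t.state + lastBit (c.output ++ t.print.toList)) := by
    rw [confNext, confNextAt, hj, lastBit_append]
  have hw : v / 2 * 2 + t.write.toNat < 2 ^ m := by
    obtain ⟨n, rfl⟩ := Nat.exists_eq_succ_of_ne_zero hm
    rw [Nat.succ_eq_add_one, pow_succ'] at *
    have := Bool.toNat_lt t.write
    omega
  have hwb : ∀ k < m, (v / 2 * 2 + t.write.toNat).testBit k =
      Function.update c.work c.workPos t.write
        (c.workPos + k - if c.workPos + k < lo + m then (0 : ℤ) else m) := by
    intro k hk
    rw [testBit_write]
    split_ifs with h1 h2 h2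
    · subst h1; simp
    · omega
    · rw [hb k hk, if_pos h2, Function.update_of_ne (by omega)]
    · rw [hb k hk, if_neg h2, Function.update_of_ne (by omega)]
  have hdiv : confNext kQ (2 ^ m) t d / nControl kQ =
      rotate (2 ^ m) t.workMove (v / 2 * 2 + t.write.toNat) := by
    rw [hnext, push_div _ hlt]
  refine ⟨?_, ?_, ?_⟩
  · rw [hdiv]; exact rotate_lt hm _ hw
  · intro k hk
    rw [hdiv]
    obtain ⟨n, rfl⟩ := Nat.exists_eq_succ_of_ne_zero hm
    cases hmv : t.workMove with
    | stay =>
      simp only [Move.onWork, rotate]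
      exact hwb k hk
    | right =>
      rw [hmv] at hlo'
      simp only [Move.onWork] at hlo' ⊢
      rw [Nat.succ_eq_add_one] at *
      rw [testBit_rotate_right hw]
      by_cases h1 : k < n
      · rw [if_pos h1, hwb _ (by omega)]
        refine congrArg _ ?_
        push_cast at *
        split_ifs <;> omega
      · obtain rfl : k = n := by omega
        have h3 := hwb 0 (by omega)
        rw [Nat.testBit_zero] at h3
        rw [if_neg h1, Nat.sub_self, Nat.testBit_zero, Nat.mod_mod, h3]
        refine congrArg _ ?_
        push_cast at *
        split_ifs <;> omega
    | left =>
      rw [hmv] at hlo'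
      simp only [Move.onWork] at hlo' ⊢
      rw [Nat.succ_eq_add_one] at *
      rw [testBit_rotate_left hw k hk]
      by_cases h1 : k = 0
      · rw [if_pos h1, hwb _ (by omega)]
        refine congrArg _ ?_
        push_cast at *
        split_ifs <;> omega
      · rw [if_neg h1, hwb _ (by omega)]
        obtain ⟨k, rfl⟩ := Nat.exists_eq_succ_of_ne_zero h1
        refine congrArg _ ?_
        rw [Nat.succ_eq_add_one, Nat.add_sub_cancel]
        push_cast at *
        split_ifs <;> omega
  · rw [hnext, Nat.mul_comm, Nat.mul_add_mod, Nat.mod_eq_of_lt hlt]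

/-- Transfers the actual computation to numbers, by induction backwards from the halting
configuration. The time left at step `i` is `T - i`. -/
theorem IsRun.haltsIn {w : List α} {c : ℕ → Config M.Q Bool} {T : ℕ}
    (hc : IsRun M (plainTape w) c T)
    (hlo : ∀ i ≤ T, lo ≤ (c i).workPos ∧ (c i).workPos < lo + m) {i : ℕ} (hi : i ≤ T) {d : ℕ}
    (hd : CycRep kQ m lo (c i) d) :
    HaltsIn kQ (fun p => (plainTape w).getD p .rightEnd) (2 ^ m) (lastBit (c T).output)
      (T - i) d (c i).inputPos := by
  induction hi using Nat.decreasingInduction generalizing d with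
  | self =>
    rw [Nat.sub_self]
    refine ⟨?_, ?_⟩
    · rw [hd.action_eq (hlo T le_rfl)]
      have := hc.halt
      unfold Machine.step at this
      exact Option.map_eq_none_iff.1 this
    · rw [hd.control, Nat.mul_add_mod, Nat.mod_eq_of_lt (lastBit_lt _)]
  | of_succ i hi ih =>
    rw [show T - i = T - (i + 1) + 1 by omega]
    have hs := hc.step i hi
    unfold Machine.step at hs
    obtain ⟨t, ht, he⟩ := Option.map_eq_some_iff.1 hs
    refine ⟨t, ?_, ?_⟩
    · rw [hd.action_eq (hlo i hi.le)]; exact ht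
    · have h1 := hlo (i + 1) hi
      rw [← he] at h1
      have h2 := hd.next (hlo i hi.le) t (t.inputMove.onInput (plainTape w).length (c i).inputPos)
        h1
      rw [he] at h2
      have h3 := ih h2
      have hp := hc.inputPos_le hi.le
      rw [length_plainTape] at hp
      rwa [← he, onInput_plainTape w (by omega)] at h3

theorem exists_haltsIn {w : List α} {b : Bool} (h : M.Outputs (plainTape w) [b])
    (hm : (M.usedCells (plainTape w)).encard ≤ m) :
    ∃ t, HaltsIn kQ (fun p => (plainTape w).getD p .rightEnd) (2 ^ m) (1 + b.toNat) t
      (3 * kQ.code M.start) 0 := by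
  obtain ⟨c, T, hc, hb⟩ := h.exists_isRun
  obtain ⟨lo, hlo⟩ := hc.exists_window hm
  have := hc.haltsIn (kQ := kQ) hlo (Nat.zero_le T) (d := 3 * kQ.code M.start)
    (by rw [hc.zero]; exact .init)
  rw [hb, hc.zero] at this
  exact ⟨_, this⟩

end

/-! ### Programs with a uniform bound for the registers -/

/-- Pairing at most squares sizes up to a constant factor, so a fixed factor 4 in the exponent is
enough. Nested tuples then have explicit exponents. -/
theorem enc_pair_add_two_le {α β : Type} [Enc α] [Enc β] {a : α} {b : β} {X c : ℕ}
    (ha : enc a + 2 ≤ (X + 2) ^ c) (hb : enc b + 2 ≤ (X + 2) ^ c) :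
    enc (a, b) + 2 ≤ (X + 2) ^ (c * 4) := by
  rw [enc_pair, pow_mul]
  have h := cpair_le (enc a) (enc b)
  simp only at *
  generalize (X + 2) ^ c = Y at *
  obtain ⟨Z, rfl⟩ := Nat.exists_eq_add_of_le' (show 2 ≤ Y by omega)
  have h1 : (enc a + enc b + 1) ^ 2 ≤ (2 * Z + 1) ^ 2 := Nat.pow_le_pow_left (by omega) 2
  have h2 : (2 * Z + 1) ^ 2 + 2 ≤ (Z + 2) ^ 4 := by
    have : (Z + 2) ^ 4 = Z ^ 4 + 8 * Z ^ 3 + 24 * Z ^ 2 + 32 * Z + 16 := by ring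
    rw [this]
    nlinarith [Nat.zero_le (Z ^ 4), Nat.zero_le (Z ^ 3), Nat.zero_le (Z ^ 2)]
  omega

theorem enc_nat_add_two_le {x X c : ℕ} (hx : x ≤ X) (hc : c ≠ 0) : enc x + 2 ≤ (X + 2) ^ c :=
  (Nat.add_le_add_right hx 2).trans (Nat.le_self_pow hc _)

theorem Lin.exists_prog {α β : Type} [Enc α] [Enc β] {f : α → β} (hf : Lin f) :
    ∃ (p : (γ : Type) → Prog γ) (e : ℕ), ∀ (γ : Type) (tape : List (InputSymbol γ)) (B Y : ℕ)
      (a : α), enc a + 2 ≤ Y → Y ^ e ≤ B →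
      RegRun tape B (p γ) (single (enc a)) (single (enc (f a))) := by
  obtain ⟨p, u, ⟨c, hu⟩, hp⟩ := hf
  refine ⟨fun γ => p γ 0, c + 1, fun γ tape B Y a ha hB => hp γ tape B 0 _ a ?_⟩
  exact (hu a).trans ((Nat.pow_le_pow_left ha _).trans hB)

theorem exists_while_prog {α : Type} [Enc α] {f : α → α} {t : α → ℕ} (hf : Lin f) (ht : Lin t) :
    ∃ (p : (γ : Type) → Prog γ) (e : ℕ), ∀ (γ : Type) (tape : List (InputSymbol γ)) (B Y : ℕ)
      (x : ℕ → α) (n : ℕ), (∀ i < n, x (i + 1) = f (x i)) → (∀ i < n, t (x i) ≠ 0) →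
        t (x n) = 0 → (∀ i ≤ n, enc (x i) + 2 ≤ Y) → Y ^ e ≤ B →
        RegRun tape B (p γ) (single (enc (x 0))) (single (enc (x n))) := by
  obtain ⟨p, u, ⟨c, hu⟩, hp⟩ := exists_while hf ht
  refine ⟨p, c + 1, fun γ tape B Y x n h1 h2 h3 h4 hB => hp γ tape B x n h1 h2 h3 fun i hi => ?_⟩
  exact (hu _).trans ((Nat.pow_le_pow_left (h4 i hi) _).trans hB)

/-- Powers: from `(k, b, a)` to `(0, b, a * b ^ k)`. -/
theorem exists_power_prog : ∃ (p : (γ : Type) → Prog γ) (e : ℕ), ∀ (γ : Type)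
    (tape : List (InputSymbol γ)) (B X k b : ℕ), 0 < b → k ≤ X → b ≤ X → b ^ k ≤ X →
      ((X + 2) ^ 16) ^ e ≤ B →
      RegRun tape B (p γ) (single (enc (k, b, 1))) (single (enc (0, b, b ^ k))) := by
  have h1 : Lin fun x : ℕ × ℕ × ℕ => x.1 := .fst
  have h2 : Lin fun x : ℕ × ℕ × ℕ => x.2.1 := Lin.fst.comp .snd
  have h3 : Lin fun x : ℕ × ℕ × ℕ => x.2.2 := Lin.snd.comp .snd
  obtain ⟨p, e, hp⟩ := exists_while_prog (h1.pred.pair (h2.pair (h3.mul h2))) h1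
  refine ⟨p, e, fun γ tape B X k b hb hk hbX hX hB => ?_⟩
  have := hp γ tape B ((X + 2) ^ 16) (fun i => (k - i, b, b ^ i)) k (fun i hi => by
    simp only [pow_succ]; rw [Nat.sub_sub]) (fun i hi => by simp only; omega) (by simp)
    (fun i hi => enc_pair_add_two_le (c := 4) (enc_nat_add_two_le (by omega) (by norm_num))
      (enc_pair_add_two_le (c := 1) (enc_nat_add_two_le hbX one_ne_zero)
        (enc_nat_add_two_le ((Nat.pow_le_pow_right hb hi).trans hX) one_ne_zero))) hB
  simpa using this

/-! ### Reading the input -/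

/-- Applies programs to the registers while reading the input, until a symbol for which no
program is given. -/
def Prog.scan {α : Type} (body : InputSymbol α → Option (Prog α)) : Prog α :=
  .seq (.inc 1) (.loop 1 (.seq (.dec 1) (.switch fun a =>
    (body a).elim .skip fun p => .seq p (.seq .advance (.inc 1)))))

theorem update_single_one (v x : ℕ) :
    Function.update (single v) 1 x = frame (fun _ => 0) 0 [v, x] := by
  have := update_frame (fun _ => 0) 0 1 x (l := [v, 0]) (by simp)
  rw [frame_pad₁] at this
  simpa [single] using this

theorem single_eq_frame (v : ℕ) : frame (fun _ => 0) 0 [v, 0] = single v := frame_pad₁ _ _ _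

/-- Register 1 is a flag that is cleared before the symbol is inspected and set again only after a
program has been applied. The scan thus stops on the first other symbol without passing it. By
`hlen` no advance is blocked by the end of the tape. -/
theorem Run.scan {α : Type} {tape : List (InputSymbol α)} {B : ℕ}
    {body : InputSymbol α → Option (Prog α)} (hB : 1 ≤ B) (v : ℕ → ℕ) (i n : ℕ) (o : List Bool)
    (hlen : i + n < tape.length)
    (h : ∀ j < n, ∃ p, body (tape.getD (i + j) .rightEnd) = some p ∧
      RegRun tape B p (single (v j)) (single (v (j + 1))))
    (hn : body (tape.getD (i + n) .rightEnd) = none) :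
    Run tape B (.scan body) ⟨single (v 0), i, o⟩ ⟨single (v n), i + n, o⟩ := by
  have hinc : ∀ v : ℕ, ∀ i, Run tape B (.inc 1) ⟨single v, i, o⟩
      ⟨frame (fun _ => 0) 0 [v, 1], i, o⟩ := fun v i => by
    have h0 : single v 1 = 0 := by simp [single, frame]
    have := Run.inc (tape := tape) (B := B) 1 ⟨single v, i, o⟩ (by simpa [h0] using hB)
    simpa only [h0, Nat.zero_add, update_single_one] using this
  have hdec : ∀ v : ℕ, ∀ i, Run tape B (.dec 1) ⟨frame (fun _ => 0) 0 [v, 1], i, o⟩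
      ⟨single v, i, o⟩ := fun v i => by
    have := Run.dec (tape := tape) (B := B) 1 ⟨frame (fun _ => 0) 0 [v, 1], i, o⟩
      (by simp [frame])
    have h0 : frame (fun _ => 0) 0 [v, 1] 1 - 1 = 0 := by simp [frame]
    have h1 : Function.update (frame (fun _ => 0) 0 [v, 1]) 1 0 = single v := by
      rw [← update_single_one, Function.update_idem, update_single_one, single_eq_frame]
    simpa only [h0, h1] using this
  refine .seq (hinc _ _) ?_
  induction n generalizing i v with
  | zero =>
    refine .loop_step (by simp [frame]) (.seq (hdec _ _) (.switch ?_))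
      (.loop_done (by simp [single, frame]))
    simp only [Nat.add_zero] at hn
    simp only [hn, Option.elim]
    exact .skip _
  | succ n ih =>
    obtain ⟨p, hp, hr⟩ := h 0 (Nat.succ_pos n)
    rw [Nat.add_zero] at hp
    refine .loop_step (w₂ := ⟨frame (fun _ => 0) 0 [v 1, 1], i + 1, o⟩) (by simp [frame])
      (.seq (hdec _ _) (.switch ?_)) ?_
    · simp only [hp, Option.elim]
      refine .seq (hr i o) (.seq (w₂ := ⟨single (v 1), i + 1, o⟩) ?_ (hinc _ _))
      have := Run.advance (B := B) (tape := tape) ⟨single (v (0 + 1)), i, o⟩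
      rwa [Move.onInput, min_eq_left (by simp only; omega)] at this
    · have := ih (fun j => v (j + 1)) (i + 1) (by omega) (fun j hj => by
        have := h (j + 1) (by omega)
        rwa [show i + 1 + j = i + (j + 1) by omega]) (by
        rwa [show i + 1 + n = i + (n + 1) by omega])
      rwa [show i + 1 + n = i + (n + 1) by omega] at this

/-! ### Cells of the shifted input tape -/

theorem length_shiftedTape {α : Type} (w : List α) :
    (shiftedTape w).length = 2 * w.length + 2 := by
  simp [shiftedTape]; omega

theorem getD_shiftedTape_blank {α : Type} (w : List α) {j : ℕ} (hj : j < w.length) :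
    (shiftedTape w).getD (1 + j) .rightEnd = .blank := by
  rw [shiftedTape, Nat.add_comm, List.getD_cons_succ, List.append_assoc,
    List.getD_append _ _ _ _ (by simpa)]
  simp [hj]

theorem getD_shiftedTape {α : Type} (w : List α) (j : ℕ) :
    (shiftedTape w).getD (1 + w.length + j) .rightEnd = (plainTape w).getD (1 + j) .rightEnd := by
  rw [shiftedTape, plainTape, show 1 + w.length + j = w.length + j + 1 by omega, Nat.add_comm 1 j,
    List.getD_cons_succ, List.getD_cons_succ, List.append_assoc,
    List.getD_append_right _ _ _ _ (by simp)]
  simp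

/-! ### Computing the result from the transition tables -/

section

variable {α : Type} {M : Machine α Bool} (kQ : Coding M.Q)

/-- The numbers after `i` cells of the input have been processed. -/
def scanState (w : List α) (P N : ℕ) (i : ℕ) : TableState :=
  Nat.rec (motive := fun _ => TableState) (P, N, 0, 3 + 3 * kQ.code M.start)
    (fun i x => scanCell kQ ((plainTape w).getD i .rightEnd) x) i

variable {kQ}

theorem scanState_fst (w : List α) (P N : ℕ) (i : ℕ) :
    (scanState kQ w P N i).1 = P ∧ (scanState kQ w P N i).2.1 = N := by
  induction i with
  | zero => exact ⟨rfl, rfl⟩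
  | succ i ih => exact ih

theorem nConf_pos {P : ℕ} (hP : 0 < P) : 0 < nConf kQ P := Nat.mul_pos (nControl_pos kQ) hP

theorem nEntry_le_pow {P : ℕ} (hP : 0 < P) : nEntry kQ P ≤ nEntry kQ P ^ nConf kQ P :=
  Nat.le_self_pow (nConf_pos hP).ne' _

theorem start_lt_nConf {P : ℕ} (hP : 0 < P) : 3 * kQ.code M.start < nConf kQ P := by
  have h := kQ.code_lt M.start
  have : nControl kQ ≤ nConf kQ P := Nat.le_mul_of_pos_right _ hP
  unfold nControl at this
  omega

theorem scanState_le (w : List α) {P N : ℕ} (hP : 0 < P) (hN : N = nEntry kQ P ^ nConf kQ P)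
    (i : ℕ) : (scanState kQ w P N i).2.2.1 ≤ N ∧ (scanState kQ w P N i).2.2.2 ≤ N := by
  have h := nEntry_le_pow (kQ := kQ) hP
  rw [← hN] at h
  cases i with
  | zero =>
    refine ⟨Nat.zero_le _, ?_⟩
    have := start_lt_nConf (kQ := kQ) hP
    show 3 + 3 * kQ.code M.start ≤ N
    unfold nEntry at h
    omega
  | succ i =>
    obtain ⟨h1, h2⟩ := scanState_fst (kQ := kQ) w P N i
    have := scanCell_le (kQ := kQ) (a := (plainTape w).getD i .rightEnd)
      (x := scanState kQ w P N i) (by rwa [h1, h2])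
    rwa [h2] at this

/-- The scan starts with the actual initial configuration on the left endmarker. After the right
endmarker the fourth number cannot stand for a further exit to the right, so it is the printed bit,
coded as 1 or 2. -/
theorem scanState_result {w : List α} {b : Bool} {m N : ℕ} (h : M.Outputs (plainTape w) [b])
    (hm : (M.usedCells (plainTape w)).encard ≤ m) (hm0 : m ≠ 0)
    (hN : N = nEntry kQ (2 ^ m) ^ nConf kQ (2 ^ m)) :
    (scanState kQ w (2 ^ m) N (w.length + 2)).2.2.2 = 1 + b.toNat := by
  obtain ⟨t, ht⟩ := exists_haltsIn (kQ := kQ) h hm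
  have hb : 1 + b.toNat < 3 := by have := Bool.toNat_lt b; omega
  have hstep : ∀ i, _ := fun i => scanCell_spec (kQ := kQ)
    (sym := fun p => (plainTape w).getD p .rightEnd) (i := i) (b := 1 + b.toNat)
    (x := scanState kQ w (2 ^ m) N i) hm0 (scanState_fst w _ N i).1
    (by rw [(scanState_fst w _ N i).1, (scanState_fst w _ N i).2]; exact hN) hb
  have key : ∀ i ≤ w.length + 1,
      ((plainTape w).getD i .rightEnd = .leftEnd ∨ 0 < i ∧
        GoodTable kQ (fun p => (plainTape w).getD p .rightEnd) (scanState kQ w (2 ^ m) N i).1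
          (1 + b.toNat) (scanState kQ w (2 ^ m) N i).2.2.1 (i - 1)) ∧
      ((scanState kQ w (2 ^ m) N i).2.2.2 = 1 + b.toNat ∨
        ∃ c < nConf kQ (scanState kQ w (2 ^ m) N i).1, ∃ t,
          (scanState kQ w (2 ^ m) N i).2.2.2 = 3 + c ∧
          HaltsIn kQ (fun p => (plainTape w).getD p .rightEnd) (scanState kQ w (2 ^ m) N i).1
            (1 + b.toNat) t c i) := by
    intro i hi
    induction i with
    | zero => exact ⟨Or.inl rfl, Or.inr ⟨_,
      show 3 * kQ.code M.start < nConf kQ (2 ^ m) from start_lt_nConf (by positivity), t, rfl, ht⟩⟩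
    | succ i ih =>
      obtain ⟨h1, h2⟩ := ih (by omega)
      obtain ⟨h3, h4⟩ := hstep i h1 h2
      exact ⟨Or.inr ⟨Nat.succ_pos i, h3⟩, h4.imp_right And.right⟩
  obtain ⟨h1, h2⟩ := key (w.length + 1) le_rfl
  rcases (hstep (w.length + 1) h1 h2).2 with h3 | ⟨h3, -⟩
  · exact h3
  · refine absurd ?_ h3
    show (plainTape w).getD (w.length + 1) .rightEnd = .rightEnd
    rw [getD_plainTape, if_neg (by omega), List.getElem?_eq_none (by omega)]
    rfl

end

/-! ### The online machine -/

theorem pow_le_of_pow_add_le {Y a b B : ℕ} (hY : 0 < Y) (h : Y ^ (a + b) ≤ B) :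
    Y ^ a ≤ B ∧ Y ^ b ≤ B :=
  ⟨(Nat.pow_le_pow_right hY (Nat.le_add_right a b)).trans h,
    (Nat.pow_le_pow_right hY (Nat.le_add_left b a)).trans h⟩

/-- Six components need five nested pairings, whence the exponent 1024 = 4^5. Likewise four
components give 64 = 4^3 below. -/
theorem enc_simState_add_two_le {X : ℕ} : ∀ x : SimState, x.1 ≤ X → x.2.1 ≤ X → x.2.2.1 ≤ X →
    x.2.2.2.1 ≤ X → x.2.2.2.2.1 ≤ X → x.2.2.2.2.2 ≤ X → enc x + 2 ≤ (X + 2) ^ 1024 :=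
  fun ⟨_, _, _, _, _, _⟩ h1 h2 h3 h4 h5 h6 =>
    enc_pair_add_two_le (c := 256) (enc_nat_add_two_le h1 (by norm_num))
      (enc_pair_add_two_le (c := 64) (enc_nat_add_two_le h2 (by norm_num))
      (enc_pair_add_two_le (c := 16) (enc_nat_add_two_le h3 (by norm_num))
      (enc_pair_add_two_le (c := 4) (enc_nat_add_two_le h4 (by norm_num))
      (enc_pair_add_two_le (c := 1) (enc_nat_add_two_le h5 (by norm_num))
        (enc_nat_add_two_le h6 (by norm_num))))))

theorem enc_scanState_add_two_le {X : ℕ} : ∀ x : TableState, x.1 ≤ X → x.2.1 ≤ X →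
    x.2.2.1 ≤ X → x.2.2.2 ≤ X → enc x + 2 ≤ (X + 2) ^ 64 :=
  fun ⟨_, _, _, _⟩ h1 h2 h3 h4 =>
    enc_pair_add_two_le (c := 16) (enc_nat_add_two_le h1 (by norm_num))
      (enc_pair_add_two_le (c := 4) (enc_nat_add_two_le h2 (by norm_num))
      (enc_pair_add_two_le (c := 1) (enc_nat_add_two_le h3 (by norm_num))
        (enc_nat_add_two_le h4 (by norm_num))))

/-- A function computed by a machine with a unary input alphabet is computed by a program. -/
theorem exists_unary_prog {Γ : Type} [Finite Γ] [Inhabited Γ] {M : Machine Unit Γ} {f s : ℕ → ℕ}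
    (hM : M.ComputesInSpace plainTape (fun w => binary (f w.length)) s) :
    ∃ (p : (γ : Type) → Prog γ) (e k g : ℕ), ∀ (γ : Type) (tape : List (InputSymbol γ))
      (B X n : ℕ), n + 1 ≤ X → k ≤ X → g ^ s n ≤ X → f n ≤ X → ((X + 2) ^ 1024) ^ e ≤ B →
      RegRun tape B (p γ) (single n) (single (f n)) := by
  have := M.finite_Q
  obtain ⟨kQ, -⟩ := exists_coding M.start
  obtain ⟨kΓ, hk⟩ := exists_coding (default : Γ)
  have h0 : Lin fun n : ℕ => ((n, kQ.code M.start, 0, 0, 0, 0) : SimState) :=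
    Lin.id.pair ((Lin.const _).pair ((Lin.const _).pair ((Lin.const _).pair
      ((Lin.const _).pair (.const _)))))
  have h6 : Lin fun x : SimState => x.2.2.2.2.2 :=
    Lin.snd.comp (Lin.snd.comp (Lin.snd.comp (Lin.snd.comp .snd)))
  obtain ⟨p₁, e₁, hp₁⟩ := h0.exists_prog
  obtain ⟨p₂, e₂, hp₂⟩ := exists_while_prog (lin_simStep kQ kΓ) (lin_simRunning kQ kΓ)
  obtain ⟨p₃, e₃, hp₃⟩ := h6.exists_prog
  refine ⟨fun γ => .seq (p₁ γ) (.seq (p₂ γ) (p₃ γ)), e₁ + (e₂ + e₃), kQ.card, kΓ.card + 1,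
    fun γ tape B X n hn hkX hg hf hB => ?_⟩
  have hY : 0 < (X + 2) ^ 1024 := Nat.pow_pos (by omega)
  obtain ⟨hB₁, hB⟩ := pow_le_of_pow_add_le hY hB
  obtain ⟨hB₂, hB₃⟩ := pow_le_of_pow_add_le hY hB
  obtain ⟨h1, h2⟩ := hM (List.replicate n ())
  simp only [List.length_replicate] at h1 h2
  obtain ⟨c, T, hc, hv⟩ := h1.exists_isRun
  have hrep := fun {i} (hi : i ≤ T) => IsRun.simRep (kQ := kQ) hk (n := n) hc hi
  have hle : ∀ i ≤ T, enc ((simStep kQ kΓ)^[i] (n, kQ.code M.start, 0, 0, 0, 0)) + 2 ≤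
      (X + 2) ^ 1024 := fun i hi => by
    obtain ⟨b1, b2, b3, b4, b5, b6⟩ := IsRun.simRep_le hk (n := n) hc h2 hi (hrep hi)
    rw [hv, bitVal_binary] at b6
    exact enc_simState_add_two_le _ (b1.trans_le (by omega)) (b2.le.trans hkX) (b3.trans hn)
      (b4.le.trans hg) (b5.le.trans hg) (b6.trans hf)
  refine (hp₁ γ tape B _ n (enc_nat_add_two_le (by omega) (by norm_num)) hB₁).seq
    ((hp₂ γ tape B _ (fun i => (simStep kQ kΓ)^[i] (n, kQ.code M.start, 0, 0, 0, 0)) T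
      (fun i _ => Function.iterate_succ_apply' _ _ _)
      (fun i hi => (hrep hi.le).running_of_some (hc.step i hi))
      ((hrep le_rfl).running_of_none hc.halt) hle hB₂).seq ?_)
  have h3 := hp₃ γ tape B _ _ (hle T le_rfl) hB₃
  rw [(hrep le_rfl).out, hv, bitVal_binary] at h3
  exact h3

section

variable {α : Type} {M : Machine α Bool} (kQ : Coding M.Q)

/-- The constants `P` and `N` are computed by two runs of the power program. `X` need only bound the
larger number `N`, which dominates all intermediate values. -/
theorem exists_table_prog (C : ℕ) :
    ∃ (p : (γ : Type) → Prog γ) (e : ℕ), ∀ (γ : Type) (tape : List (InputSymbol γ))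
      (B X n : ℕ), nEntry kQ (2 ^ (n + C)) ^ nConf kQ (2 ^ (n + C)) ≤ X →
      ((X + 2) ^ 64) ^ e ≤ B → RegRun tape B (p γ) (single n)
        (single (enc ((2 ^ (n + C), nEntry kQ (2 ^ (n + C)) ^ nConf kQ (2 ^ (n + C)), 0,
          3 + 3 * kQ.code M.start) : TableState))) := by
  have h2 : Lin fun x : ℕ × ℕ × ℕ => x.2.1 := Lin.fst.comp .snd
  have h3 : Lin fun x : ℕ × ℕ × ℕ => x.2.2 := Lin.snd.comp .snd
  have l₁ : Lin fun n : ℕ => ((n + C, 2, 1) : ℕ × ℕ × ℕ) :=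
    (Lin.id.add (.const C)).pair ((Lin.const 2).pair (.const 1))
  have l₂ : Lin fun x : ℕ × ℕ × ℕ => ((nConf kQ x.2.2, nEntry kQ x.2.2, 1) : ℕ × ℕ × ℕ) :=
    (lin_nConf kQ h3).pair ((lin_nEntry kQ h3).pair (.const 1))
  have l₃ : Lin fun x : ℕ × ℕ × ℕ =>
      (((x.2.1 - 3) / nControl kQ, x.2.2, 0, 3 + 3 * kQ.code M.start) : TableState) :=
    ((h2.sub (.const 3)).div (.const _)).pair (h3.pair ((Lin.const _).pair (.const _)))
  obtain ⟨p₁, e₁, hp₁⟩ := l₁.exists_prog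
  obtain ⟨p₂, e₂, hp₂⟩ := l₂.exists_prog
  obtain ⟨p₃, e₃, hp₃⟩ := l₃.exists_prog
  obtain ⟨q, e₄, hq⟩ := exists_power_prog
  refine ⟨fun γ => .seq (p₁ γ) (.seq (q γ) (.seq (p₂ γ) (.seq (q γ) (p₃ γ)))),
    e₁ + (e₂ + (e₃ + e₄)), fun γ tape B X n hX hB => ?_⟩
  have hY : 0 < (X + 2) ^ 64 := Nat.pow_pos (by omega)
  obtain ⟨hB₁, hB⟩ := pow_le_of_pow_add_le hY hB
  obtain ⟨hB₂, hB⟩ := pow_le_of_pow_add_le hY hB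
  obtain ⟨hB₃, hB₄⟩ := pow_le_of_pow_add_le hY hB
  have hP : 0 < 2 ^ (n + C) := Nat.pow_pos (by norm_num)
  have a1 : n + C < 2 ^ (n + C) := Nat.lt_two_pow_self
  have a2 := nEntry_le_pow (kQ := kQ) hP
  have a3 : nControl kQ ≠ 0 := (nControl_pos kQ).ne'
  have a4 : 2 ^ (n + C) ≤ nConf kQ (2 ^ (n + C)) := Nat.le_mul_of_pos_left _ (nControl_pos kQ)
  have a5 : nEntry kQ (2 ^ (n + C)) = nConf kQ (2 ^ (n + C)) + 3 := rfl
  have hB₅ : ((X + 2) ^ 16) ^ e₄ ≤ B :=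
    (Nat.pow_le_pow_left (Nat.pow_le_pow_right (by omega) (by norm_num)) _).trans hB₄
  have b₁ : enc n + 2 ≤ (X + 2) ^ 64 := enc_nat_add_two_le (by omega) (by norm_num)
  have trip : ∀ x y z : ℕ, x ≤ X → y ≤ X → z ≤ X → enc (x, y, z) + 2 ≤ (X + 2) ^ 64 :=
    fun x y z hx hy hz => (enc_pair_add_two_le (c := 4) (enc_nat_add_two_le hx (by norm_num))
      (enc_pair_add_two_le (c := 1) (enc_nat_add_two_le hy (by norm_num))
        (enc_nat_add_two_le hz (by norm_num)))).trans (Nat.pow_le_pow_right (by omega) (by norm_num))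
  have r₁ := hp₁ γ tape B _ n b₁ hB₁
  have r₂ := hq γ tape B X (n + C) 2 (by norm_num) (by omega) (by omega) (by omega) hB₅
  generalize 2 ^ (n + C) = P at *
  have r₃ := hp₂ γ tape B _ (0, 2, P) (trip _ _ _ (by omega) (by omega) (by omega)) hB₂
  have r₄ := hq γ tape B X (nConf kQ P) (nEntry kQ P) (by omega) (by omega) (by omega) hX hB₅
  have r₅ := hp₃ γ tape B _ (0, nEntry kQ P, nEntry kQ P ^ nConf kQ P)
    (trip _ _ _ (by omega) (by omega) hX) hB₃
  -- The second power run keeps only its base `nEntry kQ P`, and `P` is recovered from it.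
  have h : (nEntry kQ P - 3) / nControl kQ = P := by
    rw [a5, Nat.add_sub_cancel, nConf, Nat.mul_div_cancel_left _ (nControl_pos kQ)]
  simp only [h] at r₅
  exact r₁.seq (r₂.seq (r₃.seq (r₄.seq r₅)))

/-- The whole algorithm in one pass: count the empty symbols, compute `f n` and the constants, then
process the cells of the ordinary tape. Its left endmarker is processed without being scanned, since
the head passed the real one at the start. -/
theorem exists_decider_prog [Finite α] {Γ : Type} [Finite Γ] [Inhabited Γ] {U : Machine Unit Γ}
    {f s s' : ℕ → ℕ} {F : List α → Bool} (C : ℕ) (hC : C ≠ 0)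
    (hU : U.ComputesInSpace plainTape (fun w => binary (f w.length)) s)
    (hM : M.ComputesInSpace plainTape (fun w => [F w]) s') (hs : ∀ n, s' n ≤ f n + C) :
    ∃ (p : Prog α) (e k g : ℕ), ∀ (w : List α) (X : ℕ), w.length + 1 ≤ X → k ≤ X →
      g ^ s w.length ≤ X →
      nEntry kQ (2 ^ (f w.length + C)) ^ nConf kQ (2 ^ (f w.length + C)) ≤ X →
      ∃ r, Run (shiftedTape w) ((X + 2) ^ e) p ⟨fun _ => 0, 0, []⟩ r ∧ r.out = [F w] := by
  obtain ⟨p₁, e₁, k, g, hp₁⟩ := exists_unary_prog hU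
  obtain ⟨p₂, e₂, hp₂⟩ := exists_table_prog kQ C
  have hscan := fun a : InputSymbol α => (lin_scanCell kQ a).exists_prog
  choose q e hq using hscan
  -- The alphabet is finite, so one exponent serves the programs for all input symbols.
  obtain ⟨E, hE⟩ := (Set.finite_range e).bddAbove
  have hE : ∀ a, e a ≤ E := fun a => hE ⟨a, rfl⟩
  have hD : Lin fun x : TableState => x.2.2.2 - 1 := (Lin.snd.comp (Lin.snd.comp .snd)).pred
  obtain ⟨p₃, e₃, hp₃⟩ := hD.exists_prog
  refine ⟨.seq .advance (.seq (.scan fun | .blank => some (.inc 0) | _ => none)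
    (.seq (p₁ α) (.seq (p₂ α) (.seq (q .leftEnd α) (.seq
      (.scan fun | .letter l => some (q (.letter l) α) | _ => none)
      (.seq (q .rightEnd α) (.seq (p₃ α) (.ifz 0 (.print false) (.print true))))))))),
    1024 * (1 + (e₁ + (e₂ + (e₃ + E)))), k, g, fun w X hn hk hg hN => ?_⟩
  rw [pow_mul]
  obtain ⟨B, hB⟩ : ∃ B, B = ((X + 2) ^ 1024) ^ (1 + (e₁ + (e₂ + (e₃ + E)))) := ⟨_, rfl⟩
  rw [← hB]
  replace hB := hB.ge
  have hY : 0 < (X + 2) ^ 1024 := Nat.pow_pos (by omega)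
  obtain ⟨hB₀, hB⟩ := pow_le_of_pow_add_le hY hB
  obtain ⟨hB₁, hB⟩ := pow_le_of_pow_add_le hY hB
  obtain ⟨hB₂, hB⟩ := pow_le_of_pow_add_le hY hB
  obtain ⟨hB₃, hB₄⟩ := pow_le_of_pow_add_le hY hB
  have hB₂' : ((X + 2) ^ 64) ^ e₂ ≤ B :=
    (Nat.pow_le_pow_left (Nat.pow_le_pow_right (by omega) (by norm_num)) _).trans hB₂
  have hXB : X + 2 ≤ B := by
    rw [pow_one] at hB₀
    exact (Nat.le_self_pow (by norm_num) _).trans hB₀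
  set n := w.length with hnw
  set P := 2 ^ (f n + C) with hP
  have hP0 : 0 < P := Nat.pow_pos (by norm_num)
  set N := nEntry kQ P ^ nConf kQ P with hNdef
  have c1 : f n + C < P := Nat.lt_two_pow_self
  have c2 : nEntry kQ P ≤ N := nEntry_le_pow hP0
  have c3 : P ≤ nConf kQ P := Nat.le_mul_of_pos_left _ (nControl_pos kQ)
  have c4 : nEntry kQ P = nConf kQ P + 3 := rfl
  have hsmall : ∀ i, enc (scanState kQ w P N i) + 2 ≤ (X + 2) ^ 1024 := fun i => by
    obtain ⟨h1, h2⟩ := scanState_fst (kQ := kQ) w P N i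
    obtain ⟨h3, h4⟩ := scanState_le (kQ := kQ) w hP0 hNdef i
    exact (enc_scanState_add_two_le _ (h1.trans_le (by omega)) (h2.trans_le hN) (h3.trans hN)
      (h4.trans hN)).trans (Nat.pow_le_pow_right (by omega) (by norm_num))
  have hcell : ∀ i, RegRun (shiftedTape w) B (q ((plainTape w).getD i .rightEnd) α)
      (single (enc (scanState kQ w P N i))) (single (enc (scanState kQ w P N (i + 1)))) :=
    fun i => hq _ α _ B _ _ (hsmall i) ((Nat.pow_le_pow_right hY (hE _)).trans hB₄)
  have hlen := length_shiftedTape w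
  have hres : (scanState kQ w P N (n + 2)).2.2.2 = 1 + (F w).toNat :=
    scanState_result (hM w).1 ((hM w).2.trans (by exact_mod_cast hs w.length)) (by omega) hNdef
  have hlast := hp₃ α (shiftedTape w) B _ _ (hsmall (n + 2)) hB₃
  simp only [hres, Nat.add_sub_cancel_left, enc_nat] at hlast
  have hget : ∀ j, j < n → ∃ l, (plainTape w).getD (1 + j) .rightEnd = .letter l := fun j hj => by
    rw [getD_plainTape, if_neg (by omega), Nat.add_sub_cancel_left,
      List.getElem?_eq_getElem hj]
    exact ⟨_, rfl⟩
  have hend : (plainTape w).getD (1 + n) .rightEnd = .rightEnd := by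
    rw [getD_plainTape, if_neg (by omega), Nat.add_sub_cancel_left,
      List.getElem?_eq_none le_rfl]
    rfl
  have hfin : Run (shiftedTape w) B (.ifz 0 (.print false) (.print true))
      ⟨single (F w).toNat, 1 + n + n, []⟩ ⟨single (F w).toNat, 1 + n + n, [F w]⟩ := by
    cases F w
    · exact .ifz_zero rfl (.print false _)
    · exact .ifz_pos (by simp [single, frame]) (.print true _)
  refine ⟨_, .seq (w₂ := ⟨single 0, 1, []⟩) ?_ (.seq
    (w₂ := ⟨single n, 1 + n, []⟩) ?_ (.seq
    (hp₁ α _ B X n hn hk hg (by omega) hB₁ _ _) (.seq (hp₂ α _ B X (f n) hN hB₂' _ _)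
    (.seq (hcell 0 _ _) (.seq (w₂ := ⟨single (enc (scanState kQ w P N (n + 1))), 1 + n + n, []⟩)
      ?_ (.seq ?_ (.seq (hlast _ _) hfin))))))), rfl⟩
  · have h0 : single 0 = fun _ => 0 := funext fun j => by cases j <;> rfl
    have := Run.advance (B := B) (tape := shiftedTape w) ⟨fun _ => 0, 0, []⟩
    rw [Move.onInput, min_eq_left (by simp only; omega)] at this
    rw [h0]
    exact this
  · refine Run.scan (by omega) (fun j => j) 1 n [] (by omega) (fun j hj => ?_) ?_
    · rw [getD_shiftedTape_blank w hj]
      refine ⟨_, rfl, ?_⟩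
      have := RegRun.inc (tape := shiftedTape w) (B := B) (r := 0) (σ := single j) (by
        show j + 1 ≤ B
        omega)
      rwa [single, update_frame_self _ _ _ (by simp)] at this
    · have := getD_shiftedTape w 0
      rw [Nat.add_zero, Nat.add_zero] at this
      rw [this, getD_plainTape, if_neg one_ne_zero]
      cases w[1 - 1]? <;> rfl
  · refine Run.scan (by omega) (fun j => enc (scanState kQ w P N (j + 1))) (1 + n) n []
      (by omega) (fun j hj => ?_) ?_
    · rw [getD_shiftedTape]
      have := hcell (j + 1)
      obtain ⟨l, hl⟩ := hget j hj
      rw [hl]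
      rw [Nat.add_comm j 1, hl, Nat.add_comm 1 j] at this
      exact ⟨_, rfl, this⟩
    · rw [getD_shiftedTape, hend]
  · have := hcell (n + 1)
    rw [Nat.add_comm n 1, hend, Nat.add_comm 1 n] at this
    exact this _ _

end

/-! ### The space bound -/

theorem add_le_two_pow {a b x y : ℕ} (ha : a ≤ 2 ^ x) (hb : b ≤ 2 ^ y) :
    a + b ≤ 2 ^ (x + y + 1) := by
  have h1 : 2 ^ x ≤ 2 ^ (x + y) := Nat.pow_le_pow_right (by norm_num) (by omega)
  have h2 : 2 ^ y ≤ 2 ^ (x + y) := Nat.pow_le_pow_right (by norm_num) (by omega)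
  rw [pow_succ]
  omega

theorem mul_le_two_pow {a b x y : ℕ} (ha : a ≤ 2 ^ x) (hb : b ≤ 2 ^ y) : a * b ≤ 2 ^ (x + y) :=
  pow_add 2 x y ▸ Nat.mul_le_mul ha hb

theorem pow_le_two_pow {a x : ℕ} (ha : a ≤ 2 ^ x) (k : ℕ) : a ^ k ≤ 2 ^ (x * k) :=
  pow_mul 2 x k ▸ Nat.pow_le_pow_left ha k

theorem le_two_pow_self (a : ℕ) : a ≤ 2 ^ a := Nat.lt_two_pow_self.le

theorem nEntry_pow_le {α : Type} {M : Machine α Bool} (kQ : Coding M.Q) (m : ℕ) :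
    nEntry kQ (2 ^ m) ^ nConf kQ (2 ^ m) ≤
      2 ^ ((nControl kQ + m + 2 + 1) * (nControl kQ * 2 ^ m)) :=
  pow_le_two_pow (add_le_two_pow (mul_le_two_pow (le_two_pow_self _) le_rfl) (by norm_num)) _

/-- The lower bound on `f` enters the proof only through this divergence. -/
theorem tendsto_atTop_of_log_log_isBigO {f : ℕ → ℕ}
    (hf : (fun n : ℕ => Real.log (Real.log (n : ℝ))) =O[atTop] (fun n : ℕ => (f n : ℝ))) :
    Tendsto f atTop atTop := by
  have h : Tendsto (fun n : ℕ => Real.log (Real.log (n : ℝ))) atTop atTop :=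
    Real.tendsto_log_atTop.comp (Real.tendsto_log_atTop.comp tendsto_natCast_atTop_atTop)
  obtain ⟨c, hc, hb⟩ := hf.exists_pos
  rw [← tendsto_natCast_atTop_iff (R := ℝ)]
  refine tendsto_atTop_mono' _ ?_ (h.const_mul_atTop (inv_pos.2 hc))
  filter_upwards [hb.bound] with n hn
  rw [inv_mul_le_iff₀ hc]
  simpa using (le_abs_self _).trans hn

/-- The logarithm of `le_of_computesInSpace`: the binary counter for `n` needs only O(s(n) + f(n) +
1) cells. -/
theorem size_le_of_computesInSpace {Γ : Type} [Inhabited Γ] [Finite Γ] {M : Machine Unit Γ}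
    {f s : ℕ → ℕ} (hM : M.ComputesInSpace plainTape (fun w => binary (f w.length)) s)
    (hf : Tendsto f atTop atTop) (n : ℕ) :
    Nat.size n ≤ Nat.card M.Q + (Nat.card Γ * s n + (s n + (f n + 1))) + 1 := by
  rw [Nat.size_le, pow_succ]
  have h := (le_of_computesInSpace hM hf n).trans (mul_le_two_pow (le_two_pow_self _)
    (mul_le_two_pow (pow_le_two_pow (le_two_pow_self _) _)
      (mul_le_two_pow (le_two_pow_self _) (le_two_pow_self _))))
  have := Nat.two_pow_pos (Nat.card M.Q + (Nat.card Γ * s n + (s n + (f n + 1))))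
  omega

/-- The exponent of the table bound is linear in `f * 2 ^ f`, because the additive constant `b` in
the number of work cells costs only the factor `2 ^ b`. The summand 1 on the right covers `f = 0`.
-/
theorem exponential_bound (a b f : ℕ) :
    (a + (f + b) + 2 + 1) * (a * 2 ^ (f + b)) ≤
      a * 2 ^ b * (a + b + 4) * (f * 2 ^ f + 1) := by
  have h : 2 ^ f ≤ f * 2 ^ f + 1 := by
    rcases Nat.eq_zero_or_pos f with rfl | hf
    · simp
    · exact (Nat.le_mul_of_pos_left _ hf).trans (Nat.le_succ _)
  calc _ = a * 2 ^ b * ((a + b + 3) * 2 ^ f + f * 2 ^ f) := by rw [pow_add]; ring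
    _ ≤ a * 2 ^ b * ((a + b + 3) * (f * 2 ^ f + 1) + (f * 2 ^ f + 1)) :=
      Nat.mul_le_mul_left _ (Nat.add_le_add (Nat.mul_le_mul_left _ h) (Nat.le_succ _))
    _ = _ := by ring

theorem BinaryOfflineDecidable.mem_oneDSpacePrime {α : Type} [Finite α] (f : ℕ → ℕ)
    (hf : (fun n : ℕ => Real.log (Real.log (n : ℝ))) =O[atTop] (fun n : ℕ => (f n : ℝ)))
    (hcomp : UnaryComputableInSpace f (fun n => f n * 2 ^ f n))
    (L : Language α) (hL : BinaryOfflineDecidable L f) :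
    L ∈ OneDSpacePrime α (fun n => f n * 2 ^ f n) := by
  classical
  obtain ⟨Γ, _, _, U, sU, hsU, hU⟩ := hcomp
  obtain ⟨M, sM, hsM, hM⟩ := hL
  have := M.finite_Q
  have hf' := tendsto_atTop_of_log_log_isBigO hf
  obtain ⟨kQ, -⟩ := exists_coding M.start
  obtain ⟨n₀, hn₀⟩ := eventually_atTop.1 hsM
  -- The sum dominates the space on the short inputs, for which nothing is assumed; the summand 1
  -- makes the window nonempty.
  obtain ⟨C, hC⟩ : ∃ C, C = ∑ i ∈ Finset.range n₀, sM i + 1 := ⟨_, rfl⟩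
  have hsC : ∀ n, sM n ≤ f n + C := fun n => by
    rcases Nat.lt_or_ge n n₀ with h | h
    · have := Finset.single_le_sum (f := sM) (fun i _ => Nat.zero_le _) (Finset.mem_range.2 h)
      omega
    · exact (hn₀ n h).trans (Nat.le_add_right _ _)
  obtain ⟨p, e, k, g, hp⟩ := exists_decider_prog kQ (F := fun w => decide (w ∈ L)) C (by omega)
    hU hM hsC
  obtain ⟨r, hr⟩ := p.exists_usesUpTo
  -- An upper bound for the logarithm of the number `X + 2` chosen below: the summands come from
  -- `n`, from the constants, from the simulation of `U` and from the table.
  set x : ℕ → ℕ := fun n => Nat.size n + (k + 3) + 1 + g * sU n + 1 +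
    (nControl kQ + (f n + C) + 2 + 1) * (nControl kQ * 2 ^ (f n + C)) + 1 with hx
  set A := Nat.card U.Q + Nat.card Γ + k + 10 + g +
    nControl kQ * 2 ^ C * (nControl kQ + C + 4) with hA
  have hxA : ∀ n, x n ≤ A * (sU n + f n * 2 ^ f n + 1) := fun n => by
    have h1 := size_le_of_computesInSpace hU hf' n
    have h2 := exponential_bound (nControl kQ) C (f n)
    have h3 : f n ≤ f n * 2 ^ f n := Nat.le_mul_of_pos_right _ (by positivity)
    simp only [hx, hA]
    generalize nControl kQ * 2 ^ C * (nControl kQ + C + 4) = D at *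
    generalize f n * 2 ^ f n = G at *
    nlinarith [Nat.zero_le (Nat.card U.Q * sU n), Nat.zero_le (Nat.card U.Q * G),
      Nat.zero_le (Nat.card Γ * G), Nat.zero_le (k * sU n), Nat.zero_le (k * G),
      Nat.zero_le (g * G), Nat.zero_le (D * sU n)]
  refine ⟨_, inferInstance, inferInstance, p.toMachine r, fun n => x n * e + 1 + 1,
    p.isOnline_toMachine r, ?_, fun w => ?_⟩
  · have h1 : (fun n => ((x n * e + 1 + 1 : ℕ) : ℝ)) =O[atTop]
        fun n => (sU n : ℝ) + ((f n * 2 ^ f n : ℕ) : ℝ) + 1 := by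
      refine .of_bound ((A * e + 2 : ℕ) : ℝ) (Eventually.of_forall fun n => ?_)
      have h2 : x n * e + 1 + 1 ≤ (A * e + 2) * (sU n + f n * 2 ^ f n + 1) := by
        calc x n * e + 2 ≤ A * (sU n + f n * 2 ^ f n + 1) * e +
              2 * (sU n + f n * 2 ^ f n + 1) :=
              Nat.add_le_add (Nat.mul_le_mul_right e (hxA n)) (by omega)
          _ = _ := by ring
      have h3 : (sU n : ℝ) + ((f n * 2 ^ f n : ℕ) : ℝ) + 1 =
        ((sU n + f n * 2 ^ f n + 1 : ℕ) : ℝ) := by push_cast; ring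
      rw [h3, Real.norm_natCast, Real.norm_natCast]
      exact_mod_cast h2
    refine h1.trans ((hsU.add (isBigO_refl _ _)).add (.of_bound 1 ?_))
    filter_upwards [hf'.eventually_ge_atTop 1] with n hn
    rw [norm_one, one_mul, Real.norm_natCast]
    exact_mod_cast Nat.mul_pos hn (by positivity)
  · have hpw := hp w
    have hw : (fun n => x n * e + 1 + 1) w.length = x w.length * e + 1 + 1 := rfl
    rw [hw]
    generalize w.length = n at *
    set N := nEntry kQ (2 ^ (f n + C)) ^ nConf kQ (2 ^ (f n + C)) with hN
    obtain ⟨r', hrun, hout⟩ := hpw (n + 1 + k + g ^ sU n + N) (by omega) (by omega) (by omega)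
      (by omega)
    have hX : n + 1 + k + g ^ sU n + N + 2 ≤ 2 ^ x n := by
      have h1 : k + 3 ≤ 2 ^ (k + 3) := le_two_pow_self _
      have h := add_le_two_pow (add_le_two_pow (add_le_two_pow (Nat.lt_size_self n).le h1)
        (pow_le_two_pow (le_two_pow_self g) (sU n))) (nEntry_pow_le kQ (f n + C))
      refine le_trans ?_ h
      omega
    -- Registers are at most `(X + 2) ^ e`, so `S = x n * e + 1` bits are enough. The used cells are
    -- among 0, …, S, which explains the second `+ 1` in the space bound.
    have hB : (n + 1 + k + g ^ sU n + N + 2) ^ e < 2 ^ (x n * e + 1) :=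
      (pow_le_two_pow hX e).trans_lt (Nat.pow_lt_pow_right (by norm_num) (Nat.lt_succ_self _))
    have := hrun.outputs hr hB (Nat.succ_ne_zero _)
    rw [hout] at this
    exact this

end SublinearSpace

theorem mainTheorem5 {α : Type} [Finite α] (f : ℕ → ℕ)
    (hf : (fun n : ℕ => Real.log (Real.log (n : ℝ))) =O[atTop] (fun n : ℕ => (f n : ℝ)))
    (hcomp : SublinearSpace.UnaryComputableInSpace f (fun n => f n * 2 ^ f n))
    (L : Language α) (hL : SublinearSpace.BinaryOfflineDecidable L f) :
    L ∈ SublinearSpace.OneDSpacePrime α (fun n => f n * 2 ^ f n) :=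
  hL.mem_oneDSpacePrime f hf hcomp L
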